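/- Let $\mathbf T^2=(\mathbf R/\mathbf Z)^2$, with Lebesgue measure of total mass one. For a function $f$ on $\mathbf T^2$ let $\|\nabla^k f\|_{L^p}$ denote the sum of the $L^p$ norms of the weak partial derivatives of $f$ of order $k$, and $\|f\|_{W^{m,p}}=\sum_{k\le m}\|\nabla^k f\|_{L^p}$ (equal to $+\infty$ if $f\notin W^{m,p}$). Let $s\in\mathbf N$, $s\ge 2$. There exists an integer $\alpha_s\ge 0$ such that for any $p\in(1,\infty)$ and $q\in(1,\infty]$ there exists a constant $K=K_{p,q,s}>0$ such that the following holds. For any real-valued $\rho_*\in W^{s-2,p}(\mathbf T^2)\cap L^\infty(\mathbf T^2)$ with $\int_{\mathbf T^2}\rho_*=1$, any $\delta>0$ and any weak solution $\phi_\infty\in H^1(\mathbf T^2)$ (with $e^{-\phi_\infty}$ integrable) of the Poisson–Boltzmann equation $$-\delta^2\Delta\phi_\infty=e^{-\phi_\infty}-\rho_*\qquad\text{on }\mathbf T^2,$$ one has $\phi_\infty\in W^{s,p}(\mathbf T^2)$ and $$\|\nabla^{s}\phi_\infty\|_{L^p}\le\frac{K}{\delta^2}\Bigl(1+\|e^{-\phi_\infty}\|_{L^\infty}^{\frac{s-2}{2}}\Bigr)\Bigl(1+\|\phi_\infty\|_{W^{2,q}}^{\alpha_s}\Bigr)\Bigl(1+\frac{1}{\delta^{s-2}}\Bigr)\|\rho_*\|_{W^{s-2,p}}.$$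 -/

import Mathlib

open MeasureTheory
open scoped ENNReal

noncomputable section

namespace PoissonBoltzmann

/-- The two-dimensional flat torus `(ℝ/ℤ)²`. -/
abbrev T2 : Type := UnitAddTorus (Fin 2)

/-- Lebesgue measure on the torus, of total mass one (product of the normalised Haar measures). -/
abbrev torusMeasure : Measure T2 := Measure.pi fun _ => AddCircle.haarAddCircle

/-- Smooth real functions on the torus: the corresponding periodic function on `ℝ²` is `C^∞`. -/
def IsTest (ψ : T2 → ℝ) : Prop :=
  ContDiff ℝ ((⊤ : ℕ∞) : WithTop ℕ∞) fun y : Fin 2 → ℝ => ψ fun i => (y i : UnitAddCircle)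

/-- The classical partial derivative on the torus in the `i`-th coordinate direction. -/
def partialDeriv (i : Fin 2) (ψ : T2 → ℝ) (x : T2) : ℝ :=
  deriv (fun t : ℝ => ψ (x + Pi.single i (t : UnitAddCircle))) 0

/-- `g` is the weak derivative `∂₀^a ∂₁^b f` on the torus. -/
def HasWeakPartial (a b : ℕ) (f g : T2 → ℝ) : Prop :=
  Integrable f torusMeasure ∧ Integrable g torusMeasure ∧
    ∀ ψ : T2 → ℝ, IsTest ψ →
      ∫ x, f x * ((partialDeriv 0)^[a] ((partialDeriv 1)^[b] ψ)) x ∂torusMeasure =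
        (-1) ^ (a + b) * ∫ x, g x * ψ x ∂torusMeasure

/-- `f ∈ W^{m,p}` on the torus: all weak derivatives of order at most `m` exist and are in `L^p`. -/
def MemSobolev (m : ℕ) (p : ℝ≥0∞) (f : T2 → ℝ) : Prop :=
  ∀ a b : ℕ, a + b ≤ m → ∃ g, HasWeakPartial a b f g ∧ MemLp g p torusMeasure

/-- `‖∂₀^a ∂₁^b f‖_{L^p}` for the weak derivative, which is unique almost everywhere;
`∞` if there is no such weak derivative. -/
def weakPartialNorm (a b : ℕ) (p : ℝ≥0∞) (f : T2 → ℝ) : ℝ≥0∞ :=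
  ⨅ (g : T2 → ℝ) (_ : HasWeakPartial a b f g), eLpNorm g p torusMeasure

/-- `‖∇^k f‖_{L^p}`, the sum of the `L^p` norms of all partial derivatives of order `k`. -/
def gradNorm (k : ℕ) (p : ℝ≥0∞) (f : T2 → ℝ) : ℝ≥0∞ :=
  ∑ α ∈ Finset.HasAntidiagonal.antidiagonal k, weakPartialNorm α.1 α.2 p f

/-- `‖f‖_{W^{m,p}}`, the sum of the `L^p` norms of all partial derivatives of order at most `m`. -/
def sobolevNorm (m : ℕ) (p : ℝ≥0∞) (f : T2 → ℝ) : ℝ≥0∞ :=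
  ∑ k ∈ Finset.range (m + 1), gradNorm k p f

/-- `φ ∈ H¹` is a weak solution on the torus of `-δ² Δφ = e^{-φ} - ρ`. -/
structure IsWeakSolution (δ : ℝ) (ρ φ : T2 → ℝ) : Prop where
  memSobolev : MemSobolev 1 2 φ
  integrable_exp : Integrable (fun x => Real.exp (-φ x)) torusMeasure
  weak_eq : ∃ G₀ G₁ : T2 → ℝ, HasWeakPartial 1 0 φ G₀ ∧ HasWeakPartial 0 1 φ G₁ ∧
    ∀ ψ : T2 → ℝ, IsTest ψ →
      δ ^ 2 * ∫ x, (G₀ x * partialDeriv 0 ψ x + G₁ x * partialDeriv 1 ψ x) ∂torusMeasure =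
        ∫ x, (Real.exp (-φ x) - ρ x) * ψ x ∂torusMeasure

end PoissonBoltzmann

end

/-!
Write `u = e^{-φ}` and `m = s - 2`. The equation reads `-δ² Δφ = u - ρ`, so the `L^p` theory of the
Laplacian reduces a bound for the derivatives of order `m + 2` of `φ` to one for the derivatives of
order `m` of `u` (`ExpDerivBound.exists_hasWeakPartial`). The latter is proved by induction on `m`,
in the form `‖∇^m u‖_p ≤ C ‖u‖_∞^{m/2} (1 + ‖φ‖_∞)^α (1 + δ^{-m}) ‖ρ‖_{W^{m,p}}`:

* For `m = 0`, testing the equation with (a regularisation of) the decreasing function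
  `e^{-(p-1)φ}` of `φ` gives `‖u‖_p ≤ ‖ρ‖_p` (`IsWeakSolution.eLpNorm_exp_le`). No power of
  `‖u‖_∞` is lost.
* From `m` to `m + 2`, Moser's estimate `‖∇^{m+2} u‖_p ≤ C ‖u‖_∞ (1 + ‖φ‖_∞)^{m+2} ‖∇^{m+2} φ‖_p`
  (`exists_hasWeakPartial_exp_neg`) is combined with the bound for `∇^{m+2} φ`. Two derivatives cost
  one factor `‖u‖_∞` and one factor `δ^{-2}`, which is where the exponent `(s - 2) / 2` comes from
  (`ExpDerivBound.succ_succ`).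
* For `m = 1`, the estimate `‖∂ᵢ u‖_p² ≤ C ‖u‖_p ‖∂ᵢ² u‖_p` interpolates between `m = 0` and `m = 2`
  (`exists_expDerivBound_one`); the step to `m = 2` uses only the bound for `m = 0`.

Finally `‖φ‖_∞ ≤ ‖φ‖_{W^{2,q}}`, since already `W^{2,1}` embeds into `L^∞` in dimension two
(`eLpNorm_top_le_sobolevNorm`), and `1 ≤ ‖u‖_∞` because `u` has integral one.

The analytic tools are proved here for smooth functions and trigonometric polynomials, and carried
over to weak derivatives by Fejér means, which commute with weak derivatives and contract every
`L^p` norm.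

* The Calderón–Zygmund inequality `‖∂ᵢ ∂ⱼ f‖_p ≤ C ‖Δf‖_p` (`exists_eLpNorm_second_le`) follows from
  a Bellman function argument: along the heat flows `F` and `G` of `Δf` and of a dual function `g`,
  the integral of a Bellman function `B(F, G)` whose Hessian dominates `2 |x y|` decreases fast enough
  to control `∫ (∂ᵢ ∂ⱼ f) g`, while `B(F, G)` is of size `|F|^p + |G|^{p'}`.
* The Gagliardo–Nirenberg inequality `‖∂ᵢ f‖_r² ≤ C ‖f‖_a ‖∂ᵢ² f‖_c` for `2/r = 1/a + 1/c`
  (`exists_sq_eLpNorm_partialDeriv_le`) follows from a pointwise bound by the maximal functions of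
  `f` and `∂ᵢ² f` along lines, which are bounded on `L^p` by Garsia's maximal ergodic theorem
  applied to a small translation (`exists_eLpNorm_maximal_le`).
* By this inequality the norms `‖∇^k f‖_{pm/k}` form a log-convex sequence in `k`, and every monomial
  in the derivatives of `e^{-f}` is estimated by Hölder's inequality and log-convexity
  (`exists_eLpNorm_pd_exp_neg_le`).
-/

open Set Filter Topology UnitAddTorus ComplexConjugate

noncomputable section

namespace PoissonBoltzmann

/-! ### Calculus on the torus -/

/-- The translation by `t` in the `i`-th coordinate direction. -/
def shift (i : Fin 2) (t : ℝ) : T2 := Pi.single i (t : UnitAddCircle)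

lemma shift_zero (i : Fin 2) : shift i 0 = 0 := by simp [shift]

lemma shift_one (i : Fin 2) : shift i 1 = 0 := by
  have : ((1 : ℝ) : UnitAddCircle) = 0 := AddCircle.coe_period 1
  simp [shift, this]

lemma shift_add (i : Fin 2) (s t : ℝ) : shift i (s + t) = shift i s + shift i t := by
  simp [shift, ← Pi.single_add]

lemma continuous_shift (i : Fin 2) : Continuous (shift i) :=
  (continuous_single i).comp (AddCircle.continuous_mk' 1)

/-- The covering map of the torus by the plane. -/
def proj (y : Fin 2 → ℝ) : T2 := fun i => (y i : UnitAddCircle)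

lemma isOpenQuotientMap_proj : IsOpenQuotientMap proj :=
  IsOpenQuotientMap.piMap (f := fun (_ : Fin 2) (t : ℝ) => (t : UnitAddCircle))
    fun _ => QuotientAddGroup.isOpenQuotientMap_mk

lemma proj_add_smul_single (y : Fin 2 → ℝ) (i : Fin 2) (t : ℝ) :
    proj (y + t • Pi.single i 1) = proj y + shift i t := by
  ext j
  by_cases h : j = i
  · subst h; simp [proj, shift]
  · simp [proj, shift, h]

/-- `f'` is the classical derivative of `f` in the `i`-th coordinate direction. -/
def HasPartial (i : Fin 2) (f f' : T2 → ℝ) : Prop :=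
  ∀ x, HasDerivAt (fun t : ℝ => f (x + shift i t)) (f' x) 0

namespace HasPartial

variable {i : Fin 2} {f g f' g' : T2 → ℝ}

lemma hasDerivAt (h : HasPartial i f f') (x : T2) (t : ℝ) :
    HasDerivAt (fun t : ℝ => f (x + shift i t)) (f' (x + shift i t)) t := by
  have h1 := h (x + shift i t)
  have h2 : HasDerivAt (fun s : ℝ => f (x + shift i t + shift i (s - t))) (f' (x + shift i t)) t := by
    have := HasDerivAt.comp_sub_const t t (f := fun s => f (x + shift i t + shift i s))
      (by simpa using h1)
    simpa using this
  refine h2.congr_of_eventuallyEq (Eventually.of_forall fun s => ?_)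
  simp only [add_assoc, ← shift_add, add_sub_cancel]

lemma partialDeriv_eq (h : HasPartial i f f') : partialDeriv i f = f' := by
  ext x; exact (h x).deriv

lemma add (h : HasPartial i f f') (k : HasPartial i g g') :
    HasPartial i (fun x => f x + g x) (fun x => f' x + g' x) := fun x => (h x).add (k x)

lemma sub (h : HasPartial i f f') (k : HasPartial i g g') :
    HasPartial i (fun x => f x - g x) (fun x => f' x - g' x) := fun x => (h x).sub (k x)

lemma mul (h : HasPartial i f f') (k : HasPartial i g g') :
    HasPartial i (fun x => f x * g x) (fun x => f' x * g x + f x * g' x) := fun x => by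
  have := (h x).fun_mul (k x)
  simpa [shift_zero] using this

lemma comp {F F' : ℝ → ℝ} (hF : ∀ y, HasDerivAt F (F' y) y) (h : HasPartial i f f') :
    HasPartial i (fun x => F (f x)) (fun x => F' (f x) * f' x) := fun x => by
  have := (hF (f (x + shift i 0))).comp (0 : ℝ) (h x)
  simpa [shift_zero, Function.comp_def] using this

lemma integral_eq_sub (h : HasPartial i f f') (hf' : Continuous f') (x : T2) (t : ℝ) :
    ∫ s in (0 : ℝ)..t, f' (x + shift i s) = f (x + shift i t) - f x := by
  rw [intervalIntegral.integral_eq_sub_of_hasDerivAt (fun s _ => h.hasDerivAt x s)]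
  · simp [shift_zero]
  · exact (hf'.comp (continuous_const.add (continuous_shift i))).intervalIntegrable _ _

end HasPartial

lemma integrable_of_continuous {f : T2 → ℝ} (hf : Continuous f) : Integrable f torusMeasure :=
  hf.integrable_of_hasCompactSupport (HasCompactSupport.of_compactSpace f)

lemma memLp_of_continuous {f : T2 → ℝ} (hf : Continuous f) (p : ℝ≥0∞) :
    MemLp f p torusMeasure :=
  hf.memLp_of_hasCompactSupport (HasCompactSupport.of_compactSpace f)

/-- A partial derivative has integral zero over the torus. -/
lemma HasPartial.integral_eq_zero {i : Fin 2} {f f' : T2 → ℝ} (h : HasPartial i f f')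
    (hf' : Continuous f') : ∫ x, f' x ∂torusMeasure = 0 := by
  have h1 : ∀ x, ∫ s in (0 : ℝ)..1, f' (x + shift i s) = 0 := fun x => by
    rw [h.integral_eq_sub hf', shift_one]; simp
  have hc : Continuous (Function.uncurry fun (s : ℝ) (x : T2) => f' (x + shift i s)) := by
    have := continuous_shift i
    fun_prop
  have h2 := intervalIntegral_integral_swap (μ := torusMeasure) (a := 0) (b := 1)
    (f := fun s x => f' (x + shift i s)) ?_
  · simp only [h1, integral_zero] at h2
    simpa [integral_add_right_eq_self (μ := torusMeasure) f'] using h2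
  · have : IsFiniteMeasure (volume.restrict (uIoc (0 : ℝ) 1)) := ⟨by simp⟩
    obtain ⟨C, hC⟩ := (isCompact_univ (X := T2)).exists_bound_of_continuousOn hf'.continuousOn
    refine Integrable.of_bound (C := C) hc.aestronglyMeasurable ?_
    exact Eventually.of_forall fun z => hC _ (mem_univ _)

/-- Integration by parts for continuously differentiable functions. -/
lemma HasPartial.integral_mul_eq_neg {i : Fin 2} {f g f' g' : T2 → ℝ} (h : HasPartial i f f')
    (k : HasPartial i g g') (hf : Continuous f) (hg : Continuous g) (hf' : Continuous f')
    (hg' : Continuous g') :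
    ∫ x, f x * g' x ∂torusMeasure = -∫ x, f' x * g x ∂torusMeasure := by
  have := (h.mul k).integral_eq_zero (by fun_prop)
  rw [integral_add (integrable_of_continuous (by fun_prop))
    (integrable_of_continuous (by fun_prop))] at this
  linarith

namespace IsTest

variable {f g : T2 → ℝ} {i j : Fin 2}

lemma contDiff (hf : IsTest f) : ContDiff ℝ ((⊤ : ℕ∞) : WithTop ℕ∞) (f ∘ proj) := hf

lemma continuous (hf : IsTest f) : Continuous f :=
  isOpenQuotientMap_proj.isQuotientMap.continuous_iff.2 hf.contDiff.continuous

lemma partialDeriv_proj (hf : IsTest f) (i : Fin 2) (y : Fin 2 → ℝ) :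
    HasDerivAt (fun t : ℝ => f (proj y + shift i t)) (fderiv ℝ (f ∘ proj) y (Pi.single i 1)) 0 := by
  have h1 : HasFDerivAt (f ∘ proj) (fderiv ℝ (f ∘ proj) y) y :=
    (hf.contDiff.differentiable (by simp) y).hasFDerivAt
  have h2 : HasDerivAt (fun t : ℝ => y + t • (Pi.single i 1 : Fin 2 → ℝ)) (Pi.single i 1) 0 := by
    simpa using ((hasDerivAt_id (0 : ℝ)).smul_const (Pi.single i 1 : Fin 2 → ℝ)).const_add y
  have h3 := HasFDerivAt.comp_hasDerivAt (x := (0 : ℝ)) (f := fun t : ℝ =>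
    y + t • (Pi.single i 1 : Fin 2 → ℝ)) (l := f ∘ proj) (l' := fderiv ℝ (f ∘ proj) y)
    (by simpa using h1) h2
  simpa [Function.comp_def, proj_add_smul_single] using h3

lemma hasPartial (hf : IsTest f) (i : Fin 2) : HasPartial i f (partialDeriv i f) := by
  intro x
  obtain ⟨y, rfl⟩ := isOpenQuotientMap_proj.surjective x
  have := hf.partialDeriv_proj i y
  have e : partialDeriv i f (proj y) = fderiv ℝ (f ∘ proj) y (Pi.single i 1) := this.deriv
  rw [e]; exact this

lemma partialDeriv_comp_proj (hf : IsTest f) (i : Fin 2) :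
    partialDeriv i f ∘ proj = fun y => fderiv ℝ (f ∘ proj) y (Pi.single i 1) := by
  ext y
  exact (hf.partialDeriv_proj i y).deriv

lemma pderiv (hf : IsTest f) (i : Fin 2) : IsTest (partialDeriv i f) := by
  change ContDiff ℝ _ (partialDeriv i f ∘ proj)
  rw [hf.partialDeriv_comp_proj]
  exact (hf.contDiff.fderiv_right (m := ((⊤ : ℕ∞) : WithTop ℕ∞)) (by simp)).clm_apply
    contDiff_const

lemma partialDeriv_comm (hf : IsTest f) (i j : Fin 2) :
    partialDeriv i (partialDeriv j f) =
      partialDeriv j (partialDeriv i f) := by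
  have key : ∀ i j y, partialDeriv i (partialDeriv j f) (proj y)
      = fderiv ℝ (fderiv ℝ (f ∘ proj)) y (Pi.single i 1) (Pi.single j 1) := by
    intro i j y
    have h1 := congrFun ((hf.pderiv j).partialDeriv_comp_proj i) y
    simp only [Function.comp_apply] at h1
    rw [h1, hf.partialDeriv_comp_proj j]
    have h2 : DifferentiableAt ℝ (fderiv ℝ (f ∘ proj)) y :=
      (hf.contDiff.fderiv_right (m := ((⊤ : ℕ∞) : WithTop ℕ∞)) (by simp)).differentiable (by simp) y
    rw [fderiv_clm_apply h2 (differentiableAt_const _)]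
    simp
  ext x
  obtain ⟨y, rfl⟩ := isOpenQuotientMap_proj.surjective x
  rw [key, key]
  have hs : IsSymmSndFDerivAt ℝ (f ∘ proj) y :=
    hf.contDiff.contDiffAt.isSymmSndFDerivAt (by
    simpa using WithTop.coe_le_coe.2 (le_top : ((2 : ℕ) : ℕ∞) ≤ ⊤))
  exact hs _ _

lemma const (c : ℝ) : IsTest fun _ => c := contDiff_const

lemma add (hf : IsTest f) (hg : IsTest g) : IsTest fun x => f x + g x := ContDiff.add hf hg

lemma sub (hf : IsTest f) (hg : IsTest g) : IsTest fun x => f x - g x := ContDiff.sub hf hg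

lemma mul (hf : IsTest f) (hg : IsTest g) : IsTest fun x => f x * g x := ContDiff.mul hf hg

lemma comp {F : ℝ → ℝ} (hF : ContDiff ℝ ((⊤ : ℕ∞) : WithTop ℕ∞) F) (hf : IsTest f) :
    IsTest fun x => F (f x) := ContDiff.comp hF hf

lemma integrable (hf : IsTest f) : Integrable f torusMeasure :=
  integrable_of_continuous hf.continuous

lemma memLp (hf : IsTest f) (p : ℝ≥0∞) : MemLp f p torusMeasure :=
  memLp_of_continuous hf.continuous p

end IsTest

/-- The iterated derivative `∂₀^a ∂₁^b`. -/
def pd (a b : ℕ) (f : T2 → ℝ) : T2 → ℝ := (partialDeriv 0)^[a] ((partialDeriv 1)^[b] f)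

lemma IsTest.iterate {f : T2 → ℝ} (hf : IsTest f) (i : Fin 2) (a : ℕ) :
    IsTest ((partialDeriv i)^[a] f) := by
  induction a with
  | zero => exact hf
  | succ n ih => rw [Function.iterate_succ_apply']; exact ih.pderiv i

lemma IsTest.iterDeriv {f : T2 → ℝ} (hf : IsTest f) (a b : ℕ) : IsTest (pd a b f) :=
  (hf.iterate 1 b).iterate 0 a

lemma pd_zero (f : T2 → ℝ) : pd 0 0 f = f := rfl

lemma pd_succ_left (a b : ℕ) (f : T2 → ℝ) : pd (a + 1) b f = partialDeriv 0 (pd a b f) := by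
  simp [pd, Function.iterate_succ_apply']

lemma IsTest.pd_succ_right {f : T2 → ℝ} (hf : IsTest f) (a b : ℕ) :
    pd a (b + 1) f = partialDeriv 1 (pd a b f) := by
  induction a with
  | zero => simp [PoissonBoltzmann.pd, Function.iterate_succ_apply']
  | succ n ih => rw [pd_succ_left, ih, pd_succ_left, (hf.iterDeriv n b).partialDeriv_comm]

/-- The exponent of `∂_i` in the multi-index `(a, b)` is increased by one. -/
lemma IsTest.partialDeriv_pd {f : T2 → ℝ} (hf : IsTest f) (i : Fin 2) (a b : ℕ) :
    partialDeriv i (pd a b f) =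
      pd (a + if i = 0 then 1 else 0) (b + if i = 1 then 1 else 0) f := by
  fin_cases i
  · simp [pd_succ_left]
  · simp [hf.pd_succ_right]

lemma IsTest.pd_pd {f : T2 → ℝ} (hf : IsTest f) (a b c d : ℕ) :
    pd a b (pd c d f) = pd (a + c) (b + d) f := by
  induction a with
  | zero =>
    induction b with
    | zero => simp [pd_zero]
    | succ b ih =>
      rw [(hf.iterDeriv c d).pd_succ_right, ih, show b + 1 + d = b + d + 1 by ring, hf.pd_succ_right]
  | succ a ih => rw [pd_succ_left, ih, show a + 1 + c = a + c + 1 by ring, pd_succ_left]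

lemma partialDeriv_add {f g : T2 → ℝ} (hf : IsTest f) (hg : IsTest g) (i : Fin 2) :
    partialDeriv i (fun x => f x + g x) = fun x => partialDeriv i f x + partialDeriv i g x :=
  ((hf.hasPartial i).add (hg.hasPartial i)).partialDeriv_eq

lemma partialDeriv_sub {f g : T2 → ℝ} (hf : IsTest f) (hg : IsTest g) (i : Fin 2) :
    partialDeriv i (fun x => f x - g x) = fun x => partialDeriv i f x - partialDeriv i g x :=
  ((hf.hasPartial i).sub (hg.hasPartial i)).partialDeriv_eq

lemma IsTest.pd_sub {f g : T2 → ℝ} (hf : IsTest f) (hg : IsTest g) (a b : ℕ) :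
    pd a b (fun x => f x - g x) =
      fun x => pd a b f x - pd a b g x := by
  induction a with
  | zero =>
    induction b with
    | zero => rfl
    | succ b ih =>
      rw [(hf.sub hg).pd_succ_right, ih, partialDeriv_sub (hf.iterDeriv _ _) (hg.iterDeriv _ _),
        hf.pd_succ_right, hg.pd_succ_right]
  | succ a ih =>
    rw [pd_succ_left, ih, partialDeriv_sub (hf.iterDeriv _ _) (hg.iterDeriv _ _), pd_succ_left,
      pd_succ_left]

/-- Integration by parts for smooth functions. -/
lemma IsTest.integral_mul_pd {f g : T2 → ℝ} (hf : IsTest f) (hg : IsTest g) (a b : ℕ) :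
    ∫ x, f x * pd a b g x ∂torusMeasure =
      (-1) ^ (a + b) * ∫ x, pd a b f x * g x ∂torusMeasure := by
  have step : ∀ (i : Fin 2) {f g : T2 → ℝ}, IsTest f → IsTest g →
      ∫ x, f x * partialDeriv i g x ∂torusMeasure = -∫ x, partialDeriv i f x * g x ∂torusMeasure :=
    fun i f g hf hg => (hf.hasPartial i).integral_mul_eq_neg (hg.hasPartial i) hf.continuous
      hg.continuous (hf.pderiv i).continuous (hg.pderiv i).continuous
  induction a generalizing f with
  | zero =>
    induction b generalizing f with
    | zero => simp [pd_zero]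
    | succ b ih =>
      rw [hg.pd_succ_right, step 1 hf (hg.iterDeriv 0 b), ih (hf.pderiv 1),
        show partialDeriv 1 f = pd 0 1 f from rfl, hf.pd_pd]
      simp [pow_succ]
  | succ a ih =>
    rw [pd_succ_left, step 0 hf (hg.iterDeriv a b), ih (hf.pderiv 0),
      show partialDeriv 0 f = pd 1 0 f from rfl,
      hf.pd_pd]
    simp only [add_right_comm a 1 b, pow_succ, add_zero]
    ring

/-! ### Averages of translates -/

/-- Jensen's inequality for `t ↦ t ^ p`. -/
lemma rpow_lintegral_le_lintegral_rpow {α : Type*} [MeasurableSpace α] (ν : Measure α)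
    [IsProbabilityMeasure ν] {F : α → ℝ≥0∞} (hF : Measurable F) {p : ℝ} (hp : 1 ≤ p) :
    (∫⁻ y, F y ∂ν) ^ p ≤ ∫⁻ y, F y ^ p ∂ν := by
  have h := eLpNorm'_le_eLpNorm'_of_exponent_le (f := F) one_pos hp ν hF.aestronglyMeasurable
  simp only [eLpNorm', enorm_eq_self, ENNReal.rpow_one, div_one] at h
  calc (∫⁻ y, F y ∂ν) ^ p ≤ ((∫⁻ y, F y ^ p ∂ν) ^ (1 / p)) ^ p := by gcongr
    _ = _ := by rw [← ENNReal.rpow_mul, one_div, inv_mul_cancel₀ (by positivity), ENNReal.rpow_one]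

lemma lintegral_average_rpow_le {α : Type*} [MeasurableSpace α] (ν : Measure α)
    [IsProbabilityMeasure ν] {τ : α → T2} (hτ : Measurable τ) {F : T2 → ℝ≥0∞} (hF : Measurable F)
    {p : ℝ} (hp : 1 ≤ p) :
    ∫⁻ x, (∫⁻ y, F (x + τ y) ∂ν) ^ p ∂torusMeasure ≤ ∫⁻ x, F x ^ p ∂torusMeasure := by
  have hm : Measurable fun z : T2 × α => F (z.1 + τ z.2) :=
    hF.comp (measurable_fst.add (hτ.comp measurable_snd))
  calc ∫⁻ x, (∫⁻ y, F (x + τ y) ∂ν) ^ p ∂torusMeasure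
      ≤ ∫⁻ x, ∫⁻ y, F (x + τ y) ^ p ∂ν ∂torusMeasure := by
        refine lintegral_mono fun x => rpow_lintegral_le_lintegral_rpow ν ?_ hp
        exact hF.comp (measurable_const.add hτ)
    _ = ∫⁻ y, ∫⁻ x, F (x + τ y) ^ p ∂torusMeasure ∂ν :=
        lintegral_lintegral_swap (hm.pow_const p).aemeasurable
    _ = ∫⁻ y, ∫⁻ x, F x ^ p ∂torusMeasure ∂ν := by
        refine lintegral_congr fun y => ?_
        exact lintegral_add_right_eq_self (fun x => F x ^ p) (τ y)
    _ = _ := by simp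

/-- A function dominated by an average of translates of `h` has smaller `L^p` norm than `h`. -/
lemma eLpNorm_le_of_enorm_le_average {α : Type*} [MeasurableSpace α] (ν : Measure α)
    [IsProbabilityMeasure ν] {τ : α → T2} (hτ : Measurable τ) {g h : T2 → ℝ} (hh : Measurable h)
    {p : ℝ≥0∞} (hp : 1 ≤ p) (hp' : p ≠ ∞)
    (H : ∀ x, ‖g x‖ₑ ≤ ∫⁻ y, ‖h (x + τ y)‖ₑ ∂ν) :
    eLpNorm g p torusMeasure ≤ eLpNorm h p torusMeasure := by
  have h0 : p ≠ 0 := (one_pos.trans_le hp).ne'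
  have h1 : 1 ≤ p.toReal := by
    simpa using ENNReal.toReal_mono hp' hp
  rw [eLpNorm_eq_lintegral_rpow_enorm_toReal h0 hp', eLpNorm_eq_lintegral_rpow_enorm_toReal h0 hp']
  refine ENNReal.rpow_le_rpow ?_ (by positivity)
  refine le_trans (lintegral_mono fun x => ENNReal.rpow_le_rpow (H x) (by positivity)) ?_
  exact lintegral_average_rpow_le ν hτ hh.enorm h1

/-- The uniform probability measure on the interval `(0, 1]`. -/
abbrev unitInterval01 : Measure ℝ := volume.restrict (Ioc (0 : ℝ) 1)

instance : IsProbabilityMeasure unitInterval01 := ⟨by simp⟩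

lemma HasPartial.enorm_sub_le {i : Fin 2} {f f' : T2 → ℝ} (h : HasPartial i f f')
    (hf' : Continuous f') (x : T2) {t : ℝ} (ht : t ∈ Ioc (0 : ℝ) 1) :
    ‖f (x + shift i t) - f x‖ₑ ≤ ∫⁻ s, ‖f' (x + shift i s)‖ₑ ∂unitInterval01 := by
  rw [← h.integral_eq_sub hf', intervalIntegral.integral_of_le ht.1.le]
  refine (enorm_integral_le_lintegral_enorm _).trans ?_
  exact lintegral_mono_set (Ioc_subset_Ioc_right ht.2)

/-- A derivative in direction `i` has mean zero along the lines in direction `i`, so that it is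
controlled by its own derivative. -/
lemma HasPartial.eLpNorm_le_eLpNorm_partial {i : Fin 2} {f g g' : T2 → ℝ} (h : HasPartial i f g)
    (k : HasPartial i g g') (hg : Continuous g) (hg' : Continuous g') {p : ℝ≥0∞} (hp : 1 ≤ p)
    (hp' : p ≠ ∞) : eLpNorm g p torusMeasure ≤ eLpNorm g' p torusMeasure := by
  refine eLpNorm_le_of_enorm_le_average unitInterval01 (continuous_shift i).measurable
    hg'.measurable hp hp' fun x => ?_
  have hc : Continuous fun s => g (x + shift i s) :=
    hg.comp (continuous_const.add (continuous_shift i))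
  have h0 : ∫ s in Ioc (0 : ℝ) 1, g (x + shift i s) = 0 := by
    rw [← intervalIntegral.integral_of_le zero_le_one, h.integral_eq_sub hg, shift_one]; simp
  have h1 : g x = ∫ s in Ioc (0 : ℝ) 1, (g x - g (x + shift i s)) := by
    rw [integral_sub (integrable_const _) ((hc.integrableOn_Icc).mono_set Ioc_subset_Icc_self), h0]
    simp
  rw [h1]
  refine (enorm_integral_le_lintegral_enorm _).trans ?_
  calc ∫⁻ s in Ioc (0 : ℝ) 1, ‖g x - g (x + shift i s)‖ₑ
      ≤ ∫⁻ s in Ioc (0 : ℝ) 1, ∫⁻ r, ‖g' (x + shift i r)‖ₑ ∂unitInterval01 := by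
        refine setLIntegral_mono' measurableSet_Ioc fun s hs => ?_
        rw [← enorm_neg, neg_sub]
        exact k.enorm_sub_le hg' x hs
    _ = _ := by simp

lemma HasPartial.enorm_le_average {i : Fin 2} {f f' : T2 → ℝ} (h : HasPartial i f f')
    (hf : Continuous f) (hf' : Continuous f') (x : T2) :
    ‖f x‖ₑ ≤ ∫⁻ s, (‖f (x + shift i s)‖ₑ + ‖f' (x + shift i s)‖ₑ) ∂unitInterval01 := by
  have hs := continuous_shift i
  rw [lintegral_add_left (Continuous.measurable (by fun_prop))]
  calc ‖f x‖ₑ = ∫⁻ s, ‖f x‖ₑ ∂unitInterval01 := by simp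
    _ ≤ ∫⁻ s, (‖f (x + shift i s)‖ₑ + ∫⁻ r, ‖f' (x + shift i r)‖ₑ ∂unitInterval01)
          ∂unitInterval01 := by
        refine setLIntegral_mono' measurableSet_Ioc fun s hs => ?_
        have e : f x = f (x + shift i s) - (f (x + shift i s) - f x) := by ring
        calc ‖f x‖ₑ = ‖f (x + shift i s) - (f (x + shift i s) - f x)‖ₑ := by rw [← e]
          _ ≤ _ := _root_.enorm_sub_le.trans (by gcongr; exact h.enorm_sub_le hf' x hs)
    _ = _ := by rw [lintegral_add_right _ measurable_const]; simp

/-- Integrating along both coordinate directions from any base point gives the integral over the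
torus. -/
lemma lintegral_shift_shift {F : T2 → ℝ≥0∞} (hF : Measurable F) (x : T2) :
    ∫⁻ s, ∫⁻ t, F (x + shift 0 s + shift 1 t) ∂unitInterval01 ∂unitInterval01 =
      ∫⁻ y, F y ∂torusMeasure := by
  have hvol : (volume : Measure UnitAddCircle) = AddCircle.haarAddCircle := by
    rw [AddCircle.volume_eq_smul_haarAddCircle]; simp
  rw [← lintegral_add_left_eq_self F x]
  have h1 := ((measurePreserving_piFinTwo
    (fun _ : Fin 2 => (AddCircle.haarAddCircle : Measure UnitAddCircle))).symm).lintegral_comp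
    (f := fun y : T2 => F (x + y)) (hF.comp (measurable_const.add measurable_id))
  rw [← h1, lintegral_prod]
  · have e : ∀ z : UnitAddCircle × UnitAddCircle,
        ((MeasurableEquiv.piFinTwo fun _ => UnitAddCircle).symm z : T2)
          = ((Pi.single (0 : Fin 2) z.1 : T2) + (Pi.single (1 : Fin 2) z.2 : T2)) := by
      intro z; ext j; fin_cases j <;> simp [MeasurableEquiv.piFinTwo]
    simp_rw [e, ← hvol]
    have h2 : ∀ G : UnitAddCircle → ℝ≥0∞, ∫⁻ s, G (s : UnitAddCircle) ∂unitInterval01 =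
        ∫⁻ b, G b := fun G => by
      simpa using AddCircle.lintegral_preimage 1 0 G
    simp only [shift, add_assoc]
    rw [h2 (fun b => ∫⁻ t, F (x + ((Pi.single 0 b : T2) + (Pi.single 1 (t : UnitAddCircle) : T2)))
      ∂unitInterval01)]
    refine lintegral_congr fun b => ?_
    exact h2 (fun c => F (x + ((Pi.single 0 b : T2) + (Pi.single 1 c : T2))))
  · exact ((hF.comp (measurable_const.add measurable_id)).comp
      (MeasurableEquiv.measurable _)).aemeasurable

/-- The embedding of `W^{2,1}` into the bounded functions in dimension two. -/
lemma IsTest.enorm_le_eLpNorm_one {f : T2 → ℝ} (hf : IsTest f) (x : T2) :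
    ‖f x‖ₑ ≤ eLpNorm f 1 torusMeasure + eLpNorm (pd 0 1 f) 1 torusMeasure +
      (eLpNorm (pd 1 0 f) 1 torusMeasure + eLpNorm (pd 1 1 f) 1 torusMeasure) := by
  have c := fun a b => (hf.iterDeriv a b).continuous
  have h1 : ∀ y, ‖f y‖ₑ ≤ ∫⁻ t, (‖f (y + shift 1 t)‖ₑ + ‖pd 0 1 f (y + shift 1 t)‖ₑ)
      ∂unitInterval01 := (hf.hasPartial 1).enorm_le_average (c 0 0) (c 0 1)
  have h2 : ∀ y, ‖pd 1 0 f y‖ₑ ≤ ∫⁻ t, (‖pd 1 0 f (y + shift 1 t)‖ₑ +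
      ‖pd 1 1 f (y + shift 1 t)‖ₑ) ∂unitInterval01 := by
    have := ((hf.iterDeriv 1 0).hasPartial 1).enorm_le_average (c 1 0)
      (by rw [← hf.pd_succ_right]; exact c 1 1)
    rwa [← hf.pd_succ_right] at this
  have h3 : ‖f x‖ₑ ≤ ∫⁻ s, (‖f (x + shift 0 s)‖ₑ + ‖pd 1 0 f (x + shift 0 s)‖ₑ)
      ∂unitInterval01 := (hf.hasPartial 0).enorm_le_average (c 0 0) (c 1 0) x
  set G : T2 → ℝ≥0∞ := fun y => ‖f y‖ₑ + ‖pd 0 1 f y‖ₑ + (‖pd 1 0 f y‖ₑ + ‖pd 1 1 f y‖ₑ) with hG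
  have c00 := c 0 0
  have c10 := c 1 0
  have c01 := c 0 1
  have c11 := c 1 1
  rw [pd_zero] at c00
  have hGm : Measurable G := by
    have := c00.measurable; have := c10.measurable; have := c01.measurable
    have := c11.measurable
    fun_prop
  have hs := continuous_shift 1
  calc ‖f x‖ₑ ≤ _ := h3
    _ ≤ ∫⁻ s, ∫⁻ t, G (x + shift 0 s + shift 1 t) ∂unitInterval01 ∂unitInterval01 := by
      refine lintegral_mono fun s => ?_
      simp only [hG]
      rw [lintegral_add_left (by fun_prop)]
      exact add_le_add (h1 _) (h2 _)
    _ = ∫⁻ y, G y ∂torusMeasure := lintegral_shift_shift hGm x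
    _ = _ := by
      simp only [eLpNorm_one_eq_lintegral_enorm, hG]
      rw [lintegral_add_left (by fun_prop), lintegral_add_left (by fun_prop),
        lintegral_add_left (by fun_prop)]

/-! ### Trigonometric polynomials -/

section

lemma mFourier_add_apply (n : Fin 2 → ℤ) (x y : T2) :
    mFourier n (x + y) = mFourier n x * mFourier n y := by
  simp [mFourier, Fin.prod_univ_two, fourier_apply, smul_add, AddCircle.toCircle_add]
  ring

lemma mFourier_neg_apply (n : Fin 2 → ℤ) (x : T2) : mFourier n (-x) = conj (mFourier n x) := by
  rw [← mFourier_neg]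
  simp [mFourier, Fin.prod_univ_two, fourier_apply]

lemma norm_mFourier_apply (n : Fin 2 → ℤ) (x : T2) : ‖mFourier n x‖ = 1 := by
  simp [mFourier, fourier_apply, Circle.norm_coe]

lemma mFourier_proj (n : Fin 2 → ℤ) (y : Fin 2 → ℝ) :
    mFourier n (proj y) = Complex.exp (2 * Real.pi * Complex.I * (n 0 * y 0 + n 1 * y 1)) := by
  simp only [mFourier, proj, ContinuousMap.coe_mk, Fin.prod_univ_two, fourier_coe_apply,
    ← Complex.exp_add]
  congr 1; push_cast; ring

lemma mFourier_shift (n : Fin 2 → ℤ) (i : Fin 2) (t : ℝ) :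
    mFourier n (shift i t) = Complex.exp (2 * Real.pi * Complex.I * n i * t) := by
  have : shift i t = proj (Pi.single i t) := by
    ext j; by_cases h : j = i
    · subst h; simp [shift, proj]
    · simp [shift, proj, h]
  rw [this, mFourier_proj]
  fin_cases i <;> simp <;> ring_nf

lemma integral_mFourier (n : Fin 2 → ℤ) :
    ∫ x, mFourier n x ∂torusMeasure = if n = 0 then 1 else 0 := by
  split_ifs with h
  · simp [h, mFourier_zero]
  · obtain ⟨i, hi⟩ := Function.ne_iff.1 h
    -- translation by half a period changes the sign of the character
    have h1 : ∫ x, mFourier n (x + shift i (1 / (2 * n i))) ∂torusMeasure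
        = ∫ x, mFourier n x ∂torusMeasure := integral_add_right_eq_self (fun x => mFourier n x) _
    have h2 : mFourier n (shift i (1 / (2 * n i))) = -1 := by
      rw [mFourier_shift, ← Complex.exp_pi_mul_I]
      have : (n i : ℂ) ≠ 0 := by exact_mod_cast hi
      congr 1; push_cast; field_simp
    simp only [mFourier_add_apply, h2, integral_mul_const] at h1
    linear_combination (-1 / 2 : ℂ) * h1

/-- The real part of the trigonometric polynomial with coefficients `c` and spectrum in `S`. -/
def trig (S : Finset (Fin 2 → ℤ)) (c : (Fin 2 → ℤ) → ℂ) (x : T2) : ℝ :=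
  (∑ n ∈ S, c n * mFourier n x).re

variable {S : Finset (Fin 2 → ℤ)} {c d : (Fin 2 → ℤ) → ℂ}

lemma trig_eq_sum (S : Finset (Fin 2 → ℤ)) (c : (Fin 2 → ℤ) → ℂ) (x : T2) :
    trig S c x = ∑ n ∈ S, (c n * mFourier n x).re := by simp [trig, Complex.re_sum]

lemma trig_sub (x : T2) : trig S c x - trig S d x = trig S (fun n => c n - d n) x := by
  simp [trig, sub_mul, Finset.sum_sub_distrib]

lemma trig_add (x : T2) : trig S c x + trig S d x = trig S (fun n => c n + d n) x := by
  simp [trig, add_mul, Finset.sum_add_distrib]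

lemma mul_trig (a : ℝ) (x : T2) : a * trig S c x = trig S (fun n => a * c n) x := by
  simp only [trig, mul_assoc, ← Finset.mul_sum, Complex.re_ofReal_mul]

lemma abs_trig_le (x : T2) : |trig S c x| ≤ ∑ n ∈ S, ‖c n‖ := by
  refine (Complex.abs_re_le_norm _).trans ((norm_sum_le _ _).trans (le_of_eq ?_))
  simp [norm_mFourier_apply]

lemma isTest_trig (S : Finset (Fin 2 → ℤ)) (c : (Fin 2 → ℤ) → ℂ) : IsTest (trig S c) := by
  change ContDiff ℝ _ fun y : Fin 2 → ℝ => trig S c (proj y)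
  simp only [trig, mFourier_proj]
  refine Complex.reCLM.contDiff.comp (ContDiff.sum fun n _ => contDiff_const.mul ?_)
  have h : ∀ i : Fin 2, ContDiff ℝ ((⊤ : ℕ∞) : WithTop ℕ∞) fun y : Fin 2 → ℝ => ((y i : ℝ) : ℂ) :=
    fun i => Complex.ofRealCLM.contDiff.comp (contDiff_apply ℝ ℝ i)
  have h0 := h 0
  have h1 := h 1
  exact (contDiff_const.mul ((contDiff_const.mul h0).add (contDiff_const.mul h1))).cexp

lemma hasPartial_trig (S : Finset (Fin 2 → ℤ)) (c : (Fin 2 → ℤ) → ℂ) (i : Fin 2) :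
    HasPartial i (trig S c) (trig S fun n => 2 * Real.pi * Complex.I * n i * c n) := by
  intro x
  have h : HasDerivAt (fun t : ℝ => ∑ n ∈ S, c n * mFourier n (x + shift i t))
      (∑ n ∈ S, 2 * Real.pi * Complex.I * n i * c n * mFourier n x) 0 := by
    refine HasDerivAt.fun_sum fun n _ => ?_
    simp only [mFourier_add_apply, mFourier_shift]
    have h1 : HasDerivAt (fun t : ℝ => Complex.exp (2 * Real.pi * Complex.I * n i * t))
        (2 * Real.pi * Complex.I * n i) 0 := by
      have := (((Complex.ofRealCLM.hasDerivAt (x := (0 : ℝ))).const_mul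
        (2 * Real.pi * Complex.I * n i : ℂ)).cexp)
      simpa using this
    exact ((h1.const_mul (mFourier n x)).const_mul (c n)).congr_deriv (by ring)
  exact (Complex.reCLM.hasFDerivAt (x := ∑ n ∈ S, c n * mFourier n (x + shift i 0))).comp_hasDerivAt
    (0 : ℝ) h

lemma partialDeriv_trig (i : Fin 2) :
    partialDeriv i (trig S c) = trig S fun n => 2 * Real.pi * Complex.I * n i * c n :=
  (hasPartial_trig S c i).partialDeriv_eq

/-- The Fourier symbol of `∂₀^a ∂₁^b`. -/
def symbol (a b : ℕ) (n : Fin 2 → ℤ) : ℂ :=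
  (2 * Real.pi * Complex.I * n 0) ^ a * (2 * Real.pi * Complex.I * n 1) ^ b

lemma pd_trig (a b : ℕ) : pd a b (trig S c) = trig S fun n => symbol a b n * c n := by
  induction a with
  | zero =>
    induction b with
    | zero => simp [pd_zero, symbol]
    | succ b ih =>
      rw [(isTest_trig S c).pd_succ_right, ih, partialDeriv_trig]
      congr 1; ext n; simp only [symbol]; ring
  | succ a ih =>
    rw [pd_succ_left, ih, partialDeriv_trig]
    congr 1; ext n; simp only [symbol]; ring

lemma conj_symbol (a b : ℕ) (n : Fin 2 → ℤ) :
    conj (symbol a b n) = (-1) ^ (a + b) * symbol a b n := by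
  simp only [symbol, map_mul, map_pow, Complex.conj_I, Complex.conj_ofReal, map_ofNat,
    map_intCast, mul_neg, neg_mul]
  rw [neg_pow, neg_pow (2 * _ * _ * _ : ℂ) b]
  ring

/-- As a function of `y`, the translate `trig S c (x - y)` is again a trigonometric polynomial with
the same spectrum, because only real parts matter. -/
lemma trig_sub_apply (x y : T2) :
    trig S c (x - y) = trig S (fun n => conj (c n * mFourier n x)) y := by
  simp only [trig_eq_sum, sub_eq_add_neg, mFourier_add_apply, mFourier_neg_apply]
  refine Finset.sum_congr rfl fun n _ => ?_
  rw [← Complex.conj_re]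
  simp [mul_assoc]

/-- Convolution of `f` with a trigonometric polynomial. -/
def conv (T f : T2 → ℝ) (x : T2) : ℝ := ∫ y, T (x - y) * f y ∂torusMeasure

/-- The Fourier coefficients of a real function. -/
def coef (f : T2 → ℝ) (n : Fin 2 → ℤ) : ℂ := ∫ y, mFourier n (-y) * (f y : ℂ) ∂torusMeasure

lemma integrable_mFourier_mul {f : T2 → ℝ} (hf : Integrable f torusMeasure) (n : Fin 2 → ℤ) :
    Integrable (fun y => mFourier n (-y) * (f y : ℂ)) torusMeasure :=
  hf.ofReal.bdd_mul (c := 1) (by fun_prop)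
    (Eventually.of_forall fun y => (norm_mFourier_apply n (-y)).le)

lemma conv_trig {f : T2 → ℝ} (hf : Integrable f torusMeasure) :
    conv (trig S c) f = trig S fun n => c n * coef f n := by
  ext x
  have h1 : ∀ n, Integrable (fun y => c n * mFourier n x * (mFourier n (-y) * (f y : ℂ)))
      torusMeasure := fun n => (integrable_mFourier_mul hf n).const_mul _
  have h2 : (fun y => trig S c (x - y) * f y) = fun y =>
      (∑ n ∈ S, c n * mFourier n x * (mFourier n (-y) * (f y : ℂ))).re := by
    ext y
    have : ∑ n ∈ S, c n * mFourier n x * (mFourier n (-y) * (f y : ℂ)) =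
        (∑ n ∈ S, c n * mFourier n (x - y)) * (f y : ℂ) := by
      rw [Finset.sum_mul]
      refine Finset.sum_congr rfl fun n _ => ?_
      rw [sub_eq_add_neg, mFourier_add_apply]; ring
    rw [this, Complex.re_mul_ofReal, trig]
  rw [conv, h2]
  have h3 := integral_re (𝕜 := ℂ) (integrable_finsetSum S fun n _ => h1 n)
  simp only [RCLike.re_to_complex] at h3
  rw [h3, integral_finsetSum _ fun n _ => h1 n, trig]
  congr 1
  refine Finset.sum_congr rfl fun n _ => ?_
  rw [integral_const_mul, coef]
  ring

/-! ### Fejér means -/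

/-- The frequencies of the Dirichlet kernel underlying the Fejér kernel. -/
def box (N : ℕ) : Finset (Fin 2 → ℤ) := Fintype.piFinset fun _ => Finset.Ico (0 : ℤ) (N + 1)

lemma card_box (N : ℕ) : (box N).card = (N + 1) ^ 2 := by
  simp [box, Fintype.card_piFinset]

/-- The spectrum of the Fejér kernel. -/
def fejerSupp (N : ℕ) : Finset (Fin 2 → ℤ) := (box N ×ˢ box N).image fun k => k.1 - k.2

/-- The Fourier coefficients of the Fejér kernel. -/
def fejerCoef (N : ℕ) (n : Fin 2 → ℤ) : ℝ :=
  ((box N ×ˢ box N).filter fun k => k.1 - k.2 = n).card / ((N : ℝ) + 1) ^ 2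

/-- The two-dimensional Fejér kernel. -/
def fejerKernel (N : ℕ) : T2 → ℝ := trig (fejerSupp N) fun n => fejerCoef N n

/-- The Fejér kernel is the square of a Dirichlet kernel, hence nonnegative. -/
lemma sum_fejerCoef_mul_mFourier (N : ℕ) (x : T2) :
    ∑ n ∈ fejerSupp N, (fejerCoef N n : ℂ) * mFourier n x =
      ((‖∑ k ∈ box N, mFourier k x‖ ^ 2 / ((N : ℝ) + 1) ^ 2 : ℝ) : ℂ) := by
  have h1 : ((‖∑ k ∈ box N, mFourier k x‖ ^ 2 : ℝ) : ℂ) =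
      ∑ k ∈ box N ×ˢ box N, mFourier (k.1 - k.2) x := by
    rw [Complex.ofReal_pow, ← Complex.mul_conj', map_sum, Finset.sum_mul_sum, Finset.sum_product]
    refine Finset.sum_congr rfl fun k _ => Finset.sum_congr rfl fun l _ => ?_
    rw [sub_eq_add_neg, mFourier_add, mFourier_neg]
  have h2 : ∑ k ∈ box N ×ˢ box N, mFourier (k.1 - k.2) x = ∑ n ∈ fejerSupp N,
      (((box N ×ˢ box N).filter fun k => k.1 - k.2 = n).card : ℂ) * mFourier n x := by
    rw [Finset.sum_comp (fun n => mFourier n x) fun k : (Fin 2 → ℤ) × (Fin 2 → ℤ) => k.1 - k.2]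
    simp [fejerSupp]
  rw [Complex.ofReal_div, h1, h2, Finset.sum_div]
  refine Finset.sum_congr rfl fun n _ => ?_
  simp only [fejerCoef]; push_cast; ring

lemma fejerKernel_eq (N : ℕ) (x : T2) :
    fejerKernel N x = ‖∑ k ∈ box N, mFourier k x‖ ^ 2 / ((N : ℝ) + 1) ^ 2 := by
  rw [fejerKernel, trig, sum_fejerCoef_mul_mFourier, Complex.ofReal_re]

lemma ofReal_fejerKernel (N : ℕ) (x : T2) :
    (fejerKernel N x : ℂ) = ∑ n ∈ fejerSupp N, (fejerCoef N n : ℂ) * mFourier n x := by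
  rw [sum_fejerCoef_mul_mFourier, fejerKernel_eq]

lemma fejerCoef_eq_zero {N : ℕ} {n : Fin 2 → ℤ} (hn : n ∉ fejerSupp N) : fejerCoef N n = 0 := by
  rw [fejerCoef, Finset.filter_eq_empty_iff.2]
  · simp
  · intro k hk h; exact hn (Finset.mem_image.2 ⟨k, hk, h⟩)

lemma fejerKernel_nonneg (N : ℕ) (x : T2) : 0 ≤ fejerKernel N x := by
  rw [fejerKernel_eq]; positivity

lemma fejerKernel_neg (N : ℕ) (x : T2) : fejerKernel N (-x) = fejerKernel N x := by
  simp only [fejerKernel_eq, mFourier_neg_apply, ← map_sum, RCLike.norm_conj]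

lemma zero_mem_fejerSupp (N : ℕ) : 0 ∈ fejerSupp N := by
  refine Finset.mem_image.2 ⟨(0, 0), ?_, by simp⟩
  simp [box]

lemma fejerCoef_zero (N : ℕ) : fejerCoef N 0 = 1 := by
  have : ((box N ×ˢ box N).filter fun k => k.1 - k.2 = 0).card = (box N).card := by
    have e : (box N ×ˢ box N).filter (fun k => k.1 - k.2 = 0) = (box N).diag := by
      ext ⟨a, b⟩
      simp only [Finset.mem_filter, Finset.mem_product, Finset.mem_diag, sub_eq_zero]
      constructor
      · rintro ⟨⟨h1, _⟩, h⟩; exact ⟨h1, h⟩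
      · rintro ⟨h1, rfl⟩; exact ⟨⟨h1, h1⟩, rfl⟩
    rw [e, Finset.diag_card]
  rw [fejerCoef, this, card_box]
  push_cast
  exact div_self (by positivity)

lemma integral_trig (S : Finset (Fin 2 → ℤ)) (c : (Fin 2 → ℤ) → ℂ) :
    ∫ x, trig S c x ∂torusMeasure = if 0 ∈ S then (c 0).re else 0 := by
  have hi : ∀ n, Integrable (fun x : T2 => c n * mFourier n x) torusMeasure := fun n =>
    (by fun_prop : Continuous fun x : T2 => c n * mFourier n x).integrable_of_hasCompactSupport
      (HasCompactSupport.of_compactSpace _)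
  have h3 := integral_re (𝕜 := ℂ) (integrable_finsetSum S fun n _ => hi n)
  simp only [RCLike.re_to_complex] at h3
  simp only [trig]
  rw [h3, integral_finsetSum _ fun n _ => hi n]
  simp only [integral_const_mul, integral_mFourier, mul_ite, mul_one, mul_zero]
  rw [Finset.sum_ite_eq']
  split_ifs <;> simp

lemma integral_fejerKernel (N : ℕ) : ∫ x, fejerKernel N x ∂torusMeasure = 1 := by
  rw [fejerKernel, integral_trig, if_pos (zero_mem_fejerSupp N), fejerCoef_zero]; simp

lemma fejerCoef_le_one (N : ℕ) (n : Fin 2 → ℤ) : fejerCoef N n ≤ 1 := by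
  rw [fejerCoef, div_le_one (by positivity)]
  have : ((box N ×ˢ box N).filter fun k => k.1 - k.2 = n).card ≤ (box N).card := by
    refine Finset.card_le_card_of_injOn (fun k => k.1) ?_ ?_
    · intro k hk; simp only [Finset.coe_filter, Finset.mem_product, mem_ofPred_eq] at hk
      exact hk.1.1
    · rintro ⟨a, b⟩ h ⟨a', b'⟩ h' e
      simp only [Finset.coe_filter, Finset.mem_product, mem_ofPred_eq] at h h' e
      subst e
      have : b = b' := by rw [← sub_right_inj (a := a), h.2, h'.2]
      rw [this]
  rw [card_box] at this
  exact_mod_cast this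

/-- The `n`-th coefficient counts the pairs in the box with difference `n`; those of the form
`(l + n, l)` with `l` in a smaller box are enough for the lower bound. -/
lemma le_fejerCoef (n : Fin 2 → ℤ) (N : ℕ) (hN : ∀ i, |n i| ≤ N) :
    (((N : ℝ) + 1 - |(n 0 : ℝ)|) * ((N : ℝ) + 1 - |(n 1 : ℝ)|)) / ((N : ℝ) + 1) ^ 2
      ≤ fejerCoef N n := by
  rw [fejerCoef]
  gcongr
  let D : Finset (Fin 2 → ℤ) :=
    Fintype.piFinset fun i => Finset.Ico (max 0 (-n i)) (min (N + 1) (N + 1 - n i))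
  have hD : (D.card : ℝ) = ((N : ℝ) + 1 - |(n 0 : ℝ)|) * ((N : ℝ) + 1 - |(n 1 : ℝ)|) := by
    have h : ∀ i, (((min ((N : ℤ) + 1) (N + 1 - n i)) - max 0 (-n i)).toNat : ℝ)
        = (N : ℝ) + 1 - |(n i : ℝ)| := by
      intro i
      have h1 : (min ((N : ℤ) + 1) (N + 1 - n i)) - max 0 (-n i) = N + 1 - |n i| := by
        rcases le_total 0 (n i) with h | h
        · rw [abs_of_nonneg h, max_eq_left (by omega), min_eq_right (by omega)]
          ring
        · rw [abs_of_nonpos h, max_eq_right (by omega), min_eq_left (by omega)]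
      rw [h1]
      have h2 : (0 : ℤ) ≤ N + 1 - |n i| := by have := hN i; omega
      have h3 : (((N + 1 - |n i|).toNat : ℤ) : ℝ) = ((N + 1 - |n i| : ℤ) : ℝ) := by
        rw [Int.toNat_of_nonneg h2]
      push_cast at h3
      exact h3
    simp only [D, Fintype.card_piFinset, Fin.prod_univ_two, Int.card_Ico]
    push_cast [h]
    rfl
  rw [← hD]
  have : D.card ≤ ((box N ×ˢ box N).filter fun k => k.1 - k.2 = n).card := by
    refine Finset.card_le_card_of_injOn (fun l => (l + n, l)) ?_ ?_
    · intro l hl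
      simp only [D, Finset.mem_coe, Fintype.mem_piFinset, Finset.mem_Ico] at hl
      simp only [Finset.coe_filter, Finset.mem_product, mem_ofPred_eq, box, Fintype.mem_piFinset,
        Finset.mem_Ico, Pi.add_apply, add_sub_cancel_left, and_true]
      constructor <;> intro i <;> have := hl i <;> omega
    · intro l _ l' _ h; exact (Prod.ext_iff.1 h).2
  exact_mod_cast this

lemma tendsto_fejerCoef (n : Fin 2 → ℤ) : Tendsto (fun N => fejerCoef N n) atTop (𝓝 1) := by
  have hlow : Tendsto (fun N : ℕ => (((N : ℝ) + 1 - |(n 0 : ℝ)|) * ((N : ℝ) + 1 - |(n 1 : ℝ)|)) /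
      ((N : ℝ) + 1) ^ 2) atTop (𝓝 1) := by
    have h1 : Tendsto (fun N : ℕ => 1 / ((N : ℝ) + 1)) atTop (𝓝 0) :=
      tendsto_one_div_add_atTop_nhds_zero_nat
    have h2 : Tendsto (fun N : ℕ => (1 - |(n 0 : ℝ)| * (1 / ((N : ℝ) + 1))) *
        (1 - |(n 1 : ℝ)| * (1 / ((N : ℝ) + 1)))) atTop (𝓝 ((1 - |(n 0 : ℝ)| * 0) *
          (1 - |(n 1 : ℝ)| * 0))) :=
      ((h1.const_mul _).const_sub _).mul ((h1.const_mul _).const_sub _)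
    simp only [mul_zero, sub_zero, mul_one] at h2
    refine h2.congr fun N => ?_
    have : (N : ℝ) + 1 ≠ 0 := by positivity
    field_simp
  refine tendsto_of_tendsto_of_tendsto_of_le_of_le' hlow tendsto_const_nhds ?_
    (Eventually.of_forall fun N => fejerCoef_le_one N n)
  have : ∀ i, ∀ᶠ N : ℕ in atTop, |n i| ≤ N := fun i => by
    filter_upwards [eventually_ge_atTop (|n i|).toNat] with N hN
    omega
  filter_upwards [this 0, this 1] with N h0 h1
  exact le_fejerCoef n N fun i => by fin_cases i <;> assumption

end

section

/-- The Fejér mean of order `N` of a function on the torus. -/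
def fejer (N : ℕ) (f : T2 → ℝ) : T2 → ℝ := conv (fejerKernel N) f

variable {f g : T2 → ℝ}

lemma fejer_eq_trig (N : ℕ) (hf : Integrable f torusMeasure) :
    fejer N f = trig (fejerSupp N) fun n => fejerCoef N n * coef f n := conv_trig hf

lemma isTest_fejer (N : ℕ) (hf : Integrable f torusMeasure) : IsTest (fejer N f) := by
  rw [fejer_eq_trig N hf]; exact isTest_trig _ _

lemma continuous_fejerKernel (N : ℕ) : Continuous (fejerKernel N) := (isTest_trig _ _).continuous

lemma fejer_congr_ae (N : ℕ) (h : f =ᵐ[torusMeasure] g) : fejer N f = fejer N g := by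
  ext x
  exact integral_congr_ae (by filter_upwards [h] with y hy; rw [hy])

lemma integrable_fejerKernel_mul (N : ℕ) (hf : Integrable f torusMeasure) (x : T2) :
    Integrable (fun y => fejerKernel N (x - y) * f y) torusMeasure := by
  have hk := continuous_fejerKernel N
  exact hf.bdd_mul (c := ∑ n ∈ fejerSupp N, ‖(fejerCoef N n : ℂ)‖)
    (by fun_prop) (Eventually.of_forall fun y => abs_trig_le _)

lemma fejer_sub (N : ℕ) (hf : Integrable f torusMeasure) (hg : Integrable g torusMeasure) :
    fejer N (fun x => f x - g x) = fun x => fejer N f x - fejer N g x := by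
  ext x
  simp only [fejer, conv]
  rw [← integral_sub (integrable_fejerKernel_mul N hf x) (integrable_fejerKernel_mul N hg x)]
  simp only [mul_sub]

lemma fejer_mono (N : ℕ) (hf : Integrable f torusMeasure) (hg : Integrable g torusMeasure)
    (h : f ≤ᵐ[torusMeasure] g) (x : T2) : fejer N f x ≤ fejer N g x := by
  refine integral_mono_ae (integrable_fejerKernel_mul N hf x) (integrable_fejerKernel_mul N hg x) ?_
  filter_upwards [h] with y hy
  exact mul_le_mul_of_nonneg_left hy (fejerKernel_nonneg _ _)

lemma integral_fejerKernel_sub (N : ℕ) (x : T2) :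
    ∫ y, fejerKernel N (x - y) ∂torusMeasure = 1 := by
  have h := integral_add_right_eq_self (μ := torusMeasure) (fejerKernel N) (-x)
  rw [integral_fejerKernel] at h
  refine Eq.trans (integral_congr_ae (Eventually.of_forall fun y => ?_)) h
  simp only
  rw [← fejerKernel_neg, neg_sub, sub_eq_add_neg]

lemma fejer_const (N : ℕ) (c : ℝ) (x : T2) : fejer N (fun _ => c) x = c := by
  simp [fejer, conv, integral_mul_const, integral_fejerKernel_sub]

lemma const_le_fejer (N : ℕ) (hf : Integrable f torusMeasure) {c : ℝ}
    (h : ∀ᵐ x ∂torusMeasure, c ≤ f x) (x : T2) : c ≤ fejer N f x := by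
  have := fejer_mono N (integrable_const c) hf h x
  rwa [fejer_const] at this

lemma fejer_le_const (N : ℕ) (hf : Integrable f torusMeasure) {c : ℝ}
    (h : ∀ᵐ x ∂torusMeasure, f x ≤ c) (x : T2) : fejer N f x ≤ c := by
  have := fejer_mono N hf (integrable_const c) h x
  rwa [fejer_const] at this

lemma abs_fejer_le (N : ℕ) (hf : Integrable f torusMeasure) {c : ℝ}
    (h : ∀ᵐ x ∂torusMeasure, |f x| ≤ c) (x : T2) : |fejer N f x| ≤ c :=
  abs_le.2 ⟨const_le_fejer N hf (h.mono fun _ hx => (abs_le.1 hx).1) x,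
    fejer_le_const N hf (h.mono fun _ hx => (abs_le.1 hx).2) x⟩

/-- The Fejér kernel as a probability density. -/
def fejerMeasure (N : ℕ) : Measure T2 :=
  torusMeasure.withDensity fun y => ENNReal.ofReal (fejerKernel N y)

instance (N : ℕ) : IsProbabilityMeasure (fejerMeasure N) := ⟨by
  rw [fejerMeasure, withDensity_apply _ MeasurableSet.univ, Measure.restrict_univ,
    ← ofReal_integral_eq_lintegral_ofReal
      (integrable_of_continuous (continuous_fejerKernel N))
      (Eventually.of_forall (fejerKernel_nonneg N)), integral_fejerKernel, ENNReal.ofReal_one]⟩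

lemma enorm_fejer_le (N : ℕ) (hf : Measurable f) (x : T2) :
    ‖fejer N f x‖ₑ ≤ ∫⁻ y, ‖f (x + y)‖ₑ ∂(fejerMeasure N) := by
  have hk := (continuous_fejerKernel N).measurable
  rw [fejerMeasure, lintegral_withDensity_eq_lintegral_mul _ (by fun_prop) (by fun_prop)]
  refine (enorm_integral_le_lintegral_enorm _).trans (le_of_eq ?_)
  rw [← lintegral_add_left_eq_self (fun y => ‖fejerKernel N (x - y) * f y‖ₑ) x]
  refine lintegral_congr fun y => ?_
  simp only [Pi.mul_apply, enorm_mul]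
  rw [show x - (x + y) = -y by abel, fejerKernel_neg,
    Real.enorm_eq_ofReal (fejerKernel_nonneg N y)]

/-- Fejér means are contractions on `L^p`. -/
lemma eLpNorm_fejer_le (N : ℕ) (hf : AEStronglyMeasurable f torusMeasure) {p : ℝ≥0∞} (hp : 1 ≤ p)
    (hp' : p ≠ ∞) : eLpNorm (fejer N f) p torusMeasure ≤ eLpNorm f p torusMeasure := by
  rw [eLpNorm_congr_ae hf.ae_eq_mk, fejer_congr_ae N hf.ae_eq_mk]
  exact eLpNorm_le_of_enorm_le_average (fejerMeasure N) measurable_id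
    hf.stronglyMeasurable_mk.measurable hp hp' fun x =>
      enorm_fejer_le N hf.stronglyMeasurable_mk.measurable x

lemma integral_fejerKernel_mul_mFourier (N : ℕ) (n : Fin 2 → ℤ) :
    ∫ y, (fejerKernel N y : ℂ) * mFourier n y ∂torusMeasure = fejerCoef N (-n) := by
  have hi : ∀ k, Integrable (fun y : T2 => (fejerCoef N k : ℂ) * mFourier (k + n) y)
      torusMeasure := fun k =>
    (by fun_prop : Continuous fun y : T2 => (fejerCoef N k : ℂ) * mFourier (k + n) y)
      |>.integrable_of_hasCompactSupport (HasCompactSupport.of_compactSpace _)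
  simp only [ofReal_fejerKernel, Finset.sum_mul, mul_assoc, ← mFourier_add]
  rw [integral_finsetSum _ fun k _ => hi k]
  simp only [integral_const_mul, integral_mFourier, add_eq_zero_iff_eq_neg, mul_ite, mul_one,
    mul_zero, Finset.sum_ite_eq']
  split_ifs with h
  · rfl
  · rw [fejerCoef_eq_zero h, Complex.ofReal_zero]

lemma fejer_trig (N : ℕ) (S : Finset (Fin 2 → ℤ)) (c : (Fin 2 → ℤ) → ℂ) :
    fejer N (trig S c) = trig S fun n => fejerCoef N (-n) * c n := by
  ext x
  have hk := continuous_fejerKernel N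
  have h1 : fejer N (trig S c) x = ∫ y, fejerKernel N y * trig S c (x + y) ∂torusMeasure := by
    have h := integral_add_left_eq_self (μ := torusMeasure)
      (fun y => fejerKernel N (x - y) * trig S c y) x
    rw [fejer, conv, ← h]
    refine integral_congr_ae (Eventually.of_forall fun y => ?_)
    simp only
    rw [show x - (x + y) = -y by abel, fejerKernel_neg]
  have hi : ∀ n, Integrable (fun y : T2 => c n * mFourier n x * ((fejerKernel N y : ℂ) *
      mFourier n y)) torusMeasure := fun n =>
    (by fun_prop : Continuous fun y : T2 => c n * mFourier n x * ((fejerKernel N y : ℂ) *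
      mFourier n y)) |>.integrable_of_hasCompactSupport (HasCompactSupport.of_compactSpace _)
  have h2 : (fun y => fejerKernel N y * trig S c (x + y)) = fun y =>
      (∑ n ∈ S, c n * mFourier n x * ((fejerKernel N y : ℂ) * mFourier n y)).re := by
    ext y
    rw [trig, ← Complex.re_ofReal_mul, Finset.mul_sum]
    congr 1
    refine Finset.sum_congr rfl fun n _ => ?_
    rw [mFourier_add_apply]; ring
  have h3 := integral_re (𝕜 := ℂ) (integrable_finsetSum S fun n _ => hi n)
  simp only [RCLike.re_to_complex] at h3
  rw [h1, h2, h3, integral_finsetSum _ fun n _ => hi n, trig]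
  congr 1
  refine Finset.sum_congr rfl fun n _ => ?_
  rw [integral_const_mul, integral_fejerKernel_mul_mFourier]
  ring

/-- Real trigonometric polynomials are dense in `L^p`. -/
lemma exists_trig_eLpNorm_sub_le {p : ℝ≥0∞} (hp : 1 ≤ p) (hp' : p ≠ ∞)
    (hf : MemLp f p torusMeasure) {ε : ℝ≥0∞} (hε : ε ≠ 0) :
    ∃ S c, eLpNorm (fun x => f x - trig S c x) p torusMeasure ≤ ε := by
  have : Fact (1 ≤ p) := ⟨hp⟩
  -- the `L^p` density of characters is stated for the measure `volume` built from this instance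
  let _ : MeasureSpace UnitAddCircle := ⟨AddCircle.haarAddCircle⟩
  have hF : MemLp (fun x => (f x : ℂ)) p (volume : Measure T2) := hf.ofReal
  have hd : hF.toLp _ ∈ (Submodule.span ℂ (range (@mFourierLp (Fin 2) _ p _))).topologicalClosure := by
    rw [span_mFourierLp_closure_eq_top hp']; trivial
  rw [← SetLike.mem_coe, Submodule.topologicalClosure_coe, EMetric.mem_closure_iff] at hd
  obtain ⟨g, hg, hgε⟩ := hd ε (pos_iff_ne_zero.2 hε)
  obtain ⟨l, hl⟩ := (Finsupp.mem_span_range_iff_exists_finsupp).1 hg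
  refine ⟨l.support, l, ?_⟩
  have h1 : g =ᵐ[volume] fun x => ∑ n ∈ l.support, l n * mFourier n x := by
    rw [← hl, Finsupp.sum]
    have h2 := fun n => coeFn_mFourierLp (d := Fin 2) p n
    have h3 := Lp.coeFn_finsetSum l.support fun n => l n • mFourierLp (d := Fin 2) p n
    have h4 : ∀ n, (l n • mFourierLp (d := Fin 2) p n : Lp ℂ p (volume : Measure T2)) =ᵐ[volume]
        fun x => l n * mFourier n x := fun n => by
      filter_upwards [Lp.coeFn_smul (l n) (mFourierLp (d := Fin 2) p n), h2 n] with x hx hx'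
      rw [hx, Pi.smul_apply, hx', smul_eq_mul]
    have h5 : ∀ᵐ x ∂(volume : Measure T2), ∀ n,
        (l n • mFourierLp (d := Fin 2) p n : Lp ℂ p (volume : Measure T2)) x
          = l n * mFourier n x := ae_all_iff.2 h4
    filter_upwards [h3, h5] with x hx hx'
    rw [hx]
    simp [hx']
  rw [Lp.edist_def] at hgε
  refine le_trans ?_ hgε.le
  refine eLpNorm_mono_ae ?_
  filter_upwards [h1, hF.coeFn_toLp] with x hx hx'
  simp only [Pi.sub_apply, hx, hx']
  have : f x - trig l.support l x = ((f x : ℂ) - ∑ n ∈ l.support, l n * mFourier n x).re := by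
    simp [trig]
  rw [this]
  exact Complex.abs_re_le_norm _

lemma eLpNorm_le_of_forall_abs_le {f : T2 → ℝ} {C : ℝ} (h : ∀ x, |f x| ≤ C) (p : ℝ≥0∞) :
    eLpNorm f p torusMeasure ≤ ENNReal.ofReal C := by
  refine (eLpNorm_le_of_ae_bound (Eventually.of_forall h)).trans ?_
  simp

/-- Fejér means converge in `L^p`. -/
lemma tendsto_eLpNorm_fejer_sub {p : ℝ≥0∞} (hp : 1 ≤ p) (hp' : p ≠ ∞)
    (hf : MemLp f p torusMeasure) :
    Tendsto (fun N => eLpNorm (fun x => fejer N f x - f x) p torusMeasure) atTop (𝓝 0) := by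
  rw [ENNReal.tendsto_nhds_zero]
  intro ε hε
  obtain ⟨S, c, hc⟩ := exists_trig_eLpNorm_sub_le hp hp' hf (ε := ε / 3)
    (ENNReal.div_pos hε.ne' (by simp)).ne'
  have hfi := hf.integrable hp
  have ht := isTest_trig S c
  have hlim : Tendsto (fun N : ℕ => ENNReal.ofReal (∑ n ∈ S, ‖((fejerCoef N (-n) : ℂ) - 1) * c n‖))
      atTop (𝓝 0) := by
    rw [← ENNReal.ofReal_zero]
    refine ENNReal.tendsto_ofReal ?_
    have : Tendsto (fun N : ℕ => ∑ n ∈ S, ‖((fejerCoef N (-n) : ℂ) - 1) * c n‖) atTop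
        (𝓝 (∑ n ∈ S, ‖(((1 : ℝ) : ℂ) - 1) * c n‖)) := by
      refine tendsto_finsetSum _ fun n _ => ?_
      have h1 := (Complex.continuous_ofReal.tendsto 1).comp (tendsto_fejerCoef (-n))
      exact ((h1.sub_const 1).mul_const _).norm
    simpa using this
  filter_upwards [ENNReal.tendsto_nhds_zero.1 hlim (ε / 3) (ENNReal.div_pos hε.ne' (by simp))]
    with N hN
  have hm := isTest_fejer N hfi
  have e : (fun x => fejer N f x - f x) = (fun x => fejer N (fun y => f y - trig S c y) x) +
      ((fun x => fejer N (trig S c) x - trig S c x) - fun x => f x - trig S c x) := by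
    ext x
    simp only [fejer_sub N hfi ht.integrable, Pi.add_apply, Pi.sub_apply]
    ring
  have hd := hf.sub (ht.memLp p)
  rw [e]
  calc _ ≤ eLpNorm (fejer N (fun y => f y - trig S c y)) p torusMeasure +
        (eLpNorm (fun x => fejer N (trig S c) x - trig S c x) p torusMeasure +
          eLpNorm (fun x => f x - trig S c x) p torusMeasure) := by
        have hft := isTest_fejer N ht.integrable
        refine (eLpNorm_add_le ?_ ?_ hp).trans (add_le_add le_rfl (eLpNorm_sub_le ?_ ?_ hp))
        · exact (isTest_fejer N (hfi.sub ht.integrable)).continuous.aestronglyMeasurable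
        · exact ((hft.sub ht).continuous.aestronglyMeasurable).sub hd.1
        · exact (hft.sub ht).continuous.aestronglyMeasurable
        · exact hd.1
    _ ≤ ε / 3 + (ε / 3 + ε / 3) := by
        refine add_le_add ((eLpNorm_fejer_le N hd.1 hp hp').trans hc) (add_le_add ?_ hc)
        refine le_trans (eLpNorm_le_of_forall_abs_le (fun x => ?_) p) hN
        rw [fejer_trig, trig_sub]
        refine (abs_trig_le x).trans (le_of_eq ?_)
        simp [sub_mul]
    _ = ε := by rw [← add_assoc, ENNReal.add_thirds]

/-! ### Weak derivatives -/

/-- Fejér means commute with weak derivatives. -/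
lemma HasWeakPartial.pd_fejer {a b : ℕ} (h : HasWeakPartial a b f g) (N : ℕ) :
    pd a b (fejer N f) = fejer N g := by
  obtain ⟨hf, hg, h⟩ := h
  ext x
  set c : (Fin 2 → ℤ) → ℂ := fun n => fejerCoef N n
  -- the translated kernel `y ↦ K_N (x - y)` is an admissible test function
  have h1 := h _ (isTest_trig (fejerSupp N) fun n => conj (c n * mFourier n x))
  have e1 : ∀ y, ((partialDeriv 0)^[a] ((partialDeriv 1)^[b]
      (trig (fejerSupp N) fun n => conj (c n * mFourier n x)))) y =
      (-1) ^ (a + b) * trig (fejerSupp N) (fun n => symbol a b n * c n) (x - y) := fun y => by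
    change pd a b _ y = _
    rw [pd_trig, trig_sub_apply, mul_trig]
    congr 1; ext n
    simp only [map_mul, conj_symbol]
    push_cast
    have : ((-1 : ℂ) ^ (a + b)) * (-1) ^ (a + b) = 1 := by rw [← mul_pow]; simp
    linear_combination (-symbol a b n * (conj (c n) * conj (mFourier n x))) * this
  simp only [e1, ← trig_sub_apply] at h1
  have h2 : conv (trig (fejerSupp N) fun n => symbol a b n * c n) f x = fejer N g x := by
    have e2 : ((-1 : ℝ) ^ (a + b)) ≠ 0 := by positivity
    refine mul_left_cancel₀ e2 (Eq.trans ?_ (h1.trans ?_))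
    · rw [conv, ← integral_const_mul]
      refine integral_congr_ae (Eventually.of_forall fun y => ?_)
      simp only; ring
    · simp only [fejer, conv, mul_comm (g _)]; rfl
  rw [← h2, fejer_eq_trig N hf, pd_trig, conv_trig hf]
  simp only [mul_assoc, c]

/-- Weak derivatives are unique almost everywhere. -/
lemma HasWeakPartial.ae_eq {a b : ℕ} {g' : T2 → ℝ} (h : HasWeakPartial a b f g)
    (h' : HasWeakPartial a b f g') : g =ᵐ[torusMeasure] g' := by
  have e : ∀ N, fejer N g = fejer N g' := fun N => by rw [← h.pd_fejer, ← h'.pd_fejer]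
  have h1 := tendsto_eLpNorm_fejer_sub le_rfl ENNReal.one_ne_top
    (memLp_one_iff_integrable.2 (h.2.1.sub h'.2.1))
  have h2 : ∀ N, fejer N (g - g') = 0 := fun N => by
    have := fejer_sub N h.2.1 h'.2.1
    rw [show g - g' = fun x => g x - g' x from rfl, this, e]; simp; rfl
  simp only [h2, Pi.zero_apply, zero_sub] at h1
  have h3 := tendsto_nhds_unique h1 tendsto_const_nhds
  have h4 : eLpNorm (g - g') 1 torusMeasure = 0 := by
    rw [← eLpNorm_neg]; exact h3.symm
  rw [eLpNorm_eq_zero_iff (h.2.1.sub h'.2.1).1 one_ne_zero] at h4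
  filter_upwards [h4] with x hx
  simpa [sub_eq_zero] using hx

lemma weakPartialNorm_eq {a b : ℕ} (h : HasWeakPartial a b f g) (p : ℝ≥0∞) :
    weakPartialNorm a b p f = eLpNorm g p torusMeasure := by
  refine le_antisymm (iInf₂_le g h) (le_iInf₂ fun g' h' => ?_)
  rw [eLpNorm_congr_ae (h.ae_eq h')]

/-- Smooth functions converging in `L^1` together with a derivative produce a weak derivative. -/
lemma hasWeakPartial_of_tendsto {a b : ℕ} (hf : Integrable f torusMeasure)
    (hg : Integrable g torusMeasure) {F : ℕ → T2 → ℝ} (hF : ∀ n, IsTest (F n))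
    (h1 : Tendsto (fun n => eLpNorm (fun x => F n x - f x) 1 torusMeasure) atTop (𝓝 0))
    (h2 : Tendsto (fun n => eLpNorm (fun x => pd a b (F n) x - g x) 1 torusMeasure) atTop (𝓝 0)) :
    HasWeakPartial a b f g := by
  refine ⟨hf, hg, fun ψ hψ => ?_⟩
  have key : ∀ {u : T2 → ℝ} {U : ℕ → T2 → ℝ}, Integrable u torusMeasure →
      (∀ n, IsTest (U n)) →
      Tendsto (fun n => eLpNorm (fun x => U n x - u x) 1 torusMeasure) atTop (𝓝 0) →
      ∀ {η : T2 → ℝ}, IsTest η → Tendsto (fun n => ∫ x, U n x * η x ∂torusMeasure) atTop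
        (𝓝 (∫ x, u x * η x ∂torusMeasure)) := by
    intro u U hu hU h η hη
    obtain ⟨C, hC⟩ := (isCompact_univ (X := T2)).exists_bound_of_continuousOn
      hη.continuous.continuousOn
    refine tendsto_integral_of_L1' _ ?_ ?_ ?_
    · exact hu.1.mul hη.continuous.aestronglyMeasurable
    · exact Eventually.of_forall fun n => ((hU n).mul hη).integrable
    · have h3 : Tendsto (fun n => eLpNorm (fun x => U n x - u x) 1 torusMeasure *
          ENNReal.ofReal C) atTop (𝓝 0) := by
        simpa using ENNReal.Tendsto.mul_const h (Or.inr (ENNReal.ofReal_ne_top (r := C)))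
      refine tendsto_of_tendsto_of_tendsto_of_le_of_le tendsto_const_nhds h3
        (fun _ => zero_le) fun n => ?_
      simp only [eLpNorm_one_eq_lintegral_enorm]
      rw [← lintegral_mul_const' _ _ ENNReal.ofReal_ne_top]
      refine lintegral_mono fun x => ?_
      simp only [Pi.sub_apply, ← sub_mul, enorm_mul]
      gcongr
      rw [← ofReal_norm]
      exact ENNReal.ofReal_le_ofReal (hC x (mem_univ x))
  have h3 := key hf hF h1 (hψ.iterDeriv a b)
  have h4 := (key hg (fun n => (hF n).iterDeriv a b) h2 hψ).const_mul ((-1 : ℝ) ^ (a + b))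
  refine tendsto_nhds_unique h3 (h4.congr fun n => ?_)
  exact ((hF n).integral_mul_pd hψ a b).symm

/-- Cauchy sequences in `L^p`. -/
def CauchyLp (p : ℝ≥0∞) (U : ℕ → T2 → ℝ) : Prop :=
  Tendsto (fun z : ℕ × ℕ => eLpNorm (fun x => U z.1 x - U z.2 x) p torusMeasure) atTop (𝓝 0)

lemma cauchyLp_of_tendsto {p : ℝ≥0∞} (hp : 1 ≤ p) {U : ℕ → T2 → ℝ}
    (hU : ∀ n, MemLp (U n) p torusMeasure) (hf : MemLp f p torusMeasure)
    (h : Tendsto (fun n => eLpNorm (fun x => U n x - f x) p torusMeasure) atTop (𝓝 0)) :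
    CauchyLp p U := by
  have h1 : Tendsto (fun z : ℕ × ℕ => eLpNorm (fun x => U z.1 x - f x) p torusMeasure +
      eLpNorm (fun x => U z.2 x - f x) p torusMeasure) atTop (𝓝 0) := by
    rw [← prod_atTop_atTop_eq]
    simpa using (h.comp tendsto_fst).add (h.comp tendsto_snd)
  refine tendsto_of_tendsto_of_tendsto_of_le_of_le tendsto_const_nhds h1
    (fun _ => zero_le) fun z => ?_
  have e : (fun x => U z.1 x - U z.2 x) = (fun x => U z.1 x - f x) - fun x => U z.2 x - f x := by
    ext x; simp
  simp only [e]
  exact eLpNorm_sub_le ((hU _).sub hf).1 ((hU _).sub hf).1 hp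

lemma CauchyLp.exists_tendsto {p : ℝ≥0∞} (hp : 1 ≤ p) {U : ℕ → T2 → ℝ}
    (hU : ∀ n, MemLp (U n) p torusMeasure) (h : CauchyLp p U) :
    ∃ g, MemLp g p torusMeasure ∧
      Tendsto (fun n => eLpNorm (fun x => U n x - g x) p torusMeasure) atTop (𝓝 0) := by
  have : Fact (1 ≤ p) := ⟨hp⟩
  have hc : CauchySeq fun n => (hU n).toLp (U n) := by
    rw [EMetric.cauchySeq_iff]
    intro ε hε
    have h1 := h.eventually_lt_const hε
    rw [← prod_atTop_atTop_eq, eventually_prod_iff] at h1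
    obtain ⟨P, hP, Q, hQ, hPQ⟩ := h1
    obtain ⟨N, hN⟩ := eventually_atTop.1 (hP.and hQ)
    refine ⟨N, fun m hm n hn => ?_⟩
    rw [Lp.edist_toLp_toLp]
    exact hPQ (hN m hm).1 (hN n hn).2
  obtain ⟨G, hG⟩ := cauchySeq_tendsto_of_complete hc
  refine ⟨G, Lp.memLp G, ?_⟩
  rw [Lp.tendsto_Lp_iff_tendsto_eLpNorm'] at hG
  refine hG.congr fun n => eLpNorm_congr_ae ?_
  filter_upwards [(hU n).coeFn_toLp] with x hx
  simp [hx]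

lemma CauchyLp.mono {p r : ℝ≥0∞} {U V : ℕ → T2 → ℝ} (hV : CauchyLp r V) {C : ℝ≥0∞} (hC : C ≠ ∞)
    (h : ∀ n m, eLpNorm (fun x => U n x - U m x) p torusMeasure ≤
      C * eLpNorm (fun x => V n x - V m x) r torusMeasure) : CauchyLp p U := by
  have h1 := ENNReal.Tendsto.const_mul hV (Or.inr hC)
  rw [mul_zero] at h1
  exact tendsto_of_tendsto_of_tendsto_of_le_of_le tendsto_const_nhds h1
    (fun _ => zero_le) fun z => h _ _

lemma tendsto_eLpNorm_one {p : ℝ≥0∞} (hp : 1 ≤ p) {U : ℕ → T2 → ℝ}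
    (hU : ∀ n, AEStronglyMeasurable (U n) torusMeasure) (hf : AEStronglyMeasurable f torusMeasure)
    (h : Tendsto (fun n => eLpNorm (fun x => U n x - f x) p torusMeasure) atTop (𝓝 0)) :
    Tendsto (fun n => eLpNorm (fun x => U n x - f x) 1 torusMeasure) atTop (𝓝 0) :=
  tendsto_of_tendsto_of_tendsto_of_le_of_le tendsto_const_nhds h
    (fun _ => zero_le) fun n => eLpNorm_le_eLpNorm_of_exponent_le hp ((hU n).sub hf)

/-- A function has a weak derivative in `L^p` as soon as the corresponding derivatives of its
Fejér means are Cauchy in `L^p`. -/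
lemma exists_hasWeakPartial_of_cauchyLp {p : ℝ≥0∞} (hp : 1 ≤ p) (hf : Integrable f torusMeasure)
    {a b : ℕ} (h : CauchyLp p fun N => pd a b (fejer N f)) :
    ∃ g, HasWeakPartial a b f g ∧ MemLp g p torusMeasure := by
  have ht := fun N => (isTest_fejer N hf).iterDeriv a b
  obtain ⟨g, hg, hlim⟩ := h.exists_tendsto hp fun N => (ht N).memLp p
  refine ⟨g, hasWeakPartial_of_tendsto hf (hg.integrable hp) (fun N => isTest_fejer N hf)
    (tendsto_eLpNorm_fejer_sub le_rfl ENNReal.one_ne_top (memLp_one_iff_integrable.2 hf))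
    (tendsto_eLpNorm_one hp (fun N => ((ht N).memLp p).1) hg.1 hlim), hg⟩

/-- The converse of `exists_hasWeakPartial_of_cauchyLp`. -/
lemma HasWeakPartial.cauchyLp {p : ℝ≥0∞} (hp : 1 ≤ p) (hp' : p ≠ ∞) {a b : ℕ}
    (h : HasWeakPartial a b f g) (hg : MemLp g p torusMeasure) :
    CauchyLp p fun N => pd a b (fejer N f) := by
  simp only [h.pd_fejer]
  exact cauchyLp_of_tendsto hp (fun N => (isTest_fejer N h.2.1).memLp p) hg
    (tendsto_eLpNorm_fejer_sub hp hp' hg)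

end

/-! ### A Bellman function -/

namespace Bellman

/-- The quantity `v² + (u² + η)^a`. -/
def wt (a η u v : ℝ) : ℝ := v ^ 2 + (u ^ 2 + η) ^ a

/-- A regularised Bellman function for the bilinear heat embedding, of size `|u|^p + |v|^q` with
`a = p - 1`, `κ = (2 - q) / 2`. -/
def fn (a κ η M u v : ℝ) : ℝ := M * (v ^ 2 + η ^ a) ^ (1 - κ) + u ^ 2 * wt a η u v ^ κ

/-- First derivative of `fn` in `u`. -/
def du (a κ η u v : ℝ) : ℝ :=
  2 * u * wt a η u v ^ κ + 2 * a * κ * (u ^ 3 * ((u ^ 2 + η) ^ (a - 1) * wt a η u v ^ (κ - 1)))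

/-- First derivative of `fn` in `v`. -/
def dv (a κ η M u v : ℝ) : ℝ :=
  2 * M * (1 - κ) * (v * (v ^ 2 + η ^ a) ^ (-κ)) + 2 * κ * (u ^ 2 * (v * wt a η u v ^ (κ - 1)))

/-- Second derivative of `fn` in `u`. -/
def duu (a κ η u v : ℝ) : ℝ :=
  2 * wt a η u v ^ κ + 10 * a * κ * (u ^ 2 * ((u ^ 2 + η) ^ (a - 1) * wt a η u v ^ (κ - 1)))
    + 4 * a * κ * (a - 1) * (u ^ 4 * ((u ^ 2 + η) ^ (a - 1 - 1) * wt a η u v ^ (κ - 1)))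
    - 4 * a ^ 2 * κ * (1 - κ) *
      (u ^ 4 * (((u ^ 2 + η) ^ (a - 1)) ^ 2 * wt a η u v ^ (κ - 1 - 1)))

/-- Mixed second derivative of `fn`. -/
def duv (a κ η u v : ℝ) : ℝ :=
  4 * κ * (u * (v * wt a η u v ^ (κ - 1))) - 4 * a * κ * (1 - κ) *
    (u ^ 3 * ((u ^ 2 + η) ^ (a - 1) * (v * wt a η u v ^ (κ - 1 - 1))))

/-- Second derivative of `fn` in `v`. -/
def dvv (a κ η M u v : ℝ) : ℝ :=
  2 * M * (1 - κ) * ((v ^ 2 + η ^ a) ^ (-κ) - 2 * κ * (v ^ 2 * (v ^ 2 + η ^ a) ^ (-κ - 1)))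
    + 2 * κ * (u ^ 2 * wt a η u v ^ (κ - 1))
    - 4 * κ * (1 - κ) * (u ^ 2 * (v ^ 2 * wt a η u v ^ (κ - 1 - 1)))

variable {a κ η M : ℝ}

lemma wt_pos (hη : 0 < η) (u v : ℝ) : 0 < wt a η u v := by
  unfold wt; positivity

section Deriv

variable {u v : ℝ → ℝ} {u' v' t : ℝ}

lemma hasDerivAt_wt (hη : 0 < η) (hu : HasDerivAt u u' t) (hv : HasDerivAt v v' t) :
    HasDerivAt (fun t => wt a η (u t) (v t))
      (2 * v t * v' + 2 * u t * u' * a * (u t ^ 2 + η) ^ (a - 1)) t := by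
  have h1 := ((hu.fun_pow 2).add_const η).rpow_const (p := a) (Or.inl (by positivity))
  refine ((hv.fun_pow 2).add h1).congr_deriv ?_
  push_cast; ring

lemma hasDerivAt_wt_rpow (hη : 0 < η) (hu : HasDerivAt u u' t) (hv : HasDerivAt v v' t) (r : ℝ) :
    HasDerivAt (fun t => wt a η (u t) (v t) ^ r)
      ((2 * v t * v' + 2 * u t * u' * a * (u t ^ 2 + η) ^ (a - 1)) * r *
        wt a η (u t) (v t) ^ (r - 1)) t :=
  (hasDerivAt_wt hη hu hv).rpow_const (Or.inl (wt_pos hη _ _).ne')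

lemma hasDerivAt_fn (hη : 0 < η) (hu : HasDerivAt u u' t) (hv : HasDerivAt v v' t) :
    HasDerivAt (fun t => fn a κ η M (u t) (v t))
      (du a κ η (u t) (v t) * u' + dv a κ η M (u t) (v t) * v') t := by
  have h1 := (((hv.fun_pow 2).add_const (η ^ a)).rpow_const (p := 1 - κ)
    (Or.inl (by positivity))).const_mul M
  have h2 := (hu.fun_pow 2).mul (hasDerivAt_wt_rpow (a := a) hη hu hv κ)
  refine (h1.add h2).congr_deriv ?_
  rw [show 1 - κ - 1 = -κ by ring]
  simp only [du, dv]
  push_cast; ring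

lemma hasDerivAt_du (hη : 0 < η) (hu : HasDerivAt u u' t) (hv : HasDerivAt v v' t) :
    HasDerivAt (fun t => du a κ η (u t) (v t))
      (duu a κ η (u t) (v t) * u' + duv a κ η (u t) (v t) * v') t := by
  have h1 := (hu.const_mul 2).mul (hasDerivAt_wt_rpow (a := a) hη hu hv κ)
  have h3 := ((hu.fun_pow 2).add_const η).rpow_const (p := a - 1) (Or.inl (by positivity))
  have h2 := ((hu.fun_pow 3).mul (h3.mul (hasDerivAt_wt_rpow (a := a) hη hu hv (κ - 1)))).const_mul
    (2 * a * κ)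
  refine (h1.add h2).congr_deriv ?_
  simp only [duu, duv, Pi.mul_apply]
  push_cast; ring

lemma hasDerivAt_dv (hη : 0 < η) (hu : HasDerivAt u u' t) (hv : HasDerivAt v v' t) :
    HasDerivAt (fun t => dv a κ η M (u t) (v t))
      (duv a κ η (u t) (v t) * u' + dvv a κ η M (u t) (v t) * v') t := by
  have h1 := (hv.mul (((hv.fun_pow 2).add_const (η ^ a)).rpow_const (p := -κ)
    (Or.inl (by positivity)))).const_mul (2 * M * (1 - κ))
  have h2 := ((hu.fun_pow 2).mul (hv.mul (hasDerivAt_wt_rpow (a := a) hη hu hv (κ - 1)))).const_mul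
    (2 * κ)
  refine (h1.add h2).congr_deriv ?_
  simp only [duv, dvv, Pi.mul_apply]
  push_cast; ring

end Deriv

section Continuous

variable {X : Type*} [TopologicalSpace X] {f g : X → ℝ}

lemma continuous_wt_rpow (hη : 0 < η) (hf : Continuous f) (hg : Continuous g) (r : ℝ) :
    Continuous fun x => wt a η (f x) (g x) ^ r := by
  have h : Continuous fun x => wt a η (f x) (g x) := by
    unfold wt
    exact (hg.pow 2).add (((hf.pow 2).add continuous_const).rpow_const fun x =>
      Or.inl (add_pos_of_nonneg_of_pos (sq_nonneg _) hη).ne')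
  exact h.rpow_const fun x => Or.inl (wt_pos hη _ _).ne'

lemma continuous_sq_add_rpow (hη : 0 < η) (hf : Continuous f) (r : ℝ) :
    Continuous fun x => (f x ^ 2 + η) ^ r :=
  ((hf.pow 2).add continuous_const).rpow_const fun _ =>
    Or.inl (add_pos_of_nonneg_of_pos (sq_nonneg _) hη).ne'

lemma continuous_fn (hη : 0 < η) (hf : Continuous f) (hg : Continuous g) :
    Continuous fun x => fn a κ η M (f x) (g x) := by
  have h1 := continuous_wt_rpow (a := a) hη hf hg
  have h2 := continuous_sq_add_rpow (η := η ^ a) (by positivity) hg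
  unfold fn
  exact (continuous_const.mul (h2 _)).add ((hf.pow 2).mul (h1 _))

lemma continuous_du (hη : 0 < η) (hf : Continuous f) (hg : Continuous g) :
    Continuous fun x => du a κ η (f x) (g x) := by
  have h1 := continuous_wt_rpow (a := a) hη hf hg
  have h2 := continuous_sq_add_rpow hη hf
  have h3 := h1 κ; have h4 := h1 (κ - 1); have h5 := h2 (a - 1)
  unfold du; fun_prop

lemma continuous_dv (hη : 0 < η) (hf : Continuous f) (hg : Continuous g) :
    Continuous fun x => dv a κ η M (f x) (g x) := by
  have h1 := continuous_wt_rpow (a := a) hη hf hg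
  have h2 := continuous_sq_add_rpow (η := η ^ a) (by positivity) hg
  have h3 := h2 (-κ); have h4 := h1 (κ - 1)
  unfold dv; fun_prop

lemma continuous_duu (hη : 0 < η) (hf : Continuous f) (hg : Continuous g) :
    Continuous fun x => duu a κ η (f x) (g x) := by
  have h1 := continuous_wt_rpow (a := a) hη hf hg
  have h2 := continuous_sq_add_rpow hη hf
  have h3 := h1 κ; have h4 := h1 (κ - 1); have h5 := h1 (κ - 1 - 1)
  have h6 := h2 (a - 1); have h7 := h2 (a - 1 - 1)
  unfold duu; fun_prop

lemma continuous_duv (hη : 0 < η) (hf : Continuous f) (hg : Continuous g) :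
    Continuous fun x => duv a κ η (f x) (g x) := by
  have h1 := continuous_wt_rpow (a := a) hη hf hg
  have h2 := continuous_sq_add_rpow hη hf
  have h4 := h1 (κ - 1); have h5 := h1 (κ - 1 - 1); have h6 := h2 (a - 1)
  unfold duv; fun_prop

lemma continuous_dvv (hη : 0 < η) (hf : Continuous f) (hg : Continuous g) :
    Continuous fun x => dvv a κ η M (f x) (g x) := by
  have h1 := continuous_wt_rpow (a := a) hη hf hg
  have h2 := continuous_sq_add_rpow (η := η ^ a) (by positivity) hg
  have h3 := h2 (-κ); have h4 := h1 (κ - 1); have h5 := h1 (κ - 1 - 1); have h6 := h2 (-κ - 1)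
  unfold dvv; fun_prop

end Continuous

/-- The constant `M` for which the Bellman function is sufficiently convex. -/
def cst (a : ℝ) : ℝ := a * ((2 * a + 3) ^ 2 / 2 + 2)

/-- A criterion for a quadratic form to dominate `2 |x y|`, by completing the square. -/
lemma two_mul_abs_mul_le_of_bounds {n A B C c x y : ℝ} (hn : 0 < n) (hA : 2 * n ≤ A)
    (hB : |B| ≤ c) (hC : (c + 1) ^ 2 / 2 / n ≤ C) :
    2 * |x * y| ≤ A * x ^ 2 + 2 * B * x * y + C * y ^ 2 := by
  have h1 : -(2 * c * |x * y|) ≤ 2 * B * x * y := by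
    have : |2 * B * x * y| ≤ 2 * c * |x * y| := by
      rw [show 2 * B * x * y = 2 * B * (x * y) by ring, abs_mul, abs_mul, abs_two]
      gcongr
    linarith [neg_abs_le (2 * B * x * y)]
  have h2 : 2 * (c + 1) * |x * y| ≤ 2 * n * x ^ 2 + (c + 1) ^ 2 / 2 / n * y ^ 2 := by
    have : 2 * n * x ^ 2 + (c + 1) ^ 2 / 2 / n * y ^ 2 - 2 * (c + 1) * |x * y| =
        (2 * n * |x| - (c + 1) * |y|) ^ 2 / (2 * n) := by
      rw [abs_mul, ← sq_abs x, ← sq_abs y]; field_simp; ring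
    have : 0 ≤ (2 * n * |x| - (c + 1) * |y|) ^ 2 / (2 * n) := by positivity
    linarith
  nlinarith [mul_le_mul_of_nonneg_right hA (sq_nonneg x),
    mul_le_mul_of_nonneg_right hC (sq_nonneg y)]

lemma neg_two_le {κ r : ℝ} (h0 : 0 ≤ κ) (hr0 : 0 ≤ r) (hr : r ≤ 1) :
    -2 ≤ 2 * κ - 4 * κ * (1 - κ) * r := by
  have h1 : 4 * κ * (1 - κ) ≤ 1 := by nlinarith [sq_nonneg (1 - 2 * κ)]
  nlinarith [mul_le_mul_of_nonneg_right h1 hr0]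

lemma neg_two_mul_le {m r c : ℝ} (hr0 : 0 ≤ r) (hr : r ≤ m) (hc : -2 ≤ c) : -2 * m ≤ r * c := by
  nlinarith

/-- The Hessian of the Bellman function dominates `(x, y) ↦ 2 |x y|`. -/
lemma two_mul_abs_mul_le (ha : 1 ≤ a) (hκ : κ = (a - 1) / (2 * a)) (hη : 0 < η) (u v x y : ℝ) :
    2 * |x * y| ≤ duu a κ η u v * x ^ 2 + 2 * duv a κ η u v * x * y +
      dvv a κ η (cst a) u v * y ^ 2 := by
  have ha0 : 0 < a := by linarith
  have hκ0 : 0 ≤ κ := by rw [hκ]; apply div_nonneg <;> linarith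
  have hκa : 1 - 2 * κ = 1 / a := by rw [hκ]; field_simp; ring
  have hκ1 : κ ≤ 1 / 2 := by
    have : 0 < 1 / a := by positivity
    linarith
  have haκ : a * κ = (a - 1) / 2 := by rw [hκ]; field_simp
  set s := u ^ 2 + η with hs
  have hs0 : 0 < s := by positivity
  set P := s ^ a with hP
  have hP0 : 0 < P := by positivity
  set N := wt a η u v with hN
  have hN0 : 0 < N := wt_pos hη u v
  have hNe : N = v ^ 2 + P := rfl
  set n := N ^ κ with hn
  have hn0 : 0 < n := by positivity
  have e1 : N ^ (κ - 1) = n / N := by rw [Real.rpow_sub_one hN0.ne']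
  have e2 : N ^ (κ - 1 - 1) = n / N / N := by rw [Real.rpow_sub_one hN0.ne', e1]
  have e3 : s ^ (a - 1) = P / s := by rw [Real.rpow_sub_one hs0.ne']
  have e4 : s ^ (a - 1 - 1) = P / s / s := by rw [Real.rpow_sub_one hs0.ne', e3]
  set w := v ^ 2 + η ^ a with hw
  have hw0 : 0 < w := by positivity
  set W := w ^ (-κ) with hW
  have e5 : w ^ (-κ - 1) = W / w := by rw [Real.rpow_sub_one hw0.ne']
  have hPN : P ≤ N := by rw [hNe]; linarith [sq_nonneg v]
  have hvN : v ^ 2 ≤ N := by rw [hNe]; linarith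
  have hus : u ^ 2 ≤ s := by linarith
  have hwN : w ≤ N := by
    rw [hNe, hw, hP]; gcongr; linarith [sq_nonneg u]
  have hWn : 1 / n ≤ W := by
    rw [hW, hn, one_div, ← Real.rpow_neg hN0.le]
    exact Real.rpow_le_rpow_of_nonpos hw0 hwN (by linarith)
  -- the homogeneity of the weights: `u² N^{2κ} ≤ N`
  have hun : u ^ 2 * n ^ 2 ≤ N := by
    have h1 : s ≤ N ^ (1 / a) := by
      calc s = P ^ (1 / a) := by
            rw [hP, ← Real.rpow_mul hs0.le, mul_one_div_cancel ha0.ne', Real.rpow_one]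
        _ ≤ N ^ (1 / a) := by gcongr
    calc u ^ 2 * n ^ 2 ≤ N ^ (1 / a) * n ^ 2 := by gcongr; exact hus.trans h1
      _ = N ^ (1 / a + κ * 2) := by
          rw [hn, Real.rpow_add hN0, Real.rpow_mul hN0.le]; norm_cast
      _ = N := by rw [← hκa]; ring_nf; exact Real.rpow_one N
  set z := u ^ 2 / s with hz
  set θ := P / N with hθ
  have hz0 : 0 ≤ z := by positivity
  have hz1 : z ≤ 1 := (div_le_one hs0).2 hus
  have hθ0 : 0 ≤ θ := by positivity
  have hθ1 : θ ≤ 1 := (div_le_one hN0).2 hPN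
  refine two_mul_abs_mul_le_of_bounds (c := 2 * a + 2) hn0 ?_ ?_ ?_
  · have e : duu a κ η u v = 2 * n + n * (a * κ) * (10 * (z * θ) + 4 * (a - 1) * (z ^ 2 * θ)
        - 4 * a * (1 - κ) * (z ^ 2 * θ ^ 2)) := by
      simp only [duu, ← hN, ← hs, e1, e2, e3, e4, hz, hθ, ← hn]
      field_simp
      ring
    rw [e]
    have h1 : z ^ 2 * θ ≤ z * θ :=
      mul_le_mul_of_nonneg_right (pow_le_of_le_one hz0 hz1 two_ne_zero) hθ0
    have h2 : z ^ 2 * θ ^ 2 ≤ z ^ 2 * θ :=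
      mul_le_mul_of_nonneg_left (pow_le_of_le_one hθ0 hθ1 two_ne_zero) (sq_nonneg z)
    have h0 : 0 ≤ z ^ 2 * θ := by positivity
    have h3 : a * (1 - κ) * (z ^ 2 * θ ^ 2) ≤ a * (z ^ 2 * θ) := by
      have h4 : a * (1 - κ) ≤ a := mul_le_of_le_one_right ha0.le (by linarith)
      exact mul_le_mul h4 h2 (by positivity) ha0.le
    have h5 : 0 ≤ 10 * (z * θ) + 4 * (a - 1) * (z ^ 2 * θ)
        - 4 * a * (1 - κ) * (z ^ 2 * θ ^ 2) := by linarith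
    have h6 : 0 ≤ n * (a * κ) := by positivity
    exact le_add_of_nonneg_right (mul_nonneg h6 h5)
  · have h1 : |u * v| * n ≤ N := by
      have : (|u * v| * n) ^ 2 ≤ N ^ 2 := by
        rw [mul_pow, sq_abs]
        calc (u * v) ^ 2 * n ^ 2 = (u ^ 2 * n ^ 2) * v ^ 2 := by ring
          _ ≤ N * N := by gcongr
          _ = N ^ 2 := by ring
      exact abs_le_of_sq_le_sq' this hN0.le |>.2
    have e : duv a κ η u v = (u * v * n / N) * (4 * κ - 4 * (a * κ) * (1 - κ) * (z * θ)) := by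
      simp only [duv, ← hN, ← hs, e1, e2, e3, hz, hθ]
      field_simp
    have h2 : |u * v * n / N| ≤ 1 := by
      rw [abs_div, abs_mul, abs_of_pos hn0, abs_of_pos hN0, div_le_one hN0]; exact h1
    have h3 : |4 * κ - 4 * (a * κ) * (1 - κ) * (z * θ)| ≤ 2 * a + 2 := by
      have h4 : 0 ≤ z * θ := by positivity
      have h5 : z * θ ≤ 1 := mul_le_one₀ hz1 hθ0 hθ1
      have h6 : 0 ≤ (a * κ) * (1 - κ) := mul_nonneg (by positivity) (by linarith)
      have h7 : (a * κ) * (1 - κ) ≤ a / 2 := by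
        rw [haκ]
        linarith [mul_le_of_le_one_right (by linarith : (0 : ℝ) ≤ (a - 1) / 2)
          (by linarith : 1 - κ ≤ 1)]
      have h8 : (a * κ) * (1 - κ) * (z * θ) ≤ a / 2 * 1 := mul_le_mul h7 h5 h4 (by positivity)
      have h9 : 0 ≤ (a * κ) * (1 - κ) * (z * θ) := mul_nonneg h6 h4
      rw [abs_le]; constructor <;> linarith
    rw [e, abs_mul]
    calc _ ≤ 1 * (2 * a + 2) := mul_le_mul h2 h3 (abs_nonneg _) zero_le_one
      _ = _ := one_mul _
  · have e : dvv a κ η (cst a) u v = 2 * cst a * (1 - κ) * (W * (1 - 2 * κ * (v ^ 2 / w)))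
        + (u ^ 2 * n / N) * (2 * κ - 4 * κ * (1 - κ) * (v ^ 2 / N)) := by
      simp only [dvv, ← hN, ← hw, e1, e2, e5, ← hW]
      field_simp
      ring
    have h1 : u ^ 2 * n / N ≤ 1 / n := by
      rw [div_le_div_iff₀ hN0 hn0]; linarith
    have h2 : v ^ 2 / N ≤ 1 := (div_le_one hN0).2 hvN
    have h2' : 0 ≤ v ^ 2 / N := by positivity
    have h3 : v ^ 2 / w ≤ 1 := (div_le_one hw0).2 (by rw [hw]; linarith [Real.rpow_nonneg hη.le a])
    have h4 := neg_two_le hκ0 h2' h2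
    have h5 : 1 / a ≤ 1 - 2 * κ * (v ^ 2 / w) := by
      rw [← hκa]
      linarith [mul_le_of_le_one_right (mul_nonneg zero_le_two hκ0) h3]
    have hL : 0 < (2 * a + 3) ^ 2 / 2 + 2 := by positivity
    have h6 : ((2 * a + 3) ^ 2 / 2 + 2) * (1 / n) ≤
        2 * cst a * (1 - κ) * (W * (1 - 2 * κ * (v ^ 2 / w))) := by
      have h7 : (1 / n) * (1 / a) ≤ W * (1 - 2 * κ * (v ^ 2 / w)) :=
        mul_le_mul hWn h5 (by positivity) (by positivity)
      have h8 : cst a ≤ 2 * cst a * (1 - κ) := by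
        have : 0 ≤ cst a := by unfold cst; positivity
        have := mul_le_mul_of_nonneg_left hκ1 this
        linarith
      calc ((2 * a + 3) ^ 2 / 2 + 2) * (1 / n) = cst a * ((1 / n) * (1 / a)) := by
            unfold cst; field_simp
        _ ≤ _ := mul_le_mul h8 h7 (by positivity) (le_trans (by unfold cst; positivity) h8)
    have h7 : -2 * (1 / n) ≤ (u ^ 2 * n / N) * (2 * κ - 4 * κ * (1 - κ) * (v ^ 2 / N)) :=
      neg_two_mul_le (by positivity) h1 h4
    rw [e, show (2 * a + 2 + 1) ^ 2 / 2 / n = ((2 * a + 3) ^ 2 / 2 + 2) * (1 / n) + -2 * (1 / n) by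
      ring]
    linarith

lemma fn_nonneg (hM : 0 ≤ M) (hη : 0 < η) (u v : ℝ) : 0 ≤ fn a κ η M u v := by
  have := wt_pos (a := a) hη u v
  unfold fn; positivity

/-- The size of the Bellman function: with `a = p - 1` the exponents are `p` for `u` and
`p / (p - 1)` for `v`. -/
lemma fn_le (ha : 1 ≤ a) (hκ : κ = (a - 1) / (2 * a)) (hη : 0 < η) (hM : 0 ≤ M) (u v : ℝ) :
    fn a κ η M u v ≤ (M + 1) * |v| ^ ((a + 1) / a) + 2 ^ ((a + 1) / 2) * |u| ^ (a + 1) +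
      (M + 2 ^ ((a + 1) / 2)) * η ^ ((a + 1) / 2) := by
  have ha0 : 0 < a := by linarith
  have hκ' : 1 - κ = (a + 1) / (2 * a) := by rw [hκ]; field_simp; ring
  have hκ1 : 0 ≤ 1 - κ := by rw [hκ']; positivity
  have hκ2 : 1 - κ ≤ 1 := by rw [hκ', div_le_one (by positivity)]; linarith
  have hκ0 : 0 ≤ κ := by linarith
  set s := u ^ 2 + η with hs
  have hs0 : 0 < s := by positivity
  have hN0 := wt_pos (a := a) hη u v
  have hv : (v ^ 2) ^ (1 - κ) = |v| ^ ((a + 1) / a) := by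
    rw [← sq_abs, ← Real.rpow_natCast, ← Real.rpow_mul (abs_nonneg v), hκ']
    congr 1; push_cast; field_simp
  have hpow : ∀ {r : ℝ}, 0 ≤ r → (r ^ a) ^ (1 - κ) = r ^ ((a + 1) / 2) := fun {r} hr => by
    rw [← Real.rpow_mul hr, hκ']; congr 1; field_simp
  have h1 : (v ^ 2 + η ^ a) ^ (1 - κ) ≤ |v| ^ ((a + 1) / a) + η ^ ((a + 1) / 2) := by
    rw [← hv, ← hpow hη.le]
    exact Real.rpow_add_le_add_rpow (by positivity) (by positivity) hκ1 hκ2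
  have h2 : u ^ 2 * wt a η u v ^ κ ≤ |v| ^ ((a + 1) / a) + s ^ ((a + 1) / 2) := by
    have h3 : u ^ 2 ≤ wt a η u v ^ (1 / a) := by
      calc u ^ 2 ≤ s := by linarith
        _ = (s ^ a) ^ (1 / a) := by
            rw [← Real.rpow_mul hs0.le, mul_one_div_cancel ha0.ne', Real.rpow_one]
        _ ≤ _ := by
            refine Real.rpow_le_rpow (by positivity) ?_ (by positivity)
            unfold wt; linarith [sq_nonneg v]
    calc u ^ 2 * wt a η u v ^ κ ≤ wt a η u v ^ (1 / a) * wt a η u v ^ κ := by gcongr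
      _ = wt a η u v ^ (1 - κ) := by
          rw [← Real.rpow_add hN0, hκ]; congr 1; field_simp; ring
      _ ≤ _ := by
          rw [← hv, ← hpow hs0.le]
          exact Real.rpow_add_le_add_rpow (by positivity) (by positivity) hκ1 hκ2
  have h4 : s ^ ((a + 1) / 2) ≤ 2 ^ ((a + 1) / 2) * |u| ^ (a + 1) +
      2 ^ ((a + 1) / 2) * η ^ ((a + 1) / 2) := by
    have hu : (u ^ 2) ^ ((a + 1) / 2) = |u| ^ (a + 1) := by
      rw [← sq_abs, ← Real.rpow_natCast, ← Real.rpow_mul (abs_nonneg u)]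
      congr 1; push_cast; ring
    have hr : 0 ≤ (a + 1) / 2 := by positivity
    calc s ^ ((a + 1) / 2) ≤ (2 * max (u ^ 2) η) ^ ((a + 1) / 2) := by
          gcongr
          rw [hs]; linarith [le_max_left (u ^ 2) η, le_max_right (u ^ 2) η]
      _ = 2 ^ ((a + 1) / 2) * (max (u ^ 2) η) ^ ((a + 1) / 2) :=
          Real.mul_rpow (by norm_num) (by positivity)
      _ ≤ 2 ^ ((a + 1) / 2) * ((u ^ 2) ^ ((a + 1) / 2) + η ^ ((a + 1) / 2)) := by
          gcongr
          rcases max_choice (u ^ 2) η with h | h <;> rw [h]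
          · linarith [Real.rpow_nonneg hη.le ((a + 1) / 2)]
          · linarith [Real.rpow_nonneg (sq_nonneg u) ((a + 1) / 2)]
      _ = _ := by rw [hu]; ring
  unfold fn
  nlinarith [mul_le_mul_of_nonneg_left h1 hM]

end Bellman

/-! ### The bilinear heat embedding -/

section

lemma hasDerivAt_integral_torus {φ φ' : ℝ → T2 → ℝ} (hφ : ∀ t, Continuous (φ t))
    (hφ' : Continuous (Function.uncurry φ')) (h : ∀ t x, HasDerivAt (fun s => φ s x) (φ' t x) t)
    (t : ℝ) :
    HasDerivAt (fun s => ∫ x, φ s x ∂torusMeasure) (∫ x, φ' t x ∂torusMeasure) t := by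
  obtain ⟨C, hC⟩ := ((isCompact_Icc (a := t - 1) (b := t + 1)).prod
    (isCompact_univ (X := T2))).exists_bound_of_continuousOn hφ'.continuousOn
  refine (hasDerivAt_integral_of_dominated_loc_of_deriv_le (bound := fun _ => C)
    (F := φ) (F' := φ') (s := Icc (t - 1) (t + 1)) (Icc_mem_nhds (by linarith) (by linarith))
    (Eventually.of_forall fun s => (hφ s).aestronglyMeasurable)
    (integrable_of_continuous (hφ t)) ?_ ?_ (integrable_const C) ?_).2
  · exact (hφ'.comp (Continuous.prodMk_right t)).aestronglyMeasurable
  · exact Eventually.of_forall fun x s hs => hC (s, x) ⟨hs, mem_univ x⟩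
  · exact Eventually.of_forall fun x s _ => h s x

/-- The Laplacian of a smooth function. -/
def lap (f : T2 → ℝ) (x : T2) : ℝ :=
  partialDeriv 0 (partialDeriv 0 f) x + partialDeriv 1 (partialDeriv 1 f) x

lemma IsTest.lap {f : T2 → ℝ} (hf : IsTest f) : IsTest (lap f) :=
  ((hf.pderiv 0).pderiv 0).add ((hf.pderiv 1).pderiv 1)

lemma IsTest.integral_mul_partialDeriv {f g : T2 → ℝ} (hf : IsTest f) (hg : IsTest g) (i : Fin 2) :
    ∫ x, f x * partialDeriv i g x ∂torusMeasure = -∫ x, partialDeriv i f x * g x ∂torusMeasure :=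
  (hf.hasPartial i).integral_mul_eq_neg (hg.hasPartial i) hf.continuous hg.continuous
    (hf.pderiv i).continuous (hg.pderiv i).continuous

lemma IsTest.integral_mul_lap {f g : T2 → ℝ} (hf : IsTest f) (hg : IsTest g) :
    ∫ x, f x * PoissonBoltzmann.lap g x ∂torusMeasure =
      ∫ x, PoissonBoltzmann.lap f x * g x ∂torusMeasure := by
  have h : ∀ i, ∫ x, f x * partialDeriv i (partialDeriv i g) x ∂torusMeasure =
      ∫ x, partialDeriv i (partialDeriv i f) x * g x ∂torusMeasure := fun i => by
    rw [hf.integral_mul_partialDeriv (hg.pderiv i), (hf.pderiv i).integral_mul_partialDeriv hg,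
      neg_neg]
  have i1 : ∀ i, Integrable (fun x => f x * partialDeriv i (partialDeriv i g) x) torusMeasure :=
    fun i => (hf.mul ((hg.pderiv i).pderiv i)).integrable
  have i2 : ∀ i, Integrable (fun x => partialDeriv i (partialDeriv i f) x * g x) torusMeasure :=
    fun i => (((hf.pderiv i).pderiv i).mul hg).integrable
  simp only [PoissonBoltzmann.lap, mul_add, add_mul]
  rw [integral_add (i1 0) (i1 1), integral_add (i2 0) (i2 1), h, h]

lemma IsTest.partialDeriv_lap {f : T2 → ℝ} (hf : IsTest f) (i : Fin 2) :
    partialDeriv i (PoissonBoltzmann.lap f) = PoissonBoltzmann.lap (partialDeriv i f) := by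
  have := partialDeriv_add ((hf.pderiv 0).pderiv 0) ((hf.pderiv 1).pderiv 1) i
  unfold PoissonBoltzmann.lap
  rw [this]
  ext x
  rw [(hf.pderiv 0).partialDeriv_comm i 0, hf.partialDeriv_comm i 0,
    (hf.pderiv 1).partialDeriv_comm i 1, hf.partialDeriv_comm i 1]

/-- The time derivative of `∫ (∂ᵢ∂ⱼ h) g` along the heat flows of `h` and `g`, integrated by parts
so that only first derivatives of `Δh` and of `g` appear. -/
lemma integral_second_mul_add {h g : T2 → ℝ} (hh : IsTest h) (hg : IsTest g) (i j : Fin 2) :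
    ∫ x, (partialDeriv i (partialDeriv j (lap h)) x * g x +
      partialDeriv i (partialDeriv j h) x * lap g x) ∂torusMeasure =
    -∫ x, (partialDeriv j (lap h) x * partialDeriv i g x +
      partialDeriv i (lap h) x * partialDeriv j g x) ∂torusMeasure := by
  have hf := hh.lap
  rw [integral_add (((hf.pderiv j).pderiv i).mul hg).integrable
      (((hh.pderiv j).pderiv i).mul hg.lap).integrable,
    integral_add ((hf.pderiv j).mul (hg.pderiv i)).integrable
      ((hf.pderiv i).mul (hg.pderiv j)).integrable,
    ((hh.pderiv j).pderiv i).integral_mul_lap hg, ← (hh.pderiv j).partialDeriv_lap,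
    ← hh.partialDeriv_lap, (hf.pderiv j).integral_mul_partialDeriv hg,
    (hf.pderiv i).integral_mul_partialDeriv hg, hf.partialDeriv_comm j i]
  ring

/-- The Hessian quadratic form of the Bellman function. -/
def Bellman.hess (a κ η M u v x y : ℝ) : ℝ :=
  Bellman.duu a κ η u v * x ^ 2 + 2 * Bellman.duv a κ η u v * x * y + Bellman.dvv a κ η M u v * y ^ 2

/-- The time derivative of the integral of the Bellman function along two heat flows. -/
lemma Bellman.integral_eq_neg_integral_hess {a κ η M : ℝ} (hη : 0 < η) {u v : T2 → ℝ}
    (hu : IsTest u) (hv : IsTest v) :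
    ∫ x, (Bellman.du a κ η (u x) (v x) * lap u x + Bellman.dv a κ η M (u x) (v x) * lap v x)
      ∂torusMeasure = -∫ x, (Bellman.hess a κ η M (u x) (v x) (partialDeriv 0 u x)
        (partialDeriv 0 v x) + Bellman.hess a κ η M (u x) (v x) (partialDeriv 1 u x)
        (partialDeriv 1 v x)) ∂torusMeasure := by
  have cu := hu.continuous
  have cv := hv.continuous
  have c1 := Bellman.continuous_du (a := a) (κ := κ) hη cu cv
  have c2 := Bellman.continuous_dv (a := a) (κ := κ) (M := M) hη cu cv
  have c3 := Bellman.continuous_duu (a := a) (κ := κ) hη cu cv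
  have c4 := Bellman.continuous_duv (a := a) (κ := κ) hη cu cv
  have c5 := Bellman.continuous_dvv (a := a) (κ := κ) (M := M) hη cu cv
  have cu1 := fun i => (hu.pderiv i).continuous
  have cv1 := fun i => (hv.pderiv i).continuous
  have cu2 := fun i => ((hu.pderiv i).pderiv i).continuous
  have cv2 := fun i => ((hv.pderiv i).pderiv i).continuous
  have key : ∀ i, ∫ x, (Bellman.du a κ η (u x) (v x) * partialDeriv i (partialDeriv i u) x +
      Bellman.dv a κ η M (u x) (v x) * partialDeriv i (partialDeriv i v) x) ∂torusMeasure =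
      -∫ x, Bellman.hess a κ η M (u x) (v x) (partialDeriv i u x) (partialDeriv i v x)
        ∂torusMeasure := by
    intro i
    have h1 : HasPartial i (fun x => Bellman.du a κ η (u x) (v x)) fun x =>
        Bellman.duu a κ η (u x) (v x) * partialDeriv i u x +
          Bellman.duv a κ η (u x) (v x) * partialDeriv i v x := fun x => by
      simpa [shift_zero] using Bellman.hasDerivAt_du hη (hu.hasPartial i x) (hv.hasPartial i x)
    have h2 : HasPartial i (fun x => Bellman.dv a κ η M (u x) (v x)) fun x =>
        Bellman.duv a κ η (u x) (v x) * partialDeriv i u x +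
          Bellman.dvv a κ η M (u x) (v x) * partialDeriv i v x := fun x => by
      simpa [shift_zero] using Bellman.hasDerivAt_dv hη (hu.hasPartial i x) (hv.hasPartial i x)
    have cu1 := cu1 i; have cv1 := cv1 i; have cu2 := cu2 i; have cv2 := cv2 i
    rw [integral_add (integrable_of_continuous (by fun_prop))
        (integrable_of_continuous (by fun_prop)),
      h1.integral_mul_eq_neg ((hu.pderiv i).hasPartial i) c1 cu1 (by fun_prop) cu2,
      h2.integral_mul_eq_neg ((hv.pderiv i).hasPartial i) c2 cv1 (by fun_prop) cv2,
      ← neg_add, ← integral_add (integrable_of_continuous (by fun_prop))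
        (integrable_of_continuous (by fun_prop))]
    congr 2; ext x
    simp only [Bellman.hess]; ring
  have e : ∀ x, Bellman.du a κ η (u x) (v x) * lap u x + Bellman.dv a κ η M (u x) (v x) * lap v x =
      (Bellman.du a κ η (u x) (v x) * partialDeriv 0 (partialDeriv 0 u) x +
        Bellman.dv a κ η M (u x) (v x) * partialDeriv 0 (partialDeriv 0 v) x) +
      (Bellman.du a κ η (u x) (v x) * partialDeriv 1 (partialDeriv 1 u) x +
        Bellman.dv a κ η M (u x) (v x) * partialDeriv 1 (partialDeriv 1 v) x) := fun x => by
    simp only [lap]; ring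
  simp only [e]
  have a0 := cu1 0; have a1 := cu1 1; have a2 := cv1 0; have a3 := cv1 1
  have b0 := cu2 0; have b1 := cu2 1; have b2 := cv2 0; have b3 := cv2 1
  have q : ∀ i, Continuous fun x => Bellman.hess a κ η M (u x) (v x) (partialDeriv i u x)
      (partialDeriv i v x) := fun i => by
    have cu1 := cu1 i; have cv1 := cv1 i
    unfold Bellman.hess; fun_prop
  rw [integral_add (integrable_of_continuous (by fun_prop))
      (integrable_of_continuous (by fun_prop)), key 0, key 1,
    integral_add (integrable_of_continuous (q 0)) (integrable_of_continuous (q 1)), neg_add]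

/-- A quadratic form dominating `2 |x y|` in each of two coordinates also dominates the mixed terms:
apply the bound to the sum and the difference of the two coordinates and polarise. -/
lemma abs_mul_add_mul_le_of_forall {A B C : ℝ}
    (h : ∀ x y, 2 * |x * y| ≤ A * x ^ 2 + 2 * B * x * y + C * y ^ 2) (x y : Fin 2 → ℝ)
    (i j : Fin 2) :
    |x j * y i + x i * y j| ≤ (A * x 0 ^ 2 + 2 * B * x 0 * y 0 + C * y 0 ^ 2) +
      (A * x 1 ^ 2 + 2 * B * x 1 * y 1 + C * y 1 ^ 2) := by
  have h0 := h (x 0) (y 0)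
  have h1 := h (x 1) (y 1)
  have n0 := abs_nonneg (x 0 * y 0)
  have n1 := abs_nonneg (x 1 * y 1)
  have hp := h (x 0 + x 1) (y 0 + y 1)
  have hm := h (x 0 - x 1) (y 0 - y 1)
  have e : 2 * (x 0 * y 1 + x 1 * y 0) = (x 0 + x 1) * (y 0 + y 1) - (x 0 - x 1) * (y 0 - y 1) := by
    ring
  have hd : ∀ k, |x k * y k + x k * y k| = 2 * |x k * y k| := fun k => by
    rw [← two_mul, abs_mul, abs_two]
  have hx : |x 0 * y 1 + x 1 * y 0| ≤ (A * x 0 ^ 2 + 2 * B * x 0 * y 0 + C * y 0 ^ 2) +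
      (A * x 1 ^ 2 + 2 * B * x 1 * y 1 + C * y 1 ^ 2) := by
    have h2 : 2 * |x 0 * y 1 + x 1 * y 0| ≤ |(x 0 + x 1) * (y 0 + y 1)| +
        |(x 0 - x 1) * (y 0 - y 1)| := by
      rw [← abs_two, ← abs_mul, e]; exact abs_sub _ _
    linarith
  fin_cases i <;> fin_cases j <;> simp only [Fin.zero_eta, Fin.mk_one]
  · rw [hd]; linarith
  · rw [add_comm]; exact hx
  · exact hx
  · rw [hd]; linarith

/-- The eigenvalue of the Laplacian on the `n`-th character. -/
def eig (n : Fin 2 → ℤ) : ℝ := -(4 * Real.pi ^ 2 * ((n 0 : ℝ) ^ 2 + (n 1 : ℝ) ^ 2))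

/-- The solution of the heat equation with initial value a trigonometric polynomial. -/
def heat (S : Finset (Fin 2 → ℤ)) (c : (Fin 2 → ℤ) → ℂ) (t : ℝ) : T2 → ℝ :=
  trig S fun n => Real.exp (eig n * t) * c n

variable {S S' : Finset (Fin 2 → ℤ)} {c d : (Fin 2 → ℤ) → ℂ}

lemma heat_zero : heat S c 0 = trig S c := by simp [heat]

lemma isTest_heat (t : ℝ) : IsTest (heat S c t) := isTest_trig _ _

lemma partialDeriv_heat (i : Fin 2) (t : ℝ) :
    partialDeriv i (heat S c t) = heat S (fun n => 2 * Real.pi * Complex.I * n i * c n) t := by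
  rw [heat, partialDeriv_trig, heat]
  congr 1; ext n; ring

lemma lap_trig : lap (trig S c) = trig S fun n => eig n * c n := by
  ext x
  simp only [lap, partialDeriv_trig, trig_add]
  congr 1; ext n
  rw [eig]; push_cast
  linear_combination (4 * Real.pi ^ 2 * ((n 0 : ℂ) ^ 2 + (n 1 : ℂ) ^ 2) * c n) * Complex.I_sq

lemma lap_heat (t : ℝ) : lap (heat S c t) = heat S (fun n => eig n * c n) t := by
  rw [heat, lap_trig, heat]
  congr 1; ext n; ring

lemma hasDerivAt_heat (x : T2) (t : ℝ) :
    HasDerivAt (fun s => heat S c s x) (lap (heat S c t) x) t := by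
  rw [lap_heat]
  have h : HasDerivAt (fun s : ℝ => ∑ n ∈ S, (Real.exp (eig n * s) : ℂ) * c n * mFourier n x)
      (∑ n ∈ S, (Real.exp (eig n * t) : ℂ) * (eig n * c n) * mFourier n x) t := by
    refine HasDerivAt.fun_sum fun n _ => ?_
    have h1 := ((hasDerivAt_id t).const_mul (eig n)).exp.ofReal_comp
    refine ((h1.mul_const (c n)).mul_const (mFourier n x)).congr_deriv ?_
    simp only [id, mul_one, Complex.ofReal_mul]; ring
  exact (Complex.reCLM.hasFDerivAt
    (x := ∑ n ∈ S, (Real.exp (eig n * t) : ℂ) * c n * mFourier n x)).comp_hasDerivAt t h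

lemma continuous_heat : Continuous fun z : ℝ × T2 => heat S c z.1 z.2 := by
  simp only [heat, trig]
  refine Complex.continuous_re.comp (continuous_finsetSum _ fun n _ => ?_)
  have : Continuous fun z : ℝ × T2 => mFourier n z.2 := (mFourier n).continuous.comp continuous_snd
  fun_prop

/-- The second derivatives of a heat flow decay uniformly, since they have no zero frequency. -/
lemma tendsto_heat_second (i j : Fin 2) :
    ∃ b : ℝ → ℝ, Tendsto b atTop (𝓝 0) ∧
      ∀ t x, |partialDeriv i (partialDeriv j (heat S c t)) x| ≤ b t := by
  refine ⟨fun t => ∑ n ∈ S, ‖(Real.exp (eig n * t) : ℂ) * (2 * Real.pi * Complex.I * n i *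
    (2 * Real.pi * Complex.I * n j * c n))‖, ?_, fun t x => ?_⟩
  · have h0 : (0 : ℝ) = ∑ n ∈ S, 0 := by simp
    rw [h0]
    refine tendsto_finsetSum _ fun n _ => ?_
    simp only [norm_mul (_ : ℂ) (2 * Real.pi * Complex.I * n i *
      (2 * Real.pi * Complex.I * n j * c n)), Complex.norm_real, Real.norm_eq_abs, Real.abs_exp]
    by_cases hn : n = 0
    · simp [hn]
    · have hneg : eig n < 0 := by
        obtain ⟨k, hk⟩ := Function.ne_iff.1 hn
        have hk' : (n k : ℝ) ≠ 0 := by exact_mod_cast hk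
        have : 0 < (n 0 : ℝ) ^ 2 + (n 1 : ℝ) ^ 2 := by
          fin_cases k
          · have : 0 < (n 0 : ℝ) ^ 2 := by positivity
            positivity
          · have : 0 < (n 1 : ℝ) ^ 2 := by positivity
            positivity
        rw [eig, neg_lt_zero]; positivity
      have h1 : Tendsto (fun t => Real.exp (eig n * t)) atTop (𝓝 0) :=
        Real.tendsto_exp_atBot.comp (tendsto_id.const_mul_atTop_of_neg hneg)
      simpa using h1.mul_const _
  · rw [partialDeriv_heat, partialDeriv_heat]
    exact abs_trig_le x

lemma abs_heat_le {t : ℝ} (ht : 0 ≤ t) (x : T2) : |heat S c t x| ≤ ∑ n ∈ S, ‖c n‖ := by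
  refine (abs_trig_le x).trans (Finset.sum_le_sum fun n _ => ?_)
  rw [norm_mul, Complex.norm_real, Real.norm_eq_abs, Real.abs_exp]
  refine mul_le_of_le_one_left (norm_nonneg _) (Real.exp_le_one_iff.2 ?_)
  have : eig n ≤ 0 := by rw [eig, neg_nonpos]; positivity
  exact mul_nonpos_of_nonpos_of_nonneg this ht

end

section

variable {S S' : Finset (Fin 2 → ℤ)} {c d : (Fin 2 → ℤ) → ℂ}

lemma continuous_lap_heat : Continuous fun z : ℝ × T2 => lap (heat S c z.1) z.2 := by
  simp only [lap_heat]; exact continuous_heat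

lemma continuous_second_heat (i j : Fin 2) :
    Continuous fun z : ℝ × T2 => partialDeriv i (partialDeriv j (heat S c z.1)) z.2 := by
  simp only [partialDeriv_heat]; exact continuous_heat

lemma continuous_second_lap_heat (i j : Fin 2) :
    Continuous fun z : ℝ × T2 => partialDeriv i (partialDeriv j (lap (heat S c z.1))) z.2 := by
  simp only [lap_heat, partialDeriv_heat]; exact continuous_heat

lemma hasDerivAt_second_heat (i j : Fin 2) (x : T2) (t : ℝ) :
    HasDerivAt (fun s => partialDeriv i (partialDeriv j (heat S c s)) x)
      (partialDeriv i (partialDeriv j (lap (heat S c t))) x) t := by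
  rw [(isTest_heat t).partialDeriv_lap, ((isTest_heat t).pderiv j).partialDeriv_lap]
  simp only [partialDeriv_heat]
  exact hasDerivAt_heat x t

/-- The Bellman function evaluated along two heat flows, corrected by the pairing of the second
derivatives, decreases in time; letting time tend to infinity yields the bilinear embedding. -/
lemma abs_integral_second_mul_le {a κ η M : ℝ} (hη : 0 < η) (hM : 0 ≤ M) (i j : Fin 2)
    {Su Sv : Finset (Fin 2 → ℤ)} {cu cv : (Fin 2 → ℤ) → ℂ}
    (hQ : ∀ t x, |partialDeriv j (lap (heat S c t)) x * partialDeriv i (heat S' d t) x +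
        partialDeriv i (lap (heat S c t)) x * partialDeriv j (heat S' d t) x| ≤
      Bellman.hess a κ η M (heat Su cu t x) (heat Sv cv t x)
        (partialDeriv 0 (heat Su cu t) x) (partialDeriv 0 (heat Sv cv t) x) +
      Bellman.hess a κ η M (heat Su cu t x) (heat Sv cv t x)
        (partialDeriv 1 (heat Su cu t) x) (partialDeriv 1 (heat Sv cv t) x)) :
    |∫ x, partialDeriv i (partialDeriv j (trig S c)) x * trig S' d x ∂torusMeasure| ≤
      ∫ x, Bellman.fn a κ η M (trig Su cu x) (trig Sv cv x) ∂torusMeasure := by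
  have key : ∀ σ : ℝ, |σ| = 1 →
      0 ≤ ∫ x, Bellman.fn a κ η M (trig Su cu x) (trig Sv cv x) ∂torusMeasure +
        σ * ∫ x, partialDeriv i (partialDeriv j (trig S c)) x * trig S' d x ∂torusMeasure := by
    intro σ hσ
    set φ : ℝ → T2 → ℝ := fun t x => Bellman.fn a κ η M (heat Su cu t x) (heat Sv cv t x) +
      σ * (partialDeriv i (partialDeriv j (heat S c t)) x * heat S' d t x) with hφ
    set φ' : ℝ → T2 → ℝ := fun t x =>
      (Bellman.du a κ η (heat Su cu t x) (heat Sv cv t x) * lap (heat Su cu t) x +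
        Bellman.dv a κ η M (heat Su cu t x) (heat Sv cv t x) * lap (heat Sv cv t) x) +
      σ * (partialDeriv i (partialDeriv j (lap (heat S c t))) x * heat S' d t x +
        partialDeriv i (partialDeriv j (heat S c t)) x * lap (heat S' d t) x) with hφ'
    have hcu : ∀ t, Continuous (heat Su cu t) := fun t => (isTest_heat t).continuous
    have hcv : ∀ t, Continuous (heat Sv cv t) := fun t => (isTest_heat t).continuous
    have hfn : ∀ t, Continuous fun x => Bellman.fn a κ η M (heat Su cu t x) (heat Sv cv t x) :=
      fun t => Bellman.continuous_fn hη (hcu t) (hcv t)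
    have hA : ∀ t, IsTest fun x => partialDeriv i (partialDeriv j (heat S c t)) x * heat S' d t x :=
      fun t => (((isTest_heat t).pderiv j).pderiv i).mul (isTest_heat t)
    have hc1 : ∀ t, Continuous (φ t) := fun t =>
      (hfn t).add (continuous_const.mul (hA t).continuous)
    have hc2 : Continuous (Function.uncurry φ') := by
      have h1 := Bellman.continuous_du (a := a) (κ := κ) hη (continuous_heat (S := Su) (c := cu))
        (continuous_heat (S := Sv) (c := cv))
      have h2 := Bellman.continuous_dv (a := a) (κ := κ) (M := M) hη
        (continuous_heat (S := Su) (c := cu)) (continuous_heat (S := Sv) (c := cv))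
      exact ((h1.mul continuous_lap_heat).add (h2.mul continuous_lap_heat)).add
        (continuous_const.mul (((continuous_second_lap_heat i j).mul continuous_heat).add
          ((continuous_second_heat i j).mul continuous_lap_heat)))
    have hd : ∀ t x, HasDerivAt (fun s => φ s x) (φ' t x) t := fun t x =>
      (Bellman.hasDerivAt_fn hη (hasDerivAt_heat x t) (hasDerivAt_heat x t)).add
        (((hasDerivAt_second_heat i j x t).mul (hasDerivAt_heat x t)).const_mul σ)
    have hD := hasDerivAt_integral_torus hc1 hc2 hd
    have hneg : ∀ t, ∫ x, φ' t x ∂torusMeasure ≤ 0 := by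
      intro t
      have hu : IsTest (heat Su cu t) := isTest_heat t
      have hv : IsTest (heat Sv cv t) := isTest_heat t
      have hH : IsTest (heat S c t) := isTest_heat t
      have hG : IsTest (heat S' d t) := isTest_heat t
      have k1 : Continuous fun x => Bellman.du a κ η (heat Su cu t x) (heat Sv cv t x) :=
        Bellman.continuous_du hη (hcu t) (hcv t)
      have k2 : Continuous fun x => Bellman.dv a κ η M (heat Su cu t x) (heat Sv cv t x) :=
        Bellman.continuous_dv hη (hcu t) (hcv t)
      have i1 : Integrable (fun x =>
          Bellman.du a κ η (heat Su cu t x) (heat Sv cv t x) * lap (heat Su cu t) x +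
          Bellman.dv a κ η M (heat Su cu t x) (heat Sv cv t x) * lap (heat Sv cv t) x)
          torusMeasure := integrable_of_continuous
        ((k1.mul hu.lap.continuous).add (k2.mul hv.lap.continuous))
      have i2 := ((((hH.lap.pderiv j).pderiv i).mul hG).add
        (((hH.pderiv j).pderiv i).mul hG.lap)).integrable
      simp only [hφ']
      rw [integral_add i1 (i2.const_mul σ), integral_const_mul,
        Bellman.integral_eq_neg_integral_hess hη hu hv, integral_second_mul_add hH hG]
      have j2 := (((hH.lap.pderiv j).mul (hG.pderiv i)).add
        ((hH.lap.pderiv i).mul (hG.pderiv j))).integrable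
      have hle := norm_integral_le_integral_norm (μ := torusMeasure) fun x =>
        partialDeriv j (lap (heat S c t)) x * partialDeriv i (heat S' d t) x +
          partialDeriv i (lap (heat S c t)) x * partialDeriv j (heat S' d t) x
      have hq : ∀ k, Continuous fun x => Bellman.hess a κ η M (heat Su cu t x) (heat Sv cv t x)
          (partialDeriv k (heat Su cu t) x) (partialDeriv k (heat Sv cv t) x) := fun k => by
        have c3 := Bellman.continuous_duu (a := a) (κ := κ) hη (hcu t) (hcv t)
        have c4 := Bellman.continuous_duv (a := a) (κ := κ) hη (hcu t) (hcv t)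
        have c5 := Bellman.continuous_dvv (a := a) (κ := κ) (M := M) hη (hcu t) (hcv t)
        have c6 := (hu.pderiv k).continuous
        have c7 := (hv.pderiv k).continuous
        unfold Bellman.hess; fun_prop
      have hle2 := integral_mono (μ := torusMeasure) j2.norm
        (integrable_of_continuous ((hq 0).add (hq 1))) fun x => hQ t x
      simp only [Pi.add_apply] at hle2
      have hab : ∀ y : ℝ, σ * -y ≤ |y| := fun y => by
        calc σ * -y ≤ |σ * -y| := le_abs_self _
          _ = |y| := by rw [abs_mul, hσ, one_mul, abs_neg]
      have := hab (∫ x, (partialDeriv j (lap (heat S c t)) x * partialDeriv i (heat S' d t) x +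
          partialDeriv i (lap (heat S c t)) x * partialDeriv j (heat S' d t) x) ∂torusMeasure)
      rw [Real.norm_eq_abs] at hle
      linarith
    have hanti : Antitone fun t => ∫ x, φ t x ∂torusMeasure :=
      antitone_of_deriv_nonpos (fun t => (hD t).differentiableAt) fun t => by
        rw [(hD t).deriv]; exact hneg t
    -- as `t → ∞` the pairing tends to zero and the Bellman function stays nonnegative
    obtain ⟨b, hb, hbound⟩ := tendsto_heat_second (S := S) (c := c) i j
    have hlow : ∀ t, 0 ≤ t → -(b t * ∑ n ∈ S', ‖d n‖) ≤ ∫ x, φ 0 x ∂torusMeasure := by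
      intro t ht
      refine le_trans ?_ (hanti ht)
      have hp : ∀ x, -(b t * ∑ n ∈ S', ‖d n‖) ≤ φ t x := fun x => by
        have h1 := Bellman.fn_nonneg (a := a) (κ := κ) hM hη (heat Su cu t x) (heat Sv cv t x)
        have h2 : |σ * (partialDeriv i (partialDeriv j (heat S c t)) x * heat S' d t x)| ≤
            b t * ∑ n ∈ S', ‖d n‖ := by
          rw [abs_mul, hσ, one_mul, abs_mul]
          exact mul_le_mul (hbound t x) (abs_heat_le ht x) (abs_nonneg _)
            ((abs_nonneg _).trans (hbound t x))
        have h3 := (abs_le.1 h2).1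
        simp only [hφ]; linarith
      have := integral_mono (μ := torusMeasure) (integrable_const _)
        (integrable_of_continuous (hc1 t)) hp
      simpa using this
    have hlim : Tendsto (fun t => -(b t * ∑ n ∈ S', ‖d n‖)) atTop (𝓝 0) := by
      simpa using (hb.mul_const (∑ n ∈ S', ‖d n‖)).neg
    have h0 := le_of_tendsto hlim (eventually_atTop.2 ⟨0, hlow⟩)
    simp only [hφ, heat_zero] at h0
    have hfn0 := hfn 0
    have hA0 := hA 0
    simp only [heat_zero] at hfn0 hA0
    rwa [integral_add (integrable_of_continuous hfn0) (hA0.integrable.const_mul σ),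
      integral_const_mul] at h0
  have h1 := key 1 (by simp)
  have h2 := key (-1) (by simp)
  rw [abs_le]; constructor <;> linarith

/-- The bilinear estimate for the second derivatives, before homogenisation. -/
lemma exists_abs_integral_second_mul_le_add {a : ℝ} (ha : 1 ≤ a) :
    ∃ C : ℝ, 0 ≤ C ∧ ∀ (S S' : Finset (Fin 2 → ℤ)) (c d : (Fin 2 → ℤ) → ℂ) (i j : Fin 2),
      |∫ x, partialDeriv i (partialDeriv j (trig S c)) x * trig S' d x ∂torusMeasure| ≤
        C * (∫ x, |lap (trig S c) x| ^ (a + 1) ∂torusMeasure +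
          ∫ x, |trig S' d x| ^ ((a + 1) / a) ∂torusMeasure) ∧
      |∫ x, partialDeriv i (partialDeriv j (trig S c)) x * trig S' d x ∂torusMeasure| ≤
        C * (∫ x, |lap (trig S c) x| ^ ((a + 1) / a) ∂torusMeasure +
          ∫ x, |trig S' d x| ^ (a + 1) ∂torusMeasure) := by
  have ha0 : 0 < a := by linarith
  set κ := (a - 1) / (2 * a) with hκ
  set M := Bellman.cst a with hMdef
  have hM : 0 ≤ M := by rw [hMdef, Bellman.cst]; positivity
  set D : ℝ := 2 ^ ((a + 1) / 2) with hD
  have hD0 : 0 < D := by positivity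
  have hfin : ∀ {u v : T2 → ℝ}, Continuous u → Continuous v → ∀ {X : ℝ},
      (∀ η, 0 < η → X ≤ ∫ x, Bellman.fn a κ η M (u x) (v x) ∂torusMeasure) →
      X ≤ (M + 1 + D) * (∫ x, |u x| ^ (a + 1) ∂torusMeasure +
          ∫ x, |v x| ^ ((a + 1) / a) ∂torusMeasure) := by
    intro u v hu hv X hX
    have iu : Integrable (fun x => |u x| ^ (a + 1)) torusMeasure :=
      integrable_of_continuous (hu.abs.rpow_const fun x => Or.inr (by positivity))
    have iv : Integrable (fun x => |v x| ^ ((a + 1) / a)) torusMeasure :=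
      integrable_of_continuous (hv.abs.rpow_const fun x => Or.inr (by positivity))
    have nu : 0 ≤ ∫ x, |u x| ^ (a + 1) ∂torusMeasure :=
      integral_nonneg fun x => by positivity
    have nv : 0 ≤ ∫ x, |v x| ^ ((a + 1) / a) ∂torusMeasure :=
      integral_nonneg fun x => by positivity
    -- integrate the size estimate and let the regularisation `η` tend to zero
    have h1 : ∀ η, 0 < η → X ≤ (M + 1) * ∫ x, |v x| ^ ((a + 1) / a) ∂torusMeasure +
        D * ∫ x, |u x| ^ (a + 1) ∂torusMeasure + (M + D) * η ^ ((a + 1) / 2) := by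
      intro η hη
      refine (hX η hη).trans ?_
      have := integral_mono (μ := torusMeasure)
        (integrable_of_continuous (Bellman.continuous_fn (a := a) (κ := κ) (M := M) hη hu hv))
        (((iv.const_mul (M + 1)).add (iu.const_mul D)).add
          (integrable_const ((M + D) * η ^ ((a + 1) / 2))))
        fun x => Bellman.fn_le ha hκ hη hM (u x) (v x)
      refine this.trans (le_of_eq ?_)
      rw [integral_add' ((iv.const_mul (M + 1)).add (iu.const_mul D)) (integrable_const _),
        integral_add' (iv.const_mul (M + 1)) (iu.const_mul D), integral_const_mul,
        integral_const_mul]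
      simp
    have h2 : Tendsto (fun η : ℝ => (M + 1) * ∫ x, |v x| ^ ((a + 1) / a) ∂torusMeasure +
        D * ∫ x, |u x| ^ (a + 1) ∂torusMeasure + (M + D) * η ^ ((a + 1) / 2)) (𝓝[>] 0)
        (𝓝 ((M + 1) * ∫ x, |v x| ^ ((a + 1) / a) ∂torusMeasure +
        D * ∫ x, |u x| ^ (a + 1) ∂torusMeasure + (M + D) * 0 ^ ((a + 1) / 2))) := by
      refine Tendsto.mono_left ?_ nhdsWithin_le_nhds
      have : Continuous fun η : ℝ => η ^ ((a + 1) / 2) :=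
        Real.continuous_rpow_const (by positivity)
      exact ((continuous_const.add (continuous_const.mul this)).tendsto 0)
    have h3 := ge_of_tendsto h2 (eventually_nhdsWithin_of_forall fun η hη => h1 η hη)
    rw [Real.zero_rpow (by positivity)] at h3
    nlinarith
  have hbase := fun (η : ℝ) (hη : 0 < η) (u v x y : ℝ) =>
    Bellman.two_mul_abs_mul_le (κ := κ) ha hκ hη u v x y
  refine ⟨M + 1 + D, by positivity, fun S S' c d i j => ⟨?_, ?_⟩⟩
  -- the variable `u` is the Laplacian in the first estimate, the dual function in the second
  · refine hfin (isTest_trig S c).lap.continuous (isTest_trig S' d).continuous fun η hη => ?_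
    have := abs_integral_second_mul_le (a := a) (κ := κ) (M := M) (S := S) (c := c) (S' := S')
      (d := d) hη hM i j (Su := S) (cu := fun n => eig n * c n) (Sv := S') (cv := d) fun t x => by
        rw [lap_heat]
        exact abs_mul_add_mul_le_of_forall (hbase η hη _ _)
          (fun k => partialDeriv k (heat S (fun n => eig n * c n) t) x)
          (fun k => partialDeriv k (heat S' d t) x) i j
    rwa [← lap_trig] at this
  · rw [add_comm (∫ x, |lap (trig S c) x| ^ ((a + 1) / a) ∂torusMeasure)]
    refine hfin (isTest_trig S' d).continuous (isTest_trig S c).lap.continuous fun η hη => ?_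
    have := abs_integral_second_mul_le (a := a) (κ := κ) (M := M) (S := S) (c := c) (S' := S')
      (d := d) hη hM i j (Su := S') (cu := d) (Sv := S) (cv := fun n => eig n * c n) fun t x => by
        rw [lap_heat]
        have := abs_mul_add_mul_le_of_forall
          (hbase η hη (heat S' d t x) (heat S (fun n => eig n * c n) t x))
          (fun k => partialDeriv k (heat S' d t) x)
          (fun k => partialDeriv k (heat S (fun n => eig n * c n) t) x) i j
        refine le_trans (le_of_eq ?_) this
        congr 1
        ring
    rwa [← lap_trig] at this

end

/-! ### The Calderón–Zygmund inequality -/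

section

/-- Optimising the scaling parameter turns an additive bound into a multiplicative one. The shift by
`ε` avoids dividing by zero. -/
lemma le_two_mul_of_forall_rpow {I C X Y P Q : ℝ} (hPQ : P.HolderConjugate Q) (hC : 0 ≤ C)
    (hX : 0 ≤ X) (hY : 0 ≤ Y) (h : ∀ r : ℝ, 0 < r → I ≤ C * (r ^ P * X + r ^ (-Q) * Y)) :
    I ≤ 2 * C * (X ^ (1 / P) * Y ^ (1 / Q)) := by
  have hP := hPQ.pos
  have hQ := hPQ.symm.pos
  have key : ∀ ε : ℝ, 0 < ε → I ≤ 2 * C * ((X + ε) ^ (1 / P) * (Y + ε) ^ (1 / Q)) := by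
    intro ε hε
    have hX' : 0 < X + ε := by linarith
    have hY' : 0 < Y + ε := by linarith
    set r := ((Y + ε) / (X + ε)) ^ (1 / (P * Q)) with hr
    have hr0 : 0 < r := by positivity
    have hinv := hPQ.inv_add_inv_eq_one
    have h1 : r ^ P * (X + ε) = (X + ε) ^ (1 / P) * (Y + ε) ^ (1 / Q) := by
      rw [hr, ← Real.rpow_mul (by positivity), show 1 / (P * Q) * P = 1 / Q by field_simp,
        Real.div_rpow hY'.le hX'.le]
      have : (X + ε) = (X + ε) ^ (1 / P) * (X + ε) ^ (1 / Q) := by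
        rw [← Real.rpow_add hX', one_div, one_div, hinv, Real.rpow_one]
      rw [div_mul_eq_mul_div, div_eq_iff (by positivity)]
      exact (congrArg _ this).trans (by ring)
    have h2 : r ^ (-Q) * (Y + ε) = (X + ε) ^ (1 / P) * (Y + ε) ^ (1 / Q) := by
      rw [hr, ← Real.rpow_mul (by positivity), show 1 / (P * Q) * -Q = -(1 / P) by field_simp,
        Real.rpow_neg (by positivity), Real.div_rpow hY'.le hX'.le, inv_div]
      have : (Y + ε) = (Y + ε) ^ (1 / P) * (Y + ε) ^ (1 / Q) := by
        rw [← Real.rpow_add hY', one_div, one_div, hinv, Real.rpow_one]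
      rw [div_mul_eq_mul_div, div_eq_iff (by positivity)]
      exact (congrArg _ this).trans (by ring)
    calc I ≤ C * (r ^ P * X + r ^ (-Q) * Y) := h r hr0
      _ ≤ C * (r ^ P * (X + ε) + r ^ (-Q) * (Y + ε)) := by gcongr <;> linarith
      _ = _ := by rw [h1, h2]; ring
  have hlim : Tendsto (fun ε : ℝ => 2 * C * ((X + ε) ^ (1 / P) * (Y + ε) ^ (1 / Q))) (𝓝[>] 0)
      (𝓝 (2 * C * ((X + 0) ^ (1 / P) * (Y + 0) ^ (1 / Q)))) := by
    refine Tendsto.mono_left ?_ nhdsWithin_le_nhds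
    have h1 : Continuous fun ε : ℝ => (X + ε) ^ (1 / P) :=
      (continuous_const.add continuous_id).rpow_const fun _ => Or.inr (by positivity)
    have h2 : Continuous fun ε : ℝ => (Y + ε) ^ (1 / Q) :=
      (continuous_const.add continuous_id).rpow_const fun _ => Or.inr (by positivity)
    exact (continuous_const.mul (h1.mul h2)).tendsto 0
  simpa using ge_of_tendsto hlim (eventually_nhdsWithin_of_forall fun ε hε => key ε hε)

lemma eLpNorm_ofReal_eq {f : T2 → ℝ} (hf : Continuous f) {P : ℝ} (hP : 0 < P) :
    eLpNorm f (ENNReal.ofReal P) torusMeasure =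
      ENNReal.ofReal ((∫ x, |f x| ^ P ∂torusMeasure) ^ (1 / P)) := by
  have := (memLp_of_continuous hf (ENNReal.ofReal P)).eLpNorm_eq_integral_rpow_norm
    (by simpa using hP) ENNReal.ofReal_ne_top
  simpa [ENNReal.toReal_ofReal hP.le] using this

lemma partialDeriv_const_mul {f : T2 → ℝ} (hf : IsTest f) (i : Fin 2) (r : ℝ) :
    partialDeriv i (fun x => r * f x) = fun x => r * partialDeriv i f x :=
  HasPartial.partialDeriv_eq fun x => (hf.hasPartial i x).const_mul r

lemma lap_const_mul {f : T2 → ℝ} (hf : IsTest f) (r : ℝ) :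
    lap (fun x => r * f x) = fun x => r * lap f x := by
  ext x
  simp only [lap, partialDeriv_const_mul hf, partialDeriv_const_mul (hf.pderiv _)]
  ring

variable {S S' : Finset (Fin 2 → ℤ)} {c d : (Fin 2 → ℤ) → ℂ}

/-- Homogenisation of the bilinear estimate, by the scaling `(f, g) ↦ (r f, r⁻¹ g)`. -/
lemma abs_integral_second_mul_le_of_add {P Q C : ℝ} (hPQ : P.HolderConjugate Q) (hC : 0 ≤ C)
    (i j : Fin 2)
    (h : ∀ (S S' : Finset (Fin 2 → ℤ)) (c d : (Fin 2 → ℤ) → ℂ),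
      |∫ x, partialDeriv i (partialDeriv j (trig S c)) x * trig S' d x ∂torusMeasure| ≤
        C * (∫ x, |lap (trig S c) x| ^ P ∂torusMeasure +
          ∫ x, |trig S' d x| ^ Q ∂torusMeasure)) :
    |∫ x, partialDeriv i (partialDeriv j (trig S c)) x * trig S' d x ∂torusMeasure| ≤
      2 * C * ((∫ x, |lap (trig S c) x| ^ P ∂torusMeasure) ^ (1 / P) *
        (∫ x, |trig S' d x| ^ Q ∂torusMeasure) ^ (1 / Q)) := by
  refine le_two_mul_of_forall_rpow hPQ hC (integral_nonneg fun x => by positivity)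
    (integral_nonneg fun x => by positivity) fun r hr => ?_
  have h1 := h S S' (fun n => r * c n) (fun n => (r⁻¹ : ℝ) * d n)
  have e1 : trig S (fun n => r * c n) = fun x => r * trig S c x := by
    ext x; rw [mul_trig]
  have e2 : trig S' (fun n => (r⁻¹ : ℝ) * d n) = fun x => r⁻¹ * trig S' d x := by
    ext x; rw [mul_trig]
  have hS := isTest_trig S c
  rw [e1, e2, partialDeriv_const_mul hS, partialDeriv_const_mul (hS.pderiv j),
    lap_const_mul hS] at h1
  have e3 : ∀ x, r * partialDeriv i (partialDeriv j (trig S c)) x * (r⁻¹ * trig S' d x) =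
      partialDeriv i (partialDeriv j (trig S c)) x * trig S' d x := fun x => by field_simp
  simp only [e3, abs_mul, abs_inv, abs_of_pos hr,
    Real.mul_rpow hr.le (abs_nonneg _), Real.mul_rpow (inv_nonneg.2 hr.le) (abs_nonneg _),
    integral_const_mul, Real.inv_rpow hr.le] at h1
  rwa [Real.rpow_neg hr.le]

/-- The `L^P` norm is detected by pairing with trigonometric polynomials. -/
lemma integral_rpow_le_of_forall_trig {P Q K : ℝ} (hPQ : P.HolderConjugate Q) {w : T2 → ℝ}
    (hw : Continuous w)
    (h : ∀ S d, |∫ x, w x * trig S d x ∂torusMeasure| ≤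
      K * (∫ x, |trig S d x| ^ Q ∂torusMeasure) ^ (1 / Q)) :
    (∫ x, |w x| ^ P ∂torusMeasure) ^ (1 / P) ≤ K := by
  have hP := hPQ.pos
  have hQ := hPQ.symm.pos
  have hP1 := hPQ.lt
  have hK : 0 ≤ K := by
    have h1 := h {0} fun _ => 1
    have e : ∀ x, trig {0} (fun _ => 1) x = 1 := fun x => by simp [trig, mFourier_zero]
    simp only [e] at h1
    simp only [abs_one, Real.one_rpow, integral_const, probReal_univ, smul_eq_mul, mul_one] at h1
    exact (abs_nonneg _).trans h1
  -- the duality map `w ↦ |w|^{P-1} sgn w`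
  set g : T2 → ℝ := fun x => (max (w x) 0) ^ (P - 1) - (max (-w x) 0) ^ (P - 1) with hg
  have hgc : Continuous g :=
    ((hw.max continuous_const).rpow_const fun _ => Or.inr (by linarith)).sub
      ((hw.neg.max continuous_const).rpow_const fun _ => Or.inr (by linarith))
  have hP10 : P - 1 ≠ 0 := by linarith
  have hgw : ∀ x, w x * g x = |w x| ^ P ∧ |g x| ^ Q = |w x| ^ P := by
    intro x
    have hz : (0 : ℝ) ^ (P - 1) = 0 := Real.zero_rpow hP10
    have hPQ' : (P - 1) * Q = P := by have := hPQ.mul_eq_add; linarith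
    have hy : ∀ y : ℝ, 0 ≤ y → y * y ^ (P - 1) = y ^ P ∧ (y ^ (P - 1)) ^ Q = y ^ P := by
      intro y hy
      refine ⟨?_, by rw [← Real.rpow_mul hy, hPQ']⟩
      rcases hy.eq_or_lt with h0 | h0
      · rw [← h0, zero_mul, Real.zero_rpow hP.ne']
      · rw [← Real.rpow_one_add' hy (by linarith)]; congr 1; ring
    rcases le_total 0 (w x) with h0 | h0
    · have hgx : g x = w x ^ (P - 1) := by
        simp only [hg, max_eq_left h0, max_eq_right (neg_nonpos.2 h0), hz, sub_zero]
      rw [hgx, abs_of_nonneg h0, abs_of_nonneg (by positivity)]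
      exact hy _ h0
    · have h0' : 0 ≤ -w x := by linarith
      have hgx : g x = -(-w x) ^ (P - 1) := by
        simp only [hg, max_eq_right h0, max_eq_left h0', hz, zero_sub]
      rw [hgx, abs_of_nonpos h0, abs_neg, abs_of_nonneg (by positivity), mul_neg, ← neg_mul]
      exact hy _ h0'
  have hgi := integrable_of_continuous hgc
  set X := ∫ x, |w x| ^ P ∂torusMeasure with hX
  have hX0 : 0 ≤ X := integral_nonneg fun x => by positivity
  have hle : ∀ N, |∫ x, w x * fejer N g x ∂torusMeasure| ≤ K * X ^ (1 / Q) := by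
    intro N
    have h1 := h (fejerSupp N) fun n => fejerCoef N n * coef g n
    rw [← fejer_eq_trig N hgi] at h1
    refine h1.trans (mul_le_mul_of_nonneg_left ?_ hK)
    have h2 := eLpNorm_fejer_le N hgi.1 (p := ENNReal.ofReal Q)
      (by simpa using hPQ.symm.lt.le) ENNReal.ofReal_ne_top
    rw [eLpNorm_ofReal_eq (isTest_fejer N hgi).continuous hQ, eLpNorm_ofReal_eq hgc hQ,
      ENNReal.ofReal_le_ofReal_iff (by positivity)] at h2
    simpa only [(hgw _).2] using h2
  have hlim : Tendsto (fun N => ∫ x, w x * fejer N g x ∂torusMeasure) atTop (𝓝 X) := by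
    have e : X = ∫ x, w x * g x ∂torusMeasure := by simp only [(hgw _).1, hX]
    rw [e]
    obtain ⟨C, hC⟩ := (isCompact_univ (X := T2)).exists_bound_of_continuousOn hw.continuousOn
    refine tendsto_integral_of_L1' _ (hw.mul hgc).aestronglyMeasurable
      (Eventually.of_forall fun N =>
        integrable_of_continuous (hw.mul (isTest_fejer N hgi).continuous)) ?_
    have h3 : Tendsto (fun N => ENNReal.ofReal C * eLpNorm (fun x => fejer N g x - g x) 1
        torusMeasure) atTop (𝓝 0) := by
      simpa using ENNReal.Tendsto.const_mul (tendsto_eLpNorm_fejer_sub le_rfl ENNReal.one_ne_top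
        (memLp_one_iff_integrable.2 hgi)) (Or.inr (ENNReal.ofReal_ne_top (r := C)))
    refine tendsto_of_tendsto_of_tendsto_of_le_of_le tendsto_const_nhds h3
      (fun _ => zero_le) fun N => ?_
    simp only [eLpNorm_one_eq_lintegral_enorm]
    rw [← lintegral_const_mul' _ _ ENNReal.ofReal_ne_top]
    refine lintegral_mono fun x => ?_
    change ‖w x * fejer N g x - w x * g x‖ₑ ≤ _
    rw [← mul_sub, enorm_mul]
    gcongr
    rw [← ofReal_norm]
    exact ENNReal.ofReal_le_ofReal (hC x (mem_univ x))
  have hfin : X ≤ K * X ^ (1 / Q) :=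
    le_of_tendsto hlim (Eventually.of_forall fun N => (le_abs_self _).trans (hle N))
  rcases hX0.eq_or_lt with h0 | h0
  · rw [← h0, Real.zero_rpow (by positivity)]; exact hK
  · have hXX : X ^ (1 / P) * X ^ (1 / Q) = X := by
      rw [← Real.rpow_add h0, one_div, one_div, hPQ.inv_add_inv_eq_one, Real.rpow_one]
    exact le_of_mul_le_mul_right (hXX.le.trans hfin) (Real.rpow_pos_of_pos h0 _)

/-- **Calderón–Zygmund inequality** for trigonometric polynomials. -/
theorem exists_eLpNorm_second_le {p : ℝ≥0∞} (hp : 1 < p) (hp' : p ≠ ∞) :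
    ∃ C : ℝ≥0∞, C ≠ ∞ ∧ ∀ (S : Finset (Fin 2 → ℤ)) (c : (Fin 2 → ℤ) → ℂ) (i j : Fin 2),
      eLpNorm (partialDeriv i (partialDeriv j (trig S c))) p torusMeasure ≤
        C * eLpNorm (lap (trig S c)) p torusMeasure := by
  obtain ⟨P, rfl⟩ : ∃ P : ℝ, p = ENNReal.ofReal P := ⟨p.toReal, (ENNReal.ofReal_toReal hp').symm⟩
  have hP1 : 1 < P := by simpa using hp
  have hP0 : 0 < P := by linarith
  obtain ⟨Q, hPQ⟩ : ∃ Q, P.HolderConjugate Q := ⟨_, Real.HolderConjugate.conjExponent hP1⟩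
  obtain ⟨C, hC0, hC⟩ : ∃ C : ℝ, 0 ≤ C ∧ ∀ (i j : Fin 2) (S S' : Finset (Fin 2 → ℤ))
      (c d : (Fin 2 → ℤ) → ℂ),
      |∫ x, partialDeriv i (partialDeriv j (trig S c)) x * trig S' d x ∂torusMeasure| ≤
        C * (∫ x, |lap (trig S c) x| ^ P ∂torusMeasure +
          ∫ x, |trig S' d x| ^ Q ∂torusMeasure) := by
    have hQ0 := hPQ.symm.pos
    have hm := hPQ.mul_eq_add
    -- the Bellman function needs `a ≥ 1`, so its first variable carries the larger exponent
    rcases le_total 2 P with h2 | h2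
    · obtain ⟨C, hC0, hC⟩ := exists_abs_integral_second_mul_le_add (a := P - 1) (by linarith)
      have hne : P - 1 ≠ 0 := by linarith
      have hQ : Q = (P - 1 + 1) / (P - 1) := by rw [eq_div_iff hne]; linarith
      refine ⟨C, hC0, fun i j S S' c d => ?_⟩
      have := (hC S S' c d i j).1
      rwa [← hQ, sub_add_cancel] at this
    · have hQ1 := hPQ.symm.lt
      have hQ2 : 2 ≤ Q := by nlinarith
      obtain ⟨C, hC0, hC⟩ := exists_abs_integral_second_mul_le_add (a := Q - 1) (by linarith)
      have hne : Q - 1 ≠ 0 := by linarith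
      have hP : P = (Q - 1 + 1) / (Q - 1) := by rw [eq_div_iff hne]; linarith
      refine ⟨C, hC0, fun i j S S' c d => ?_⟩
      have := (hC S S' c d i j).2
      rwa [← hP, sub_add_cancel] at this
  refine ⟨ENNReal.ofReal (2 * C), ENNReal.ofReal_ne_top, fun S c i j => ?_⟩
  have hS := isTest_trig S c
  rw [eLpNorm_ofReal_eq ((hS.pderiv j).pderiv i).continuous hP0,
    eLpNorm_ofReal_eq hS.lap.continuous hP0, ← ENNReal.ofReal_mul (by positivity)]
  refine ENNReal.ofReal_le_ofReal (integral_rpow_le_of_forall_trig hPQ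
    ((hS.pderiv j).pderiv i).continuous fun S' d => ?_)
  have := abs_integral_second_mul_le_of_add (S := S) (c := c) (S' := S') (d := d) hPQ hC0 i j
    (hC i j)
  linarith

end

/-! ### The maximal function of a measure-preserving map -/

section Maximal

variable {X : Type*} {T : X → X}

/-- The maximum of `0` and the first `k` Birkhoff sums of `h`. -/
def birkhoffMax (T : X → X) (h : X → ℝ) : ℕ → X → ℝ
  | 0 => fun _ => 0
  | k + 1 => fun x => max 0 (h x + birkhoffMax T h k (T x))

lemma birkhoffMax_nonneg (h : X → ℝ) (k : ℕ) (x : X) : 0 ≤ birkhoffMax T h k x := by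
  cases k with
  | zero => exact le_rfl
  | succ k => exact le_max_left _ _

lemma birkhoffMax_le_succ (h : X → ℝ) (k : ℕ) (x : X) :
    birkhoffMax T h k x ≤ birkhoffMax T h (k + 1) x := by
  induction k generalizing x with
  | zero => exact le_max_left _ _
  | succ k ih =>
    change max _ _ ≤ max _ _
    gcongr
    exact ih (T x)

lemma birkhoffSum_le_birkhoffMax (h : X → ℝ) {k K : ℕ} (hk : k ≤ K) (x : X) :
    birkhoffSum T h k x ≤ birkhoffMax T h K x := by
  refine le_trans ?_ (monotone_nat_of_le_succ (f := fun k => birkhoffMax T h k x)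
    (fun k => birkhoffMax_le_succ h k x) hk)
  induction k generalizing x with
  | zero => simp [birkhoffMax]
  | succ k ih =>
    rw [birkhoffSum_succ']
    exact (add_le_add_right (ih (by omega) (T x)) (h x)).trans (le_max_right _ _)

/-- The largest of the first `K + 1` Birkhoff averages. -/
def maximal (T : X → X) (g : X → ℝ) (K : ℕ) (x : X) : ℝ :=
  (Finset.range (K + 1)).sup' Finset.nonempty_range_add_one
    fun k => birkhoffSum T g (k + 1) x / (k + 1)

lemma birkhoffSum_le_mul_maximal (g : X → ℝ) {k K : ℕ} (hk : k ≤ K) (x : X) :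
    birkhoffSum T g (k + 1) x ≤ (k + 1) * maximal T g K x := by
  have : birkhoffSum T g (k + 1) x / (k + 1) ≤ maximal T g K x :=
    Finset.le_sup' (f := fun k : ℕ => birkhoffSum T g (k + 1) x / (k + 1))
      (Finset.mem_range.2 (by omega))
  rwa [div_le_iff₀' (by positivity)] at this

lemma maximal_le {g : X → ℝ} {C : ℝ} (hg : ∀ x, g x ≤ C) (K : ℕ) (x : X) :
    maximal T g K x ≤ C := by
  refine Finset.sup'_le _ _ fun k _ => ?_
  rw [div_le_iff₀' (by positivity)]
  refine (Finset.sum_le_card_nsmul _ _ C fun j _ => hg _).trans (le_of_eq ?_)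
  simp

lemma maximal_nonneg {g : X → ℝ} (hg : ∀ x, 0 ≤ g x) (K : ℕ) (x : X) : 0 ≤ maximal T g K x := by
  have h : 0 ≤ birkhoffSum T g 1 x := by simpa using hg x
  simpa using h.trans (birkhoffSum_le_mul_maximal g (Nat.zero_le K) x)

variable [MeasurableSpace X] {μ : Measure X}

lemma measurable_birkhoffMax (hT : Measurable T) {h : X → ℝ} (hh : Measurable h) (k : ℕ) :
    Measurable (birkhoffMax T h k) := by
  induction k with
  | zero => exact measurable_const
  | succ k ih => exact measurable_const.max (hh.add (ih.comp hT))

lemma integrable_birkhoffMax (hT : MeasurePreserving T μ μ) {h : X → ℝ} (hh : Integrable h μ)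
    (k : ℕ) : Integrable (birkhoffMax T h k) μ := by
  induction k with
  | zero => exact integrable_zero _ _ _
  | succ k ih =>
    exact (integrable_zero _ _ _).sup (hh.add (hT.integrable_comp_of_integrable ih))

/-- The **maximal ergodic theorem**, by Garsia's argument. -/
lemma setIntegral_birkhoffMax_nonneg (hT : MeasurePreserving T μ μ) {h : X → ℝ}
    (hh : Measurable h) (hi : Integrable h μ) (K : ℕ) :
    0 ≤ ∫ x in {x | 0 < birkhoffMax T h K x}, h x ∂μ := by
  have hE : MeasurableSet {x | 0 < birkhoffMax T h K x} :=
    measurableSet_lt measurable_const (measurable_birkhoffMax hT.measurable hh K)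
  have hm := integrable_birkhoffMax hT hi K
  have hmT := hT.integrable_comp_of_integrable hm
  have hpt : ∀ x, birkhoffMax T h K x ≤
      {x | 0 < birkhoffMax T h K x}.indicator h x + birkhoffMax T h K (T x) := by
    intro x
    by_cases hx : 0 < birkhoffMax T h K x
    · rw [indicator_of_mem (by exact hx)]
      cases K with
      | zero => exact absurd hx (lt_irrefl _)
      | succ k =>
        have : birkhoffMax T h (k + 1) x = h x + birkhoffMax T h k (T x) :=
          max_eq_right (le_of_lt (by simpa [birkhoffMax] using hx))
        rw [this]
        exact add_le_add_right (birkhoffMax_le_succ h k (T x)) _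
    · rw [indicator_of_notMem (by exact hx), zero_add]
      exact (not_lt.1 hx).trans (birkhoffMax_nonneg h K (T x))
  have h1 := integral_mono hm ((hi.indicator hE).add hmT) hpt
  have h2 : ∫ x, birkhoffMax T h K (T x) ∂μ = ∫ x, birkhoffMax T h K x ∂μ := by
    rw [← integral_map hT.aemeasurable (hT.map_eq.symm ▸ hm.1), hT.map_eq]
  rw [integral_add' (hi.indicator hE) hmT, integral_indicator hE] at h1
  simp only [Function.comp_apply, h2] at h1
  linarith

lemma measurable_maximal (hT : Measurable T) {g : X → ℝ} (hg : Measurable g) (K : ℕ) :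
    Measurable (maximal T g K) := by
  have h : ∀ k : ℕ, Measurable fun x => birkhoffSum T g (k + 1) x / ((k : ℝ) + 1) := fun k =>
    (Finset.measurable_sum _ fun j _ => hg.comp (hT.iterate j)).div_const _
  have e : maximal T g K = (Finset.range (K + 1)).sup' Finset.nonempty_range_add_one
      fun (k : ℕ) x => birkhoffSum T g (k + 1) x / ((k : ℝ) + 1) := by
    ext x; rw [Finset.sup'_apply]; rfl
  rw [e]
  exact Finset.measurable_sup' _ fun k _ => h k

/-- The weak type inequality, in the refined form in which only the part of `g` above the level `l`
counts. -/
lemma ofReal_mul_measure_maximal_le [IsFiniteMeasure μ] (hT : MeasurePreserving T μ μ) {g : X → ℝ}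
    (hg : Measurable g) (hi : Integrable g μ) (K : ℕ) {l : ℝ} :
    ENNReal.ofReal l * μ {x | 2 * l < maximal T g K x} ≤ ∫⁻ x, ENNReal.ofReal (g x - l) ∂μ := by
  set h : X → ℝ := fun x => max (g x - l) 0 - l with hh
  have hhm : Measurable h := ((hg.sub_const l).max measurable_const).sub_const l
  have hpos : Integrable (fun x => max (g x - l) 0) μ := (hi.sub (integrable_const l)).pos_part
  have hhi : Integrable h μ := hpos.sub (integrable_const l)
  set E := {x | 0 < birkhoffMax T h (K + 1) x} with hE
  -- replacing `g` by its part above `l` loses at most `l` in each average, hence the level `2 l`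
  have hsub : {x | 2 * l < maximal T g K x} ⊆ E := by
    intro x hx
    obtain ⟨k, hk, hx⟩ := (Finset.lt_sup'_iff _).1 (show 2 * l < maximal T g K x from hx)
    rw [lt_div_iff₀ (by positivity)] at hx
    refine lt_of_lt_of_le ?_ (birkhoffSum_le_birkhoffMax h (k := k + 1)
      (by simpa using hk) x)
    have : ∑ j ∈ Finset.range (k + 1), (g (T^[j] x) - 2 * l) ≤ birkhoffSum T h (k + 1) x :=
      Finset.sum_le_sum fun j _ => by
        have := le_max_left (g (T^[j] x) - l) 0
        simp only [hh]; linarith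
    rw [Finset.sum_sub_distrib] at this
    simp only [Finset.sum_const, Finset.card_range, nsmul_eq_mul, Nat.cast_add, Nat.cast_one]
      at this
    simp only [birkhoffSum] at hx this ⊢
    linarith
  have hEm : MeasurableSet E :=
    measurableSet_lt measurable_const (measurable_birkhoffMax hT.measurable hhm _)
  have h0 := setIntegral_birkhoffMax_nonneg hT hhm hhi (K + 1)
  rw [integral_sub hpos.integrableOn (integrable_const l), setIntegral_const, smul_eq_mul] at h0
  have h1 : ∫ x in E, max (g x - l) 0 ∂μ ≤ ∫ x, max (g x - l) 0 ∂μ :=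
    setIntegral_le_integral hpos (Eventually.of_forall fun x => le_max_right _ _)
  calc ENNReal.ofReal l * μ {x | 2 * l < maximal T g K x} ≤ ENNReal.ofReal l * μ E := by gcongr
    _ = ENNReal.ofReal (μ.real E * l) := by
      rw [mul_comm, ENNReal.ofReal_mul measureReal_nonneg, ofReal_measureReal]
    _ ≤ ENNReal.ofReal (∫ x, max (g x - l) 0 ∂μ) := ENNReal.ofReal_le_ofReal (by linarith)
    _ = ∫⁻ x, ENNReal.ofReal (g x - l) ∂μ := by
      rw [ofReal_integral_eq_lintegral_ofReal hpos
        (Eventually.of_forall fun x => le_max_right _ _)]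
      refine lintegral_congr fun x => ?_
      rw [ENNReal.ofReal_max, ENNReal.ofReal_zero, max_eq_left zero_le]

/-- The integral over the levels in the layer cake formula; it converges at `0` as `1 < p`. -/
lemma lintegral_rpow_mul_sub_le {p b : ℝ} (hp : 1 < p) (hb : 0 ≤ b) :
    ∫⁻ l in Ioi (0 : ℝ), ENNReal.ofReal (l ^ (p - 2)) * ENNReal.ofReal (b - l) ≤
      ENNReal.ofReal ((p - 1)⁻¹) * ENNReal.ofReal (b ^ p) := by
  have hint : IntegrableOn (fun l : ℝ => l ^ (p - 2)) (Ioc 0 b) := by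
    have := intervalIntegral.intervalIntegrable_rpow' (a := 0) (b := b)
      (show -1 < p - 2 by linarith)
    rwa [intervalIntegrable_iff_integrableOn_Ioc_of_le hb] at this
  have h1 : ∫⁻ l in Ioc 0 b, ENNReal.ofReal (l ^ (p - 2)) =
      ENNReal.ofReal (b ^ (p - 1) / (p - 1)) := by
    rw [← ofReal_integral_eq_lintegral_ofReal hint
      ((ae_restrict_iff' measurableSet_Ioc).2 (Eventually.of_forall fun l hl =>
        Real.rpow_nonneg hl.1.le _)), ← intervalIntegral.integral_of_le hb,
      integral_rpow (Or.inl (by linarith)), show p - 2 + 1 = p - 1 by ring,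
      Real.zero_rpow (by linarith), sub_zero]
  calc ∫⁻ l in Ioi (0 : ℝ), ENNReal.ofReal (l ^ (p - 2)) * ENNReal.ofReal (b - l)
      ≤ ∫⁻ l in Ioi (0 : ℝ), (Ioc 0 b).indicator
        (fun l => ENNReal.ofReal (l ^ (p - 2)) * ENNReal.ofReal b) l := by
        refine setLIntegral_mono_ae' measurableSet_Ioi (Eventually.of_forall fun l hl => ?_)
        by_cases hlb : l ≤ b
        · rw [indicator_of_mem (show l ∈ Ioc 0 b from ⟨hl, hlb⟩)]
          gcongr
          linarith [show (0 : ℝ) < l from hl]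
        · rw [ENNReal.ofReal_of_nonpos (by linarith : b - l ≤ 0), mul_zero]
          exact zero_le
    _ ≤ ∫⁻ l, (Ioc 0 b).indicator
        (fun l => ENNReal.ofReal (l ^ (p - 2)) * ENNReal.ofReal b) l := setLIntegral_le_lintegral _ _
    _ = _ := by
      rw [lintegral_indicator measurableSet_Ioc, lintegral_mul_const' _ _ ENNReal.ofReal_ne_top, h1,
        ← ENNReal.ofReal_mul (div_nonneg (by positivity) (by linarith)),
        ← ENNReal.ofReal_mul (inv_nonneg.2 (by linarith))]
      congr 1
      rcases hb.eq_or_lt with rfl | hb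
      · rw [Real.zero_rpow (by linarith : p ≠ 0)]; simp
      · rw [Real.rpow_sub_one hb.ne']; field_simp

/-- The strong type maximal inequality. -/
lemma lintegral_maximal_rpow_le [IsFiniteMeasure μ] (hT : MeasurePreserving T μ μ) {g : X → ℝ}
    (hg : Measurable g) (hi : Integrable g μ) (hg0 : ∀ x, 0 ≤ g x) (K : ℕ) {p : ℝ} (hp : 1 < p) :
    ∫⁻ x, ENNReal.ofReal ((maximal T g K x / 2) ^ p) ∂μ ≤
      ENNReal.ofReal (p * (p - 1)⁻¹) * ∫⁻ x, ENNReal.ofReal (g x ^ p) ∂μ := by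
  rw [lintegral_rpow_eq_lintegral_meas_lt_mul μ
    (Eventually.of_forall fun x => div_nonneg (maximal_nonneg hg0 K x) two_pos.le)
    ((measurable_maximal hT.measurable hg K).div_const 2).aemeasurable (by linarith : 0 < p),
    ENNReal.ofReal_mul (by linarith : 0 ≤ p), mul_assoc]
  gcongr
  calc ∫⁻ l in Ioi (0 : ℝ), μ {x | l < maximal T g K x / 2} * ENNReal.ofReal (l ^ (p - 1))
      ≤ ∫⁻ l in Ioi (0 : ℝ), ∫⁻ x, ENNReal.ofReal (l ^ (p - 2)) * ENNReal.ofReal (g x - l) ∂μ := by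
        refine setLIntegral_mono_ae' measurableSet_Ioi (Eventually.of_forall fun l hl => ?_)
        have hl : 0 < l := hl
        have h1 := ofReal_mul_measure_maximal_le hT hg hi K (l := l)
        have h2 : {x | l < maximal T g K x / 2} = {x | 2 * l < maximal T g K x} := by
          ext x; simp only [mem_ofPred_eq]; constructor <;> intro h <;> linarith
        rw [lintegral_const_mul' _ _ ENNReal.ofReal_ne_top, h2,
          show p - 1 = p - 2 + 1 by ring, Real.rpow_add_one hl.ne',
          ENNReal.ofReal_mul (by positivity)]
        calc _ = ENNReal.ofReal (l ^ (p - 2)) *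
              (ENNReal.ofReal l * μ {x | 2 * l < maximal T g K x}) := by ring
          _ ≤ _ := by gcongr
    _ = ∫⁻ x, (∫⁻ l in Ioi (0 : ℝ), ENNReal.ofReal (l ^ (p - 2)) *
          ENNReal.ofReal (g x - l)) ∂μ := by
        refine lintegral_lintegral_swap (Measurable.aemeasurable ?_)
        have : Measurable (Function.uncurry fun (l : ℝ) (x : X) => g x - l) :=
          (hg.comp measurable_snd).sub measurable_fst
        exact ((measurable_fst.pow_const (p - 2)).ennreal_ofReal).mul this.ennreal_ofReal
    _ ≤ ∫⁻ x, ENNReal.ofReal ((p - 1)⁻¹) * ENNReal.ofReal (g x ^ p) ∂μ :=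
        lintegral_mono fun x => lintegral_rpow_mul_sub_le hp (hg0 x)
    _ = _ := lintegral_const_mul' _ _ ENNReal.ofReal_ne_top

/-- The maximal function is bounded on `L^p` for `1 < p`. -/
lemma exists_eLpNorm_maximal_le {p : ℝ≥0∞} (hp : 1 < p) (hp' : p ≠ ∞) :
    ∃ C : ℝ≥0∞, C ≠ ∞ ∧ ∀ (X : Type) [MeasurableSpace X] (μ : Measure X) [IsFiniteMeasure μ]
      (T : X → X), MeasurePreserving T μ μ → ∀ g : X → ℝ, Measurable g → Integrable g μ →
      (∀ x, 0 ≤ g x) → ∀ K, eLpNorm (maximal T g K) p μ ≤ C * eLpNorm g p μ := by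
  have hp0 : p ≠ 0 := (zero_lt_one.trans hp).ne'
  have hP : 1 < p.toReal := by
    rw [← ENNReal.toReal_one]; exact (ENNReal.toReal_lt_toReal ENNReal.one_ne_top hp').2 hp
  have hP0 : 0 < p.toReal := by linarith
  refine ⟨2 * ENNReal.ofReal (p.toReal * (p.toReal - 1)⁻¹) ^ (1 / p.toReal),
    ENNReal.mul_ne_top (by simp) (ENNReal.rpow_ne_top_of_nonneg (by positivity)
      ENNReal.ofReal_ne_top), fun X _ μ _ T hT g hg hi hg0 K => ?_⟩
  have e : ∀ f : X → ℝ, (∀ x, 0 ≤ f x) →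
      eLpNorm f p μ = (∫⁻ x, ENNReal.ofReal (f x ^ p.toReal) ∂μ) ^ (1 / p.toReal) := by
    intro f hf
    rw [eLpNorm_eq_lintegral_rpow_enorm_toReal hp0 hp']
    congr 1
    refine lintegral_congr fun x => ?_
    rw [Real.enorm_eq_ofReal (hf x), ENNReal.ofReal_rpow_of_nonneg (hf x) hP0.le]
  have h1 : eLpNorm (maximal T g K) p μ = 2 * eLpNorm (fun x => maximal T g K x / 2) p μ := by
    have := eLpNorm_const_smul (2 : ℝ) (fun x => maximal T g K x / 2) p μ
    rw [show (2 : ℝ≥0∞) = ‖(2 : ℝ)‖ₑ by rw [Real.enorm_eq_ofReal two_pos.le]; simp, ← this]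
    congr 1
    ext x
    simp only [Pi.smul_apply, smul_eq_mul]; ring
  rw [h1, e _ fun x => div_nonneg (maximal_nonneg hg0 K x) two_pos.le, e g hg0, mul_assoc,
    ← ENNReal.mul_rpow_of_nonneg _ _ (by positivity)]
  gcongr
  exact lintegral_maximal_rpow_le hT hg hi hg0 K hP

end Maximal

/-! ### Interpolation of first derivatives -/

section

/-- A derivative is bounded by the averages of the function and of its second derivative over a
segment: integrate by parts twice against the cubic cut-off `W`, for which `W 0 = 1` and
`W' 0 = W H = W' H = 0`. -/
lemma abs_le_of_contDiff_two {g g' g'' : ℝ → ℝ} (h1 : ∀ t, HasDerivAt g (g' t) t)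
    (h2 : ∀ t, HasDerivAt g' (g'' t) t) (hc : Continuous g'') {H : ℝ} (hH : 0 < H) :
    |g' 0| ≤ 6 / H ^ 2 * (∫ t in (0 : ℝ)..H, |g t|) + ∫ t in (0 : ℝ)..H, |g'' t| := by
  have hgc : Continuous g := continuous_iff_continuousAt.2 fun t => (h1 t).continuousAt
  have hne := hH.ne'
  set W : ℝ → ℝ := fun t => 1 - 3 * (t / H) ^ 2 + 2 * (t / H) ^ 3 with hW
  set W' : ℝ → ℝ := fun t => (-6 * (t / H) + 6 * (t / H) ^ 2) / H with hW'
  set W'' : ℝ → ℝ := fun t => (-6 + 12 * (t / H)) / H ^ 2 with hW''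
  have hd : ∀ t, HasDerivAt (fun t : ℝ => t / H) (1 / H) t := fun t => (hasDerivAt_id t).div_const H
  have d1 : ∀ t, HasDerivAt W (W' t) t := fun t => by
    refine (((((hd t).pow 2).const_mul 3).const_sub 1).add
      (((hd t).pow 3).const_mul 2)).congr_deriv ?_
    simp only [hW']; norm_num; field_simp; ring
  have d2 : ∀ t, HasDerivAt W' (W'' t) t := fun t => by
    refine ((((hd t).const_mul (-6)).add (((hd t).pow 2).const_mul 6)).div_const H).congr_deriv ?_
    simp only [hW'']; norm_num; field_simp; ring
  have hd3 : ∀ t, HasDerivAt (fun t => W t * g' t - W' t * g t) (W t * g'' t - W'' t * g t) t :=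
    fun t => (((d1 t).mul (h2 t)).sub ((d2 t).mul (h1 t))).congr_deriv (by ring)
  have hWc : Continuous W := continuous_iff_continuousAt.2 fun t => (d1 t).continuousAt
  have hWc'' : Continuous W'' := by fun_prop
  have hFTC := intervalIntegral.integral_eq_sub_of_hasDerivAt (a := 0) (b := H)
    (fun t _ => hd3 t) (((hWc.mul hc).sub (hWc''.mul hgc)).intervalIntegrable _ _)
  have e0 : W 0 = 1 ∧ W' 0 = 0 ∧ W H = 0 ∧ W' H = 0 := by
    simp only [hW, hW', zero_div, div_self hne]; norm_num
  rw [e0.1, e0.2.1, e0.2.2.1, e0.2.2.2] at hFTC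
  have i1 : IntervalIntegrable (fun t => |g t|) volume 0 H := hgc.abs.intervalIntegrable _ _
  have i2 : IntervalIntegrable (fun t => |g'' t|) volume 0 H := hc.abs.intervalIntegrable _ _
  have hb : |∫ t in (0 : ℝ)..H, (W t * g'' t - W'' t * g t)| ≤
      ∫ t in (0 : ℝ)..H, (6 / H ^ 2 * |g t| + |g'' t|) := by
    rw [← Real.norm_eq_abs]
    refine intervalIntegral.norm_integral_le_of_norm_le hH.le (Eventually.of_forall fun t ht => ?_)
      ((i1.const_mul _).add i2)
    obtain ⟨s, hs⟩ : ∃ s, s = t / H := ⟨_, rfl⟩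
    have hs0 : 0 ≤ s := hs ▸ div_nonneg ht.1.le hH.le
    have hs1 : s ≤ 1 := hs ▸ (div_le_one hH).2 ht.2
    have w1 : |W t| ≤ 1 := by
      simp only [hW, ← hs]
      rw [abs_le]
      constructor <;> nlinarith [mul_nonneg hs0 hs0,
        mul_nonneg (mul_nonneg hs0 hs0) (sub_nonneg.2 hs1), mul_nonneg hs0 (sub_nonneg.2 hs1)]
    have w2 : |W'' t| ≤ 6 / H ^ 2 := by
      simp only [hW'', ← hs]
      rw [abs_div, abs_of_pos (by positivity : (0 : ℝ) < H ^ 2)]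
      gcongr
      rw [abs_le]; constructor <;> linarith
    calc ‖W t * g'' t - W'' t * g t‖ ≤ |W t * g'' t| + |W'' t * g t| := abs_sub _ _
      _ = |W t| * |g'' t| + |W'' t| * |g t| := by rw [abs_mul, abs_mul]
      _ ≤ 1 * |g'' t| + 6 / H ^ 2 * |g t| := by gcongr
      _ = _ := by ring
  rw [intervalIntegral.integral_add (i1.const_mul _) i2, intervalIntegral.integral_const_mul,
    hFTC] at hb
  simpa using hb

/-- The average of `|f|` over a segment of length `τ` in the `i`-th direction. -/
def segmentAverage (i : Fin 2) (τ : ℝ) (f : T2 → ℝ) (x : T2) : ℝ :=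
  ∫ s in (0 : ℝ)..1, |f (x + shift i (τ * s))|

variable {i : Fin 2} {τ : ℝ} {f : T2 → ℝ}

lemma segmentAverage_nonneg (x : T2) : 0 ≤ segmentAverage i τ f x :=
  intervalIntegral.integral_nonneg zero_le_one fun _ _ => abs_nonneg _

lemma continuous_segmentAverage (hf : Continuous f) : Continuous (segmentAverage i τ f) := by
  have := continuous_shift i
  refine intervalIntegral.continuous_parametric_intervalIntegral_of_continuous' ?_ 0 1
  fun_prop

lemma segmentAverage_le (hf : Continuous f) {C : ℝ} (hC : ∀ x, |f x| ≤ C) (x : T2) :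
    segmentAverage i τ f x ≤ C := by
  have := continuous_shift i
  refine (intervalIntegral.integral_mono_on (g := fun _ => C) zero_le_one
    (Continuous.intervalIntegrable (by fun_prop) _ _) (by simp) fun _ _ => hC _).trans ?_
  simp

lemma eLpNorm_segmentAverage_le (hf : Continuous f) {p : ℝ≥0∞} (hp : 1 ≤ p) (hp' : p ≠ ∞) :
    eLpNorm (segmentAverage i τ f) p torusMeasure ≤ eLpNorm f p torusMeasure := by
  have := continuous_shift i
  refine eLpNorm_le_of_enorm_le_average unitInterval01 (τ := fun s => shift i (τ * s))
    (Continuous.measurable (by fun_prop)) hf.measurable hp hp' fun x => ?_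
  rw [segmentAverage, intervalIntegral.integral_of_le zero_le_one]
  refine (enorm_integral_le_lintegral_enorm _).trans (le_of_eq ?_)
  simp

/-- Integrals over segments are Birkhoff sums of the translation by `τ`. -/
lemma integral_abs_eq_mul_birkhoffSum (hf : Continuous f) (hτ : 0 < τ) (k : ℕ) (x : T2) :
    ∫ t in (0 : ℝ)..(k * τ), |f (x + shift i t)| =
      τ * birkhoffSum (· + shift i τ) (segmentAverage i τ f) k x := by
  have hs := continuous_shift i
  have hc : Continuous fun t => |f (x + shift i t)| := by fun_prop
  have hit : ∀ j : ℕ, (· + shift i τ)^[j] x = x + shift i (j * τ) := by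
    intro j
    induction j with
    | zero => simp [shift_zero]
    | succ j ih =>
      rw [Function.iterate_succ_apply', ih, add_assoc, ← shift_add]
      push_cast; ring_nf
  have h1 := intervalIntegral.sum_integral_adjacent_intervals (μ := volume)
    (f := fun t => |f (x + shift i t)|) (a := fun j : ℕ => (j : ℝ) * τ) (n := k)
    fun j _ => hc.intervalIntegrable _ _
  simp only [Nat.cast_zero, zero_mul] at h1
  rw [← h1, birkhoffSum, Finset.mul_sum]
  refine Finset.sum_congr rfl fun j _ => ?_
  have h2 := intervalIntegral.integral_comp_mul_add (a := 0) (b := 1)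
    (fun t => |f (x + shift i t)|) hτ.ne' (j * τ)
  rw [hit, segmentAverage]
  simp only [add_assoc, ← shift_add]
  simp only [mul_zero, zero_add, mul_one, smul_eq_mul] at h2
  simp only [add_comm (j * τ : ℝ), h2, Nat.cast_add, Nat.cast_one, add_mul, one_mul]
  field_simp

/-- The maximal function along the `i`-th direction, with step `τ`. -/
def lineMaximal (i : Fin 2) (τ : ℝ) (K : ℕ) (f : T2 → ℝ) : T2 → ℝ :=
  maximal (· + shift i τ) (segmentAverage i τ f) K

lemma measurable_lineMaximal (hf : Continuous f) (K : ℕ) : Measurable (lineMaximal i τ K f) :=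
  measurable_maximal (measurable_add_const _) (continuous_segmentAverage hf).measurable K

lemma lineMaximal_nonneg (K : ℕ) (x : T2) : 0 ≤ lineMaximal i τ K f x :=
  maximal_nonneg segmentAverage_nonneg K x

lemma lineMaximal_le (hf : Continuous f) {C : ℝ} (hC : ∀ x, |f x| ≤ C) (K : ℕ) (x : T2) :
    lineMaximal i τ K f x ≤ C :=
  maximal_le (segmentAverage_le hf hC) K x

lemma abs_le_eLpNorm_top (hf : Continuous f) (x : T2) :
    |f x| ≤ (eLpNorm f ∞ torusMeasure).toReal := by
  have hfin : eLpNorm f ∞ torusMeasure ≠ ∞ := (memLp_of_continuous hf ∞).eLpNorm_ne_top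
  by_contra! hx
  have hopen : IsOpen {y | (eLpNorm f ∞ torusMeasure).toReal < |f y|} :=
    isOpen_lt continuous_const hf.abs
  have hpos := hopen.measure_pos torusMeasure ⟨x, hx⟩
  refine hpos.ne' (measure_mono_null (fun y hy => ?_)
    (ae_iff.1 (ae_le_eLpNormEssSup (f := f) (μ := torusMeasure))))
  simp only [mem_ofPred_eq, not_le, ← eLpNorm_exponent_top] at hy ⊢
  rw [← ENNReal.ofReal_toReal hfin, Real.enorm_eq_ofReal_abs]
  exact (ENNReal.ofReal_lt_ofReal_iff (ENNReal.toReal_nonneg.trans_lt hy)).2 hy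

lemma exists_eLpNorm_lineMaximal_le {p : ℝ≥0∞} (hp : 1 < p) :
    ∃ C : ℝ≥0∞, C ≠ ∞ ∧ ∀ (i : Fin 2) (τ : ℝ) (K : ℕ) (f : T2 → ℝ), Continuous f →
      eLpNorm (lineMaximal i τ K f) p torusMeasure ≤ C * eLpNorm f p torusMeasure := by
  by_cases hp' : p = ∞
  · refine ⟨1, by simp, fun i τ K f hf => ?_⟩
    have hfin : eLpNorm f ∞ torusMeasure ≠ ∞ := (memLp_of_continuous hf ∞).eLpNorm_ne_top
    rw [one_mul, hp', ← ENNReal.ofReal_toReal hfin]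
    refine eLpNorm_le_of_forall_abs_le (fun x => ?_) _
    rw [abs_of_nonneg (lineMaximal_nonneg K x)]
    exact lineMaximal_le hf (abs_le_eLpNorm_top hf) K x
  · obtain ⟨C, hC, h⟩ := exists_eLpNorm_maximal_le hp hp'
    refine ⟨C, hC, fun i τ K f hf => ?_⟩
    refine (h T2 torusMeasure (· + shift i τ) (measurePreserving_add_right _ _) _
      (continuous_segmentAverage hf).measurable
      (integrable_of_continuous (continuous_segmentAverage hf)) segmentAverage_nonneg K).trans ?_
    gcongr
    exact eLpNorm_segmentAverage_le hf hp.le hp'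

/-- The pointwise bound with a segment of length `(k + 1) τ`. -/
lemma IsTest.abs_partialDeriv_le (hf : IsTest f) (hτ : 0 < τ) {k K : ℕ} (hk : k ≤ K) (x : T2) :
    |partialDeriv i f x| ≤ 6 / ((k + 1) * τ) * lineMaximal i τ K f x +
      (k + 1) * τ * lineMaximal i τ K (partialDeriv i (partialDeriv i f)) x := by
  have hH : 0 < ((k + 1 : ℕ) : ℝ) * τ := by positivity
  have hs := continuous_shift i
  have h2c := ((hf.pderiv i).pderiv i).continuous
  have h := abs_le_of_contDiff_two (fun t => (hf.hasPartial i).hasDerivAt x t)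
    (fun t => ((hf.pderiv i).hasPartial i).hasDerivAt x t) (by fun_prop) hH
  rw [integral_abs_eq_mul_birkhoffSum hf.continuous hτ,
    integral_abs_eq_mul_birkhoffSum h2c hτ, shift_zero, add_zero] at h
  have b1 := birkhoffSum_le_mul_maximal (T := (· + shift i τ)) (segmentAverage i τ f) hk x
  have b2 := birkhoffSum_le_mul_maximal (T := (· + shift i τ))
    (segmentAverage i τ (partialDeriv i (partialDeriv i f))) hk x
  refine h.trans ?_
  push_cast
  calc _ ≤ 6 / ((k + 1) * τ) ^ 2 * (τ * ((k + 1) * lineMaximal i τ K f x)) +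
        τ * ((k + 1) * lineMaximal i τ K (partialDeriv i (partialDeriv i f)) x) := by
        gcongr <;> assumption
    _ = _ := by field_simp

/-- Choosing the length of the segment optimally gives the pointwise interpolation inequality. -/
lemma IsTest.exists_sq_partialDeriv_le (hf : IsTest f) (i : Fin 2) {ε : ℝ} (hε : 0 < ε) :
    ∃ τ K, ∀ x, |partialDeriv i f x| ≤
      8 * (√(lineMaximal i τ K f x + ε) *
        √(lineMaximal i τ K (partialDeriv i (partialDeriv i f)) x + ε)) := by
  have h2c := ((hf.pderiv i).pderiv i).continuous
  have b1 := abs_le_eLpNorm_top hf.continuous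
  have b2 := abs_le_eLpNorm_top h2c
  set A := (eLpNorm f ∞ torusMeasure).toReal
  set B := (eLpNorm (partialDeriv i (partialDeriv i f)) ∞ torusMeasure).toReal
  have hA : 0 ≤ A := ENNReal.toReal_nonneg
  have hB : 0 ≤ B := ENNReal.toReal_nonneg
  set τ := √(ε / (B + ε)) with hτd
  have hτ : 0 < τ := by positivity
  -- `τ` and `K τ` are lower and upper bounds for the optimal length, uniformly in `x`
  obtain ⟨K, hK⟩ := exists_nat_ge (√((A + ε) / ε) / τ)
  refine ⟨τ, K, fun x => ?_⟩
  have ha0 := lineMaximal_nonneg (i := i) (τ := τ) (f := f) K x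
  have hb0 := lineMaximal_nonneg (i := i) (τ := τ) (f := partialDeriv i (partialDeriv i f)) K x
  have ha1 := lineMaximal_le (i := i) (τ := τ) hf.continuous b1 K x
  have hb1 := lineMaximal_le (i := i) (τ := τ) h2c b2 K x
  have hmain := fun k (hk : k ≤ K) => hf.abs_partialDeriv_le (i := i) hτ hk x
  set a := lineMaximal i τ K f x
  set b := lineMaximal i τ K (partialDeriv i (partialDeriv i f)) x
  have ha : 0 < a + ε := by linarith
  have hb : 0 < b + ε := by linarith
  -- the optimal length balances the two terms
  set H := √((a + ε) / (b + ε)) with hH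
  have hH0 : 0 < H := by positivity
  have hτH : τ ≤ H := Real.sqrt_le_sqrt (by gcongr; linarith)
  have hHK : H ≤ √((A + ε) / ε) := Real.sqrt_le_sqrt (by gcongr; linarith)
  set k := ⌊H / τ⌋₊ with hk
  have hkK : k ≤ K := by
    have : (k : ℝ) ≤ K := (Nat.floor_le (by positivity)).trans ((by gcongr : H / τ ≤ _).trans hK)
    exact_mod_cast this
  have h1 : H ≤ (k + 1) * τ := by
    rw [← div_le_iff₀ hτ]; exact (Nat.lt_floor_add_one _).le
  have h2 : (k + 1) * τ ≤ 2 * H := by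
    have : (k : ℝ) * τ ≤ H := by rw [← le_div_iff₀ hτ]; exact Nat.floor_le (by positivity)
    linarith
  have e1 : (a + ε) / H = √(a + ε) * √(b + ε) := by
    rw [hH, Real.sqrt_div ha.le, div_div_eq_mul_div, div_eq_iff (by positivity)]
    nth_rw 1 [← Real.mul_self_sqrt ha.le]; ring
  have e2 : H * (b + ε) = √(a + ε) * √(b + ε) := by
    rw [hH, Real.sqrt_div ha.le, div_mul_eq_mul_div, div_eq_iff (by positivity)]
    nth_rw 1 [← Real.mul_self_sqrt hb.le]; ring
  calc |partialDeriv i f x| ≤ 6 / ((k + 1) * τ) * a + (k + 1) * τ * b := hmain k hkK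
    _ ≤ 6 / H * (a + ε) + 2 * H * (b + ε) := by gcongr <;> linarith
    _ = 6 * ((a + ε) / H) + 2 * (H * (b + ε)) := by ring
    _ = _ := by rw [e1, e2]; ring

lemma eLpNorm_sqrt {g : T2 → ℝ} (hg : ∀ x, 0 ≤ g x) (p : ℝ≥0∞) :
    eLpNorm (fun x => √(g x)) (2 * p) torusMeasure = eLpNorm g p torusMeasure ^ (1 / 2 : ℝ) := by
  have h := eLpNorm_norm_rpow (p := 2 * p) (q := 1 / 2) (μ := torusMeasure) g (by norm_num)
  have e : 2 * p * ENNReal.ofReal (1 / 2) = p := by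
    rw [show ENNReal.ofReal (1 / 2) = 2⁻¹ by
      rw [one_div, ENNReal.ofReal_inv_of_pos two_pos]; simp, mul_comm, ← mul_assoc,
      ENNReal.inv_mul_cancel (by simp) (by simp), one_mul]
  rw [e] at h
  rw [← h]
  congr 1
  ext x
  rw [Real.norm_of_nonneg (hg x), Real.sqrt_eq_rpow]

/-- The **Gagliardo–Nirenberg inequality** for one derivative between the function and two
derivatives in the same direction. -/
theorem exists_sq_eLpNorm_partialDeriv_le {a c r : ℝ≥0∞} (ha : 1 < a) (hc : 1 < c)
    (hr : a⁻¹ + c⁻¹ = 2 * r⁻¹) :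
    ∃ C : ℝ≥0∞, C ≠ ∞ ∧ ∀ f : T2 → ℝ, IsTest f → ∀ i,
      eLpNorm (partialDeriv i f) r torusMeasure ^ 2 ≤
        C * (eLpNorm f a torusMeasure *
          eLpNorm (partialDeriv i (partialDeriv i f)) c torusMeasure) := by
  obtain ⟨C, hC, hCa⟩ := exists_eLpNorm_lineMaximal_le ha
  obtain ⟨D, hD, hDc⟩ := exists_eLpNorm_lineMaximal_le hc
  have hold : ENNReal.HolderTriple (2 * a) (2 * c) r := ⟨by
    rw [ENNReal.mul_inv (by simp) (by simp), ENNReal.mul_inv (by simp) (by simp), ← mul_add, hr,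
      ← mul_assoc, ENNReal.inv_mul_cancel (by simp) (by simp), one_mul]⟩
  refine ⟨64 * (C * D), ENNReal.mul_ne_top (by simp) (ENNReal.mul_ne_top hC hD),
    fun f hf i => ?_⟩
  have hfc := hf.continuous
  have h2c := ((hf.pderiv i).pderiv i).continuous
  have key : ∀ ε : ℝ, 0 < ε → eLpNorm (partialDeriv i f) r torusMeasure ^ 2 ≤
      64 * ((C * eLpNorm f a torusMeasure + ENNReal.ofReal ε) *
        (D * eLpNorm (partialDeriv i (partialDeriv i f)) c torusMeasure + ENNReal.ofReal ε)) := by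
    intro ε hε
    obtain ⟨τ, K, h⟩ := hf.exists_sq_partialDeriv_le i hε
    have add_le : ∀ (p : ℝ≥0∞) (D : ℝ≥0∞) (g : T2 → ℝ), 1 < p → Continuous g →
        eLpNorm (lineMaximal i τ K g) p torusMeasure ≤ D * eLpNorm g p torusMeasure →
        eLpNorm (fun x => lineMaximal i τ K g x + ε) p torusMeasure ≤
          D * eLpNorm g p torusMeasure + ENNReal.ofReal ε := fun p D g hp hg hle =>
      (eLpNorm_add_le (measurable_lineMaximal hg K).aestronglyMeasurable
        aestronglyMeasurable_const hp.le).trans (add_le_add hle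
          (eLpNorm_le_of_forall_abs_le (fun _ => by rw [abs_of_pos hε]) p))
    have n1 : ∀ x, 0 ≤ lineMaximal i τ K f x + ε := fun x =>
      add_nonneg (lineMaximal_nonneg K x) hε.le
    have n2 : ∀ x, 0 ≤ lineMaximal i τ K (partialDeriv i (partialDeriv i f)) x + ε := fun x =>
      add_nonneg (lineMaximal_nonneg K x) hε.le
    have m1 := (measurable_lineMaximal (i := i) (τ := τ) hfc K).add_const ε
    have m2 := (measurable_lineMaximal (i := i) (τ := τ) h2c K).add_const ε
    have h1 : eLpNorm (partialDeriv i f) r torusMeasure ≤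
        8 * (eLpNorm (fun x => lineMaximal i τ K f x + ε) a torusMeasure ^ (1 / 2 : ℝ) *
          eLpNorm (fun x => lineMaximal i τ K (partialDeriv i (partialDeriv i f)) x + ε) c
            torusMeasure ^ (1 / 2 : ℝ)) := by
      rw [← eLpNorm_sqrt n1, ← eLpNorm_sqrt n2]
      refine (eLpNorm_mono_real (g := (8 : ℝ) • ((fun x => √(lineMaximal i τ K f x + ε)) •
        fun x => √(lineMaximal i τ K (partialDeriv i (partialDeriv i f)) x + ε))) h).trans ?_
      rw [eLpNorm_const_smul, show ‖(8 : ℝ)‖ₑ = 8 by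
        rw [Real.enorm_eq_ofReal (by norm_num)]; simp]
      gcongr
      exact eLpNorm_smul_le_mul_eLpNorm m2.sqrt.aestronglyMeasurable m1.sqrt.aestronglyMeasurable
    have sq : ∀ y : ℝ≥0∞, (y ^ (1 / 2 : ℝ)) ^ 2 = y := fun y => by
      rw [← ENNReal.rpow_natCast, ← ENNReal.rpow_mul]; norm_num
    calc eLpNorm (partialDeriv i f) r torusMeasure ^ 2 ≤ _ := pow_le_pow_left' h1 2
      _ = 64 * (eLpNorm (fun x => lineMaximal i τ K f x + ε) a torusMeasure *
          eLpNorm (fun x => lineMaximal i τ K (partialDeriv i (partialDeriv i f)) x + ε) c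
            torusMeasure) := by rw [mul_pow, mul_pow, sq, sq]; norm_num
      _ ≤ _ := by
        gcongr
        · exact add_le _ _ _ ha hfc (hCa i τ K f hfc)
        · exact add_le _ _ _ hc h2c (hDc i τ K _ h2c)
  have n1 : C * eLpNorm f a torusMeasure ≠ ∞ :=
    ENNReal.mul_ne_top hC (memLp_of_continuous hfc a).eLpNorm_ne_top
  have n2 : D * eLpNorm (partialDeriv i (partialDeriv i f)) c torusMeasure ≠ ∞ :=
    ENNReal.mul_ne_top hD (memLp_of_continuous h2c c).eLpNorm_ne_top
  have hl : ∀ y : ℝ≥0∞, Tendsto (fun ε : ℝ => y + ENNReal.ofReal ε) (𝓝[>] 0) (𝓝 y) := fun y => by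
    have : Tendsto (fun ε : ℝ => y + ENNReal.ofReal ε) (𝓝[>] 0) (𝓝 (y + ENNReal.ofReal 0)) :=
      ((continuous_const.add ENNReal.continuous_ofReal).tendsto 0).mono_left nhdsWithin_le_nhds
    simpa using this
  have hlim := ENNReal.Tendsto.const_mul (a := 64) (ENNReal.Tendsto.mul (hl _) (Or.inr n2)
    (hl _) (Or.inr n1)) (Or.inr (by simp))
  refine (ge_of_tendsto hlim (eventually_nhdsWithin_of_forall fun ε hε => key ε hε)).trans
    (le_of_eq ?_)
  ring

end

/-! ### Log-convex sequences -/

section LogConvex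

variable {N : ℕ → ℝ≥0∞} {C : ℝ≥0∞} {m : ℕ}

/-- Log-convexity moves one unit from a smaller index to a larger one. Terms may vanish, so that the
argument avoids quotients. -/
lemma mul_le_mul_of_sq_le (hN : ∀ k, N k ≠ ∞)
    (h : ∀ k, k + 2 ≤ m → N (k + 1) ^ 2 ≤ C * (N k * N (k + 2))) (a n : ℕ)
    (ham : a + 1 + n + 1 ≤ m) :
    N (a + 1) * N (a + 1 + n) ≤ C ^ (n + 1) * (N a * N (a + 1 + n + 1)) := by
  induction n with
  | zero => simpa [sq] using h a (by omega)
  | succ n ih =>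
    rcases eq_or_ne (N (a + 1 + n + 1)) 0 with h0 | h0
    · rw [← add_assoc, h0, mul_zero]; exact zero_le
    · rw [← ENNReal.mul_le_mul_iff_left h0 (hN _)]
      calc N (a + 1) * N (a + 1 + (n + 1)) * N (a + 1 + n + 1)
          = N (a + 1) * N (a + 1 + n + 1) ^ 2 := by rw [← add_assoc]; ring
        _ ≤ N (a + 1) * (C * (N (a + 1 + n) * N (a + 1 + n + 2))) := by
            gcongr; exact h _ (by omega)
        _ = C * N (a + 1 + n + 2) * (N (a + 1) * N (a + 1 + n)) := by ring
        _ ≤ C * N (a + 1 + n + 2) * (C ^ (n + 1) * (N a * N (a + 1 + n + 1))) := by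
            exact mul_le_mul_right (ih (by omega)) _
        _ = _ := by rw [← add_assoc (a + 1) n 1, add_assoc (a + 1 + n) 1 1]; ring

/-- In a log-convex sequence the product of two terms is controlled by the product of the extreme
terms with the same sum of indices. -/
lemma mul_le_zero_mul_of_sq_le (hC : 1 ≤ C) (hN : ∀ k, N k ≠ ∞)
    (h : ∀ k, k + 2 ≤ m → N (k + 1) ^ 2 ≤ C * (N k * N (k + 2))) (a b : ℕ) (hab : a + b ≤ m) :
    N a * N b ≤ C ^ (m * m) * (N 0 * N (a + b)) := by
  have key : ∀ a b : ℕ, a ≤ b → a + b ≤ m → N a * N b ≤ C ^ (m * a) * (N 0 * N (a + b)) := by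
    intro a
    induction a with
    | zero => intro b _ _; simp
    | succ a ih =>
      intro b hab hm
      obtain ⟨n, rfl⟩ := Nat.exists_eq_add_of_le hab
      calc N (a + 1) * N (a + 1 + n) ≤ C ^ (n + 1) * (N a * N (a + 1 + n + 1)) :=
            mul_le_mul_of_sq_le hN h a n (by omega)
        _ ≤ C ^ m * (C ^ (m * a) * (N 0 * N (a + (a + 1 + n + 1)))) := by
            exact mul_le_mul' (pow_le_pow_right₀ hC (by omega)) (ih _ (by omega) (by omega))
        _ = _ := by
            rw [show a + (a + 1 + n + 1) = a + 1 + (a + 1 + n) by ring]; ring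
  rcases le_total a b with hle | hle
  · refine (key a b hle hab).trans ?_
    exact mul_le_mul_left (pow_le_pow_right₀ hC (Nat.mul_le_mul_left _ (by omega))) _
  · rw [mul_comm, add_comm]
    refine (key b a hle (by omega)).trans ?_
    exact mul_le_mul_left (pow_le_pow_right₀ hC (Nat.mul_le_mul_left _ (by omega))) _

/-- In a log-convex sequence, an interior term is small as soon as the next one is and the first
one is bounded. -/
lemma exists_pow_le_of_sq_le (hC : C ≠ ∞) (k : ℕ) : ∃ D : ℝ≥0∞, D ≠ ∞ ∧ ∀ N : ℕ → ℝ≥0∞,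
    (∀ k, N k ≠ ∞) → (∀ k, k + 2 ≤ m → N (k + 1) ^ 2 ≤ C * (N k * N (k + 2))) → k + 1 ≤ m →
    N k ^ (k + 1) ≤ D * (N 0 * N (k + 1) ^ k) := by
  induction k with
  | zero => exact ⟨1, by simp, fun N _ _ _ => by simp⟩
  | succ k ih =>
    obtain ⟨D, hD, ih⟩ := ih
    refine ⟨C ^ (k + 1) * D, ENNReal.mul_ne_top (ENNReal.pow_ne_top hC) hD,
      fun N hN h hk => ?_⟩
    rcases eq_or_ne (N (k + 1)) 0 with h0 | h0
    · rw [h0, zero_pow (by omega)]; exact zero_le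
    · rw [← ENNReal.mul_le_mul_iff_left (pow_ne_zero k h0) (ENNReal.pow_ne_top (hN _))]
      calc N (k + 1) ^ (k + 1 + 1) * N (k + 1) ^ k = (N (k + 1) ^ 2) ^ (k + 1) := by ring
        _ ≤ (C * (N k * N (k + 2))) ^ (k + 1) := by gcongr; exact h k (by omega)
        _ = C ^ (k + 1) * N (k + 2) ^ (k + 1) * N k ^ (k + 1) := by ring
        _ ≤ C ^ (k + 1) * N (k + 2) ^ (k + 1) * (D * (N 0 * N (k + 1) ^ k)) := by
            gcongr; exact ih N hN h (by omega)
        _ = _ := by ring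

end LogConvex

/-! ### Gagliardo–Nirenberg inequalities between all orders -/

/-- The exponent `p m / k` at which derivatives of order `k` are measured when those of order `m`
are in `L^p`; it is `∞` for `k = 0`. -/
def gnExp (p : ℝ≥0∞) (m k : ℕ) : ℝ≥0∞ := p * m / k

/-- The sum of the `L^r` norms of the classical derivatives of order `k`. -/
def derivNorm (k : ℕ) (r : ℝ≥0∞) (f : T2 → ℝ) : ℝ≥0∞ :=
  ∑ α ∈ Finset.HasAntidiagonal.antidiagonal k, eLpNorm (pd α.1 α.2 f) r torusMeasure

lemma derivNorm_zero (r : ℝ≥0∞) (f : T2 → ℝ) : derivNorm 0 r f = eLpNorm f r torusMeasure := by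
  simp [derivNorm, pd_zero]

lemma eLpNorm_pd_le_derivNorm {k a b : ℕ} (h : a + b = k) (r : ℝ≥0∞) (f : T2 → ℝ) :
    eLpNorm (pd a b f) r torusMeasure ≤ derivNorm k r f := by
  have hm : (a, b) ∈ Finset.HasAntidiagonal.antidiagonal k :=
    Finset.HasAntidiagonal.mem_antidiagonal.2 h
  have := Finset.single_le_sum_of_canonicallyOrdered
    (f := fun α : ℕ × ℕ => eLpNorm (pd α.1 α.2 f) r torusMeasure) hm
  unfold derivNorm
  simpa only using this

lemma derivNorm_ne_top {f : T2 → ℝ} (hf : IsTest f) (k : ℕ) (r : ℝ≥0∞) : derivNorm k r f ≠ ∞ :=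
  ENNReal.sum_ne_top.2 fun _ _ => ((hf.iterDeriv _ _).memLp r).eLpNorm_ne_top

section GagliardoNirenberg

variable {p : ℝ≥0∞} {m : ℕ}

lemma inv_gnExp (hp : 1 < p) (hp' : p ≠ ∞) (hm : 1 ≤ m) (k : ℕ) :
    (gnExp p m k)⁻¹ = k / (p * m) := by
  have h0 : p * m ≠ 0 := mul_ne_zero (zero_lt_one.trans hp).ne' (by simp; omega)
  exact ENNReal.inv_div (Or.inr (ENNReal.mul_ne_top hp' (by simp))) (Or.inr h0)

lemma inv_gnExp_add (hp : 1 < p) (hp' : p ≠ ∞) (hm : 1 ≤ m) (j k : ℕ) :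
    (gnExp p m j)⁻¹ + (gnExp p m k)⁻¹ = (gnExp p m (j + k))⁻¹ := by
  simp only [inv_gnExp hp hp' hm, ENNReal.div_add_div_same, Nat.cast_add]

lemma gnExp_self (hm : 1 ≤ m) : gnExp p m m = p :=
  ENNReal.mul_div_cancel_right (by simp; omega) (by simp)

lemma gnExp_zero (hp : 1 < p) (hm : 1 ≤ m) : gnExp p m 0 = ∞ := by
  have h0 : p * m ≠ 0 := mul_ne_zero (zero_lt_one.trans hp).ne' (by simp; omega)
  simp only [gnExp, Nat.cast_zero]
  exact ENNReal.div_zero h0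

lemma one_lt_gnExp (hp : 1 < p) (hm : 1 ≤ m) {k : ℕ} (hk : k ≤ m) : 1 < gnExp p m k := by
  rcases Nat.eq_zero_or_pos k with rfl | h0
  · rw [gnExp_zero hp hm]; simp
  · refine hp.trans_le ?_
    rw [gnExp, ENNReal.le_div_iff_mul_le (Or.inl (by simp; omega)) (Or.inl (by simp))]
    gcongr

/-- Log-convexity of the norms of the derivatives at the exponents `gnExp p m k`. -/
lemma exists_sq_derivNorm_le (hp : 1 < p) (hp' : p ≠ ∞) (k : ℕ) (hk : k + 2 ≤ m) :
    ∃ C : ℝ≥0∞, C ≠ ∞ ∧ ∀ f, IsTest f → derivNorm (k + 1) (gnExp p m (k + 1)) f ^ 2 ≤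
      C * (derivNorm k (gnExp p m k) f * derivNorm (k + 2) (gnExp p m (k + 2)) f) := by
  have hm : 1 ≤ m := by omega
  obtain ⟨C, hC, h⟩ := exists_sq_eLpNorm_partialDeriv_le (a := gnExp p m k)
    (c := gnExp p m (k + 2)) (r := gnExp p m (k + 1)) (one_lt_gnExp hp hm (by omega))
    (one_lt_gnExp hp hm hk) (by
      rw [inv_gnExp_add hp hp' hm, two_mul, inv_gnExp_add hp hp' hm]; congr 2; ring)
  refine ⟨(k + 2) ^ 2 * C, ENNReal.mul_ne_top (by finiteness) hC, fun f hf => ?_⟩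
  set Y := C * (derivNorm k (gnExp p m k) f * derivNorm (k + 2) (gnExp p m (k + 2)) f) with hY
  have hsq : ∀ x : ℝ≥0∞, x ^ 2 ≤ Y → x ≤ Y ^ (2 : ℝ)⁻¹ := fun x hx => by
    rw [ENNReal.le_rpow_inv_iff two_pos]; exact_mod_cast hx
  have step : ∀ (a b : ℕ) (i : Fin 2), a + b = k →
      eLpNorm (partialDeriv i (pd a b f)) (gnExp p m (k + 1)) torusMeasure ≤ Y ^ (2 : ℝ)⁻¹ := by
    intro a b i hab
    refine hsq _ ((h _ (hf.iterDeriv a b) i).trans ?_)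
    rw [hY]
    gcongr
    · exact eLpNorm_pd_le_derivNorm hab _ _
    · rw [hf.partialDeriv_pd, hf.partialDeriv_pd]
      refine eLpNorm_pd_le_derivNorm ?_ _ _
      fin_cases i <;> simp <;> omega
  have hall : ∀ α ∈ Finset.HasAntidiagonal.antidiagonal (k + 1),
      eLpNorm (pd α.1 α.2 f) (gnExp p m (k + 1)) torusMeasure ≤ Y ^ (2 : ℝ)⁻¹ := by
    rintro ⟨a, b⟩ hab
    rw [Finset.HasAntidiagonal.mem_antidiagonal] at hab
    rcases a with _ | a
    · obtain rfl : b = k + 1 := by simpa using hab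
      simp only
      rw [hf.pd_succ_right]
      exact step 0 k 1 (by simp)
    · simp only
      rw [pd_succ_left]
      exact step a b 0 (by simp only at hab; omega)
  calc derivNorm (k + 1) (gnExp p m (k + 1)) f ^ 2
      ≤ ((k + 2) * Y ^ (2 : ℝ)⁻¹) ^ 2 := by
        gcongr
        refine (Finset.sum_le_card_nsmul _ _ _ hall).trans (le_of_eq ?_)
        rw [Finset.Nat.card_antidiagonal, nsmul_eq_mul]; push_cast; ring
    _ = _ := by
      rw [mul_pow, ← ENNReal.rpow_natCast (Y ^ _), ← ENNReal.rpow_mul, hY]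
      norm_num
      ring

lemma exists_forall_sq_derivNorm_le (hp : 1 < p) (hp' : p ≠ ∞) (m : ℕ) :
    ∃ C : ℝ≥0∞, 1 ≤ C ∧ C ≠ ∞ ∧ ∀ f, IsTest f → ∀ k, k + 2 ≤ m →
      derivNorm (k + 1) (gnExp p m (k + 1)) f ^ 2 ≤
      C * (derivNorm k (gnExp p m k) f * derivNorm (k + 2) (gnExp p m (k + 2)) f) := by
  have h : ∀ k, ∃ C : ℝ≥0∞, C ≠ ∞ ∧ (k + 2 ≤ m → ∀ f, IsTest f →
      derivNorm (k + 1) (gnExp p m (k + 1)) f ^ 2 ≤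
      C * (derivNorm k (gnExp p m k) f * derivNorm (k + 2) (gnExp p m (k + 2)) f)) := by
    intro k
    by_cases hk : k + 2 ≤ m
    · obtain ⟨C, hC, h⟩ := exists_sq_derivNorm_le hp hp' k hk
      exact ⟨C, hC, fun _ => h⟩
    · exact ⟨0, by simp, fun h => absurd h hk⟩
  choose C hC h using h
  refine ⟨1 + ∑ k ∈ Finset.range m, C k, le_self_add,
    ENNReal.add_ne_top.2 ⟨by simp, ENNReal.sum_ne_top.2 fun k _ => hC k⟩, fun f hf k hk => ?_⟩
  refine (h k hk f hf).trans ?_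
  gcongr
  exact (Finset.single_le_sum (f := C) (fun _ _ => zero_le) (Finset.mem_range.2 (by omega))).trans
    le_add_self

/-! ### Derivatives of the exponential of a function -/

/-- Differential polynomials all of whose monomials are products of derivatives of positive order,
of total order `k`. -/
inductive IsHomogeneous : ℕ → ((T2 → ℝ) → T2 → ℝ) → Prop
  | zero (k : ℕ) : IsHomogeneous k fun _ _ => 0
  | one : IsHomogeneous 0 fun _ _ => 1
  | add {k : ℕ} {P Q : (T2 → ℝ) → T2 → ℝ} : IsHomogeneous k P → IsHomogeneous k Q →
      IsHomogeneous k fun f x => P f x + Q f x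
  | neg {k : ℕ} {P : (T2 → ℝ) → T2 → ℝ} : IsHomogeneous k P → IsHomogeneous k fun f x => -P f x
  | mul {j k n a b : ℕ} {P : (T2 → ℝ) → T2 → ℝ} : IsHomogeneous j P → a + b = k → 1 ≤ k →
      j + k = n → IsHomogeneous n fun f x => P f x * pd a b f x

lemma IsHomogeneous.continuous {k : ℕ} {P : (T2 → ℝ) → T2 → ℝ} (h : IsHomogeneous k P)
    {f : T2 → ℝ} (hf : IsTest f) : Continuous (P f) := by
  induction h with
  | zero => exact continuous_const
  | one => exact continuous_const
  | add _ _ ih1 ih2 => exact ih1.add ih2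
  | neg _ ih => exact ih.neg
  | mul _ _ _ _ ih => exact ih.mul (hf.iterDeriv _ _).continuous

lemma IsHomogeneous.exists_hasPartial {k : ℕ} {P : (T2 → ℝ) → T2 → ℝ} (h : IsHomogeneous k P)
    (i : Fin 2) : ∃ Q, IsHomogeneous (k + 1) Q ∧ ∀ f, IsTest f → HasPartial i (P f) (Q f) := by
  induction h with
  | zero k => exact ⟨_, .zero _, fun f _ x => hasDerivAt_const _ _⟩
  | one => exact ⟨_, .zero _, fun f _ x => hasDerivAt_const _ _⟩
  | add _ _ ih1 ih2 =>
    obtain ⟨Q1, h1, k1⟩ := ih1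
    obtain ⟨Q2, h2, k2⟩ := ih2
    exact ⟨_, h1.add h2, fun f hf => (k1 f hf).add (k2 f hf)⟩
  | neg _ ih =>
    obtain ⟨Q, h, k⟩ := ih
    exact ⟨_, h.neg, fun f hf x => (k f hf x).neg⟩
  | @mul j k n a b P hP hab hk hn ih =>
    obtain ⟨Q, h, hQ⟩ := ih
    refine ⟨_, (h.mul hab hk (by omega)).add (hP.mul (k := k + 1)
      (a := a + if i = 0 then 1 else 0) (b := b + if i = 1 then 1 else 0) ?_ (by omega)
      (by omega)), fun f hf => ?_⟩
    · fin_cases i <;> simp <;> omega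
    · have := (hQ f hf).mul ((hf.iterDeriv a b).hasPartial i)
      rwa [hf.partialDeriv_pd] at this

/-- A derivative of order `a + b` of `e^{-f}` is `e^{-f}` times a differential polynomial in `f`
that is homogeneous of order `a + b`. -/
lemma exists_pd_exp_neg (a b : ℕ) : ∃ Q, IsHomogeneous (a + b) Q ∧ ∀ f, IsTest f →
    pd a b (fun x => Real.exp (-f x)) = fun x => Real.exp (-f x) * Q f x := by
  have step : ∀ {k : ℕ} {Q : (T2 → ℝ) → T2 → ℝ} (i : Fin 2), IsHomogeneous k Q →
      ∃ R, IsHomogeneous (k + 1) R ∧ ∀ f, IsTest f →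
        partialDeriv i (fun x => Real.exp (-f x) * Q f x) = fun x => Real.exp (-f x) * R f x := by
    intro k Q i hQ
    obtain ⟨R, hR, hQR⟩ := hQ.exists_hasPartial i
    refine ⟨_, (hQ.mul (k := 1) (a := if i = 0 then 1 else 0) (b := if i = 1 then 1 else 0)
      (by fin_cases i <;> simp) le_rfl rfl).neg.add hR, fun f hf => ?_⟩
    have h1 : HasPartial i (fun x => Real.exp (-f x)) fun x => -Real.exp (-f x) *
        pd (if i = 0 then 1 else 0) (if i = 1 then 1 else 0) f x := by
      have h2 := hf.hasPartial i
      rw [← pd_zero f, hf.partialDeriv_pd, zero_add, zero_add, pd_zero] at h2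
      exact h2.comp (F := fun y => Real.exp (-y)) (F' := fun y => -Real.exp (-y))
        fun y => ((hasDerivAt_neg y).exp).congr_deriv (by ring)
    rw [(h1.mul (hQR f hf)).partialDeriv_eq]
    ext x; ring
  induction a with
  | zero =>
    induction b with
    | zero => exact ⟨_, .one, fun f _ => by ext x; simp [pd_zero]⟩
    | succ b ih =>
      obtain ⟨Q, hQ, h⟩ := ih
      obtain ⟨R, hR, hQR⟩ := step 1 hQ
      refine ⟨R, hR, fun f hf => ?_⟩
      have ht : IsTest fun x => Real.exp (-f x) :=
        hf.comp (F := fun y => Real.exp (-y)) (Real.contDiff_exp.comp contDiff_neg)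
      rw [ht.pd_succ_right, h f hf, hQR f hf]
  | succ a ih =>
    obtain ⟨Q, hQ, h⟩ := ih
    obtain ⟨R, hR, hQR⟩ := step 0 hQ
    refine ⟨R, by convert hR using 1; omega, fun f hf => ?_⟩
    rw [pd_succ_left, h f hf, hQR f hf]

lemma eLpNorm_mul_le {f g : T2 → ℝ} (hf : AEStronglyMeasurable f torusMeasure)
    (hg : AEStronglyMeasurable g torusMeasure) {q r t : ℝ≥0∞} (h : q⁻¹ + r⁻¹ = t⁻¹) :
    eLpNorm (fun x => f x * g x) t torusMeasure ≤
      eLpNorm f q torusMeasure * eLpNorm g r torusMeasure := by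
  have : ENNReal.HolderTriple q r t := ⟨h⟩
  have := eLpNorm_smul_le_mul_eLpNorm (p := q) (q := r) (r := t) hg hf
  exact this

/-- Each monomial is bounded by Hölder's inequality and the log-convexity of the norms. The case
distinction is needed as `derivNorm 0` is the norm of `f` itself, on which a constant does not
depend. -/
lemma IsHomogeneous.exists_eLpNorm_le (hp : 1 < p) (hp' : p ≠ ∞) (hm : 1 ≤ m) {k : ℕ}
    {P : (T2 → ℝ) → T2 → ℝ} (h : IsHomogeneous k P) (hk : k ≤ m) :
    ∃ C : ℝ≥0∞, C ≠ ∞ ∧ ∀ f, IsTest f → eLpNorm (P f) (gnExp p m k) torusMeasure ≤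
      C * (1 + eLpNorm f ∞ torusMeasure) ^ k *
        if k = 0 then 1 else derivNorm k (gnExp p m k) f := by
  induction h with
  | zero => exact ⟨0, by simp, fun f _ => by simp⟩
  | one =>
    refine ⟨1, by simp, fun f _ => ?_⟩
    simpa using eLpNorm_le_of_forall_abs_le (f := fun _ => (1 : ℝ)) (C := 1) (by simp) _
  | @add k P Q hP hQ ih1 ih2 =>
    obtain ⟨C, hC, h1⟩ := ih1 hk
    obtain ⟨D, hD, h2⟩ := ih2 hk
    refine ⟨C + D, ENNReal.add_ne_top.2 ⟨hC, hD⟩, fun f hf => ?_⟩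
    refine (eLpNorm_add_le (hP.continuous hf).aestronglyMeasurable
      (hQ.continuous hf).aestronglyMeasurable (one_lt_gnExp hp hm hk).le).trans ?_
    rw [add_mul, add_mul]
    exact add_le_add (h1 f hf) (h2 f hf)
  | @neg k P hP ih =>
    obtain ⟨C, hC, h1⟩ := ih hk
    refine ⟨C, hC, fun f hf => ?_⟩
    have := eLpNorm_neg (P f) (gnExp p m k) torusMeasure
    exact this.trans_le (h1 f hf)
  | @mul j k n a b P hP hab hk1 hn ih =>
    obtain ⟨C, hC, h1⟩ := ih (by omega)
    obtain ⟨D, hD1, hD, h2⟩ := exists_forall_sq_derivNorm_le hp hp' m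
    refine ⟨C * D ^ (m * m), ENNReal.mul_ne_top hC (ENNReal.pow_ne_top hD), fun f hf => ?_⟩
    set N : ℕ → ℝ≥0∞ := fun k => derivNorm k (gnExp p m k) f with hNdef
    have hN := mul_le_zero_mul_of_sq_le (N := N) hD1 (fun k => derivNorm_ne_top hf k _) (h2 f hf)
      j k (by omega)
    have hN0 : N 0 = eLpNorm f ∞ torusMeasure := by
      simp only [hNdef, derivNorm_zero, gnExp_zero hp hm]
    rw [if_neg (by omega : n ≠ 0)]
    have hD2 : 1 ≤ D ^ (m * m) := one_le_pow₀ hD1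
    calc eLpNorm (fun x => P f x * pd a b f x) (gnExp p m n) torusMeasure
        ≤ eLpNorm (P f) (gnExp p m j) torusMeasure *
          eLpNorm (pd a b f) (gnExp p m k) torusMeasure :=
          eLpNorm_mul_le (hP.continuous hf).aestronglyMeasurable
            (hf.iterDeriv a b).continuous.aestronglyMeasurable
            (by rw [inv_gnExp_add hp hp' hm, hn])
      _ ≤ (C * (1 + N 0) ^ j * if j = 0 then 1 else N j) * N k := by
          have h3 : eLpNorm (pd a b f) (gnExp p m k) torusMeasure ≤ N k :=
            eLpNorm_pd_le_derivNorm hab _ _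
          have h4 := h1 f hf
          rw [← hN0] at h4
          exact mul_le_mul h4 h3 zero_le zero_le
      _ ≤ C * D ^ (m * m) * (1 + N 0) ^ n * N n := by
          rcases Nat.eq_zero_or_pos j with hj | hj
          · obtain rfl : k = n := by omega
            rw [if_pos hj, mul_one, hj, pow_zero, mul_one]
            gcongr
            calc C = C * 1 * 1 := by simp
              _ ≤ _ := by gcongr; exact one_le_pow₀ le_self_add
          · rw [if_neg (by omega), mul_assoc]
            calc C * (1 + N 0) ^ j * (N j * N k)
                ≤ C * (1 + N 0) ^ j * (D ^ (m * m) * (N 0 * N (j + k))) := by gcongr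
              _ ≤ C * (1 + N 0) ^ j * (D ^ (m * m) * ((1 + N 0) * N (j + k))) := by
                  gcongr; exact le_add_self
              _ = C * D ^ (m * m) * (1 + N 0) ^ (j + 1) * N n := by rw [hn]; ring
              _ ≤ _ := by
                  gcongr
                  · exact le_self_add
                  · omega
      _ = _ := by rw [hN0]

/-- **Moser's estimate** for the exponential: its derivatives of order `m` are bounded linearly by
those of the exponent. -/
theorem exists_eLpNorm_pd_exp_neg_le (hp : 1 < p) (hp' : p ≠ ∞) {a b : ℕ} (hm : 1 ≤ a + b) :
    ∃ C : ℝ≥0∞, C ≠ ∞ ∧ ∀ f, IsTest f →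
      eLpNorm (pd a b fun x => Real.exp (-f x)) p torusMeasure ≤
        C * eLpNorm (fun x => Real.exp (-f x)) ∞ torusMeasure *
          (1 + eLpNorm f ∞ torusMeasure) ^ (a + b) * derivNorm (a + b) p f := by
  obtain ⟨Q, hQ, h⟩ := exists_pd_exp_neg a b
  obtain ⟨C, hC, hle⟩ := hQ.exists_eLpNorm_le hp hp' hm le_rfl
  refine ⟨C, hC, fun f hf => ?_⟩
  have hle := hle f hf
  rw [if_neg (by omega), gnExp_self hm] at hle
  rw [h f hf]
  have hc : Continuous fun x => Real.exp (-f x) := Real.continuous_exp.comp hf.continuous.neg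
  refine (eLpNorm_mul_le (q := ∞) (r := p) hc.aestronglyMeasurable
    (hQ.continuous hf).aestronglyMeasurable (by simp)).trans ?_
  refine (mul_le_mul_right hle _).trans (le_of_eq ?_)
  ring

end GagliardoNirenberg

/-! ### Weak derivatives of the exponential of a function -/

section

lemma CauchyLp.exists_eLpNorm_le {p : ℝ≥0∞} (hp : 1 ≤ p) {U : ℕ → T2 → ℝ}
    (hU : ∀ n, MemLp (U n) p torusMeasure) (h : CauchyLp p U) :
    ∃ B : ℝ≥0∞, B ≠ ∞ ∧ ∀ n, eLpNorm (U n) p torusMeasure ≤ B := by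
  obtain ⟨g, hg, hlim⟩ := h.exists_tendsto hp hU
  have h1 := hlim.eventually_le_const one_pos
  obtain ⟨K, hK⟩ := eventually_atTop.1 h1
  refine ⟨(1 + eLpNorm g p torusMeasure) + ∑ n ∈ Finset.range K, eLpNorm (U n) p torusMeasure,
    ?_, fun n => ?_⟩
  · exact ENNReal.add_ne_top.2 ⟨ENNReal.add_ne_top.2 ⟨by simp, hg.eLpNorm_ne_top⟩,
      ENNReal.sum_ne_top.2 fun n _ => (hU n).eLpNorm_ne_top⟩
  · rcases lt_or_ge n K with hn | hn
    · exact (Finset.single_le_sum_of_canonicallyOrdered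
        (f := fun n => eLpNorm (U n) p torusMeasure) (Finset.mem_range.2 hn)).trans le_add_self
    · have e : U n = (fun x => U n x - g x) + g := by ext x; simp
      calc eLpNorm (U n) p torusMeasure = eLpNorm ((fun x => U n x - g x) + g) p torusMeasure := by
            rw [← e]
        _ ≤ eLpNorm (fun x => U n x - g x) p torusMeasure + eLpNorm g p torusMeasure :=
            eLpNorm_add_le ((hU n).1.sub hg.1) hg.1 hp
        _ ≤ 1 + eLpNorm g p torusMeasure := by gcongr; exact hK n hn
        _ ≤ _ := le_self_add

lemma CauchyLp.add {p : ℝ≥0∞} (hp : 1 ≤ p) {U V : ℕ → T2 → ℝ}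
    (hU : ∀ n, MemLp (U n) p torusMeasure) (hV : ∀ n, MemLp (V n) p torusMeasure)
    (h : CauchyLp p U) (k : CauchyLp p V) : CauchyLp p fun n x => U n x + V n x := by
  have h1 := Tendsto.add h k
  rw [add_zero] at h1
  refine tendsto_of_tendsto_of_tendsto_of_le_of_le tendsto_const_nhds h1 (fun _ => zero_le)
    fun z => ?_
  have e : (fun x => U z.1 x + V z.1 x - (U z.2 x + V z.2 x)) =
      (fun x => U z.1 x - U z.2 x) + fun x => V z.1 x - V z.2 x := by ext x; simp; ring
  simp only [e]
  exact eLpNorm_add_le ((hU _).1.sub (hU _).1) ((hV _).1.sub (hV _).1) hp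

lemma CauchyLp.neg {p : ℝ≥0∞} {U : ℕ → T2 → ℝ} (h : CauchyLp p U) :
    CauchyLp p fun n x => -U n x :=
  h.mono ENNReal.one_ne_top fun n m => by
    have e : (fun x => -U n x - -U m x) = -fun x => U n x - U m x := by ext x; simp; ring
    rw [e, eLpNorm_neg, one_mul]

lemma CauchyLp.mul {q r t : ℝ≥0∞} (hq : 1 ≤ q) (hr : 1 ≤ r) (ht : 1 ≤ t)
    (hqr : q⁻¹ + r⁻¹ = t⁻¹) {U V : ℕ → T2 → ℝ} (hU : ∀ n, MemLp (U n) q torusMeasure)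
    (hV : ∀ n, MemLp (V n) r torusMeasure) (h : CauchyLp q U) (k : CauchyLp r V) :
    CauchyLp t fun n x => U n x * V n x := by
  obtain ⟨A, hA, hUA⟩ := h.exists_eLpNorm_le hq hU
  obtain ⟨B, hB, hVB⟩ := k.exists_eLpNorm_le hr hV
  have h1 := Tendsto.add (ENNReal.Tendsto.const_mul k (Or.inr hA))
    (ENNReal.Tendsto.mul_const h (Or.inr hB))
  rw [mul_zero, zero_mul, add_zero] at h1
  refine tendsto_of_tendsto_of_tendsto_of_le_of_le tendsto_const_nhds h1 (fun _ => zero_le)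
    fun z => ?_
  have e : (fun x => U z.1 x * V z.1 x - U z.2 x * V z.2 x) =
      (fun x => U z.1 x * (V z.1 x - V z.2 x)) + fun x => (U z.1 x - U z.2 x) * V z.2 x := by
    ext x; simp; ring
  simp only [e]
  refine (eLpNorm_add_le ((hU _).1.mul ((hV _).1.sub (hV _).1))
    (((hU _).1.sub (hU _).1).mul (hV _).1) ht).trans (add_le_add ?_ ?_)
  · exact (eLpNorm_mul_le (hU _).1 ((hV _).1.sub (hV _).1) hqr).trans
      (mul_le_mul_left (hUA _) _)
  · exact (eLpNorm_mul_le ((hU _).1.sub (hU _).1) (hV _).1 hqr).trans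
      (mul_le_mul_right (hVB _) _)

/-- Fatou's lemma: an `L^p` bound passes to limits in `L^1`. -/
lemma eLpNorm_le_of_tendsto_one {p : ℝ≥0∞} {f : T2 → ℝ} {U : ℕ → T2 → ℝ}
    (hU : ∀ n, AEStronglyMeasurable (U n) torusMeasure) (hf : AEStronglyMeasurable f torusMeasure)
    (h : Tendsto (fun n => eLpNorm (fun x => U n x - f x) 1 torusMeasure) atTop (𝓝 0))
    {B : ℝ≥0∞} (hB : ∀ n, eLpNorm (U n) p torusMeasure ≤ B) : eLpNorm f p torusMeasure ≤ B := by
  obtain ⟨ns, -, hns⟩ := (tendstoInMeasure_of_tendsto_eLpNorm one_ne_zero hU hf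
    h).exists_seq_tendsto_ae
  refine (Lp.eLpNorm_lim_le_liminf_eLpNorm (fun n => hU (ns n)) f hns).trans ?_
  exact liminf_le_of_frequently_le' (Frequently.of_forall fun n => hB (ns n))

variable {p : ℝ≥0∞} {m : ℕ}

/-- If the derivatives of order `m` converge in `L^p` and the functions stay bounded, then the
derivatives of order `k` converge in `L^{pm/k}`, by interpolation. -/
lemma cauchyLp_gnExp (hp : 1 < p) (hp' : p ≠ ∞) (hm : 1 ≤ m) {U : ℕ → T2 → ℝ}
    (hU : ∀ n, IsTest (U n)) {B : ℝ≥0∞} (hB : B ≠ ∞)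
    (hUB : ∀ n l, eLpNorm (fun x => U n x - U l x) ∞ torusMeasure ≤ B)
    (h : ∀ a b, a + b = m → CauchyLp p fun n => pd a b (U n)) {a b : ℕ} (hab : 1 ≤ a + b)
    (habm : a + b ≤ m) : CauchyLp (gnExp p m (a + b)) fun n => pd a b (U n) := by
  obtain ⟨C, -, hC, hsq⟩ := exists_forall_sq_derivNorm_le hp hp' m
  have hsub : ∀ n l, IsTest fun x => U n x - U l x := fun n l => (hU n).sub (hU l)
  have key : ∀ j k : ℕ, j + k = m → 1 ≤ k →
      Tendsto (fun z : ℕ × ℕ => derivNorm k (gnExp p m k) fun x => U z.1 x - U z.2 x)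
        atTop (𝓝 0) := by
    intro j
    induction j with
    | zero =>
      rintro k hk -
      obtain rfl : k = m := by omega
      simp only [derivNorm, gnExp_self hm]
      rw [show (0 : ℝ≥0∞) = ∑ α ∈ Finset.HasAntidiagonal.antidiagonal k, 0 by simp]
      refine tendsto_finsetSum _ fun α hα => ?_
      have := h α.1 α.2 (Finset.HasAntidiagonal.mem_antidiagonal.1 hα)
      refine Tendsto.congr (fun z => ?_) this
      rw [(hU z.1).pd_sub (hU z.2)]
    | succ j ih =>
      intro k hk hk1
      have h1 := ih (k + 1) (by omega) (by omega)
      obtain ⟨D, hD, hpow⟩ := exists_pow_le_of_sq_le (m := m) hC k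
      have h2 : ∀ z : ℕ × ℕ, derivNorm k (gnExp p m k) (fun x => U z.1 x - U z.2 x) ≤
          (D * (B * derivNorm (k + 1) (gnExp p m (k + 1)) (fun x => U z.1 x - U z.2 x) ^ k)) ^
            (((k + 1 : ℕ) : ℝ)⁻¹) := by
        intro z
        have h3 := hpow (fun k => derivNorm k (gnExp p m k) fun x => U z.1 x - U z.2 x)
          (fun k => derivNorm_ne_top (hsub _ _) k _) (hsq _ (hsub _ _)) (by omega)
        rw [ENNReal.le_rpow_inv_iff (by positivity), ENNReal.rpow_natCast]
        refine h3.trans ?_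
        gcongr
        rw [derivNorm_zero, gnExp_zero hp hm]
        exact hUB _ _
      have h4 := ENNReal.Tendsto.const_mul (ENNReal.Tendsto.const_mul
        (ENNReal.Tendsto.pow (n := k) h1) (Or.inr hB)) (Or.inr hD)
      rw [zero_pow (by omega), mul_zero, mul_zero] at h4
      have h5 := (ENNReal.continuous_rpow_const (y := ((k + 1 : ℕ) : ℝ)⁻¹)).tendsto 0 |>.comp h4
      rw [ENNReal.zero_rpow_of_pos (by positivity)] at h5
      exact tendsto_of_tendsto_of_tendsto_of_le_of_le tendsto_const_nhds h5 (fun _ => zero_le) h2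
  obtain ⟨j, hj⟩ := Nat.exists_eq_add_of_le' habm
  refine tendsto_of_tendsto_of_tendsto_of_le_of_le tendsto_const_nhds
    (key j (a + b) hj.symm hab) (fun _ => zero_le) fun z => ?_
  have := eLpNorm_pd_le_derivNorm (rfl : a + b = a + b) (gnExp p m (a + b))
    (fun x => U z.1 x - U z.2 x)
  rwa [(hU z.1).pd_sub (hU z.2)] at this

/-- Differential polynomials are continuous with respect to convergence of the derivatives. -/
lemma IsHomogeneous.cauchyLp (hp : 1 < p) (hp' : p ≠ ∞) (hm : 1 ≤ m) {k : ℕ}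
    {P : (T2 → ℝ) → T2 → ℝ} (h : IsHomogeneous k P) (hk : k ≤ m) {U : ℕ → T2 → ℝ}
    (hU : ∀ n, IsTest (U n))
    (hc : ∀ a b, 1 ≤ a + b → a + b ≤ m → CauchyLp (gnExp p m (a + b)) fun n => pd a b (U n)) :
    CauchyLp (gnExp p m k) fun n => P (U n) := by
  have hmem : ∀ {k : ℕ} {P : (T2 → ℝ) → T2 → ℝ}, IsHomogeneous k P → ∀ r n,
      MemLp (P (U n)) r torusMeasure := fun h r n => memLp_of_continuous (h.continuous (hU n)) r
  induction h with
  | zero => simp [CauchyLp]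
  | one => simp [CauchyLp]
  | add hP hQ ih1 ih2 =>
    exact (ih1 hk).add (one_lt_gnExp hp hm hk).le (hmem hP _) (hmem hQ _) (ih2 hk)
  | neg _ ih => exact (ih hk).neg
  | @mul j k n a b P hP hab hk1 hn ih =>
    subst hab
    exact (ih (by omega)).mul (one_lt_gnExp hp hm (by omega)).le
      (one_lt_gnExp hp hm (by omega)).le (one_lt_gnExp hp hm hk).le
      (by rw [inv_gnExp_add hp hp' hm, hn]) (hmem hP _)
      (fun n => ((hU n).iterDeriv a b).memLp _) (hc a b hk1 (by omega))

lemma abs_exp_neg_sub_le {M x y : ℝ} (hx : |x| ≤ M) (hy : |y| ≤ M) :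
    |Real.exp (-x) - Real.exp (-y)| ≤ Real.exp M * |x - y| := by
  have key : ∀ x y : ℝ, |x| ≤ M → x ≤ y →
      Real.exp (-x) - Real.exp (-y) ≤ Real.exp M * (y - x) := by
    intro x y hx hxy
    have h1 : Real.exp (-y) = Real.exp (-x) * Real.exp (x - y) := by
      rw [← Real.exp_add]; ring_nf
    have h2 := Real.add_one_le_exp (x - y)
    have h3 : Real.exp (-x) ≤ Real.exp M := Real.exp_le_exp.2 (by linarith [(abs_le.1 hx).1])
    have h4 := Real.exp_pos (-x)
    calc Real.exp (-x) - Real.exp (-y) = Real.exp (-x) * (1 - Real.exp (x - y)) := by rw [h1]; ring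
      _ ≤ Real.exp (-x) * (y - x) := mul_le_mul_of_nonneg_left (by linarith) h4.le
      _ ≤ _ := mul_le_mul_of_nonneg_right h3 (by linarith)
  rcases le_total x y with h | h
  · rw [abs_of_nonneg (by simpa using h), abs_of_nonpos (by linarith)]
    simpa using key x y hx h
  · rw [abs_sub_comm, abs_sub_comm x, abs_of_nonneg (by simpa using h),
      abs_of_nonpos (by linarith)]
    simpa using key y x hy h

lemma eLpNorm_exp_neg_sub_le {f g : T2 → ℝ} {M : ℝ} (hf : ∀ᵐ x ∂torusMeasure, |f x| ≤ M)
    (hg : ∀ᵐ x ∂torusMeasure, |g x| ≤ M) (p : ℝ≥0∞) :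
    eLpNorm (fun x => Real.exp (-f x) - Real.exp (-g x)) p torusMeasure ≤
      ENNReal.ofReal (Real.exp M) * eLpNorm (fun x => f x - g x) p torusMeasure := by
  refine eLpNorm_le_mul_eLpNorm_of_ae_le_mul ?_ p
  filter_upwards [hf, hg] with x h1 h2
  exact abs_exp_neg_sub_le h1 h2

lemma IsTest.exp_neg {f : T2 → ℝ} (hf : IsTest f) : IsTest fun x => Real.exp (-f x) :=
  hf.comp (F := fun y => Real.exp (-y)) (Real.contDiff_exp.comp contDiff_neg)

/-- The derivatives of `e^{-U n}` converge in `L^1` only, which suffices to identify the weak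
derivative of the limit; the `L^p` bound passes to the limit by Fatou's lemma. -/
lemma cauchyLp_pd_exp_neg (hp : 1 < p) (hp' : p ≠ ∞) {a b : ℕ} (hm : 1 ≤ a + b)
    {U : ℕ → T2 → ℝ} (hU : ∀ n, IsTest (U n)) {M : ℝ} (hM : ∀ n x, |U n x| ≤ M)
    (h0 : ∀ r, 1 ≤ r → r ≠ ∞ → CauchyLp r U)
    (h : ∀ c d, c + d = a + b → CauchyLp p fun n => pd c d (U n)) :
    CauchyLp 1 fun n => pd a b fun x => Real.exp (-U n x) := by
  obtain ⟨Q, hQ, hQe⟩ := exists_pd_exp_neg a b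
  simp only [fun n => hQe (U n) (hU n)]
  have hc := hQ.cauchyLp hp hp' hm le_rfl hU fun c d h1 h2 =>
    cauchyLp_gnExp hp hp' hm hU (B := ENNReal.ofReal (2 * M)) ENNReal.ofReal_ne_top
      (fun n l => eLpNorm_le_of_forall_abs_le (fun x => by
        have := abs_sub (U n x) (U l x); linarith [hM n x, hM l x]) _) h h1 h2
  rw [gnExp_self hm] at hc
  obtain ⟨q, hq, hq', hqp⟩ : ∃ q : ℝ≥0∞, 1 ≤ q ∧ q ≠ ∞ ∧ q⁻¹ + p⁻¹ = 1 := by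
    have hlt : p⁻¹ < 1 := ENNReal.inv_lt_one.2 hp
    refine ⟨(1 - p⁻¹)⁻¹, ENNReal.one_le_inv.2 tsub_le_self,
      ENNReal.inv_ne_top.2 (tsub_pos_of_lt hlt).ne', ?_⟩
    rw [inv_inv, tsub_add_cancel_of_le hlt.le]
  have hexp : CauchyLp q fun n x => Real.exp (-U n x) :=
    (h0 q hq hq').mono (C := ENNReal.ofReal (Real.exp M)) ENNReal.ofReal_ne_top fun n l =>
      eLpNorm_exp_neg_sub_le (Eventually.of_forall (hM n)) (Eventually.of_forall (hM l)) q
  exact hexp.mul hq hp.le le_rfl (by rw [hqp, inv_one]) (fun n => (hU n).exp_neg.memLp q)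
    (fun n => memLp_of_continuous (hQ.continuous (hU n)) p) hc

lemma ae_abs_le_of_memLp_top {f : T2 → ℝ} (hf : MemLp f ∞ torusMeasure) :
    ∀ᵐ x ∂torusMeasure, |f x| ≤ (eLpNorm f ∞ torusMeasure).toReal := by
  filter_upwards [ae_le_eLpNormEssSup (f := f) (μ := torusMeasure)] with x hx
  rw [← eLpNorm_exponent_top] at hx
  exact (toReal_enorm (f x)).symm.le.trans (ENNReal.toReal_mono hf.eLpNorm_ne_top hx)

/-- Moser's estimate for weak derivatives: if `φ` is bounded and its weak derivatives of order `m`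
are in `L^p`, so are those of `e^{-φ}`. -/
theorem exists_hasWeakPartial_exp_neg (hp : 1 < p) (hp' : p ≠ ∞) {a b : ℕ} (hm : 1 ≤ a + b) :
    ∃ C : ℝ≥0∞, C ≠ ∞ ∧ ∀ φ : T2 → ℝ, MemLp φ ∞ torusMeasure →
      (∀ c d, c + d = a + b → ∃ g, HasWeakPartial c d φ g ∧ MemLp g p torusMeasure) →
      ∃ g, HasWeakPartial a b (fun x => Real.exp (-φ x)) g ∧ eLpNorm g p torusMeasure ≤
        C * eLpNorm (fun x => Real.exp (-φ x)) ∞ torusMeasure *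
          (1 + eLpNorm φ ∞ torusMeasure) ^ (a + b) * gradNorm (a + b) p φ := by
  obtain ⟨C, hC, hMoser⟩ := exists_eLpNorm_pd_exp_neg_le hp hp' hm
  refine ⟨C, hC, fun φ hφ hg => ?_⟩
  have hφ1 : Integrable φ torusMeasure := hφ.integrable le_top
  set U : ℕ → T2 → ℝ := fun N => fejer N φ with hUdef
  have hU : ∀ N, IsTest (U N) := fun N => isTest_fejer N hφ1
  set M := (eLpNorm φ ∞ torusMeasure).toReal with hM
  have hφM : ∀ᵐ x ∂torusMeasure, |φ x| ≤ M := ae_abs_le_of_memLp_top hφ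
  have hUM : ∀ N x, |U N x| ≤ M := fun N x => abs_fejer_le N hφ1 hφM x
  have hM' : ENNReal.ofReal M = eLpNorm φ ∞ torusMeasure := ENNReal.ofReal_toReal hφ.eLpNorm_ne_top
  set E := (eLpNorm (fun x => Real.exp (-φ x)) ∞ torusMeasure) with hE
  have hum : AEStronglyMeasurable (fun x => Real.exp (-φ x)) torusMeasure :=
    Real.continuous_exp.comp_aestronglyMeasurable hφ.1.neg
  have huM : ∀ᵐ x ∂torusMeasure, ‖Real.exp (-φ x)‖ ≤ Real.exp M := by
    filter_upwards [hφM] with x hx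
    rw [Real.norm_of_nonneg (Real.exp_nonneg _)]
    exact Real.exp_le_exp.2 (by linarith [(abs_le.1 hx).1])
  have hu : MemLp (fun x => Real.exp (-φ x)) ∞ torusMeasure := memLp_top_of_bound hum _ huM
  have hu1 : Integrable (fun x => Real.exp (-φ x)) torusMeasure := hu.integrable le_top
  -- Fejér means are averages, so they inherit the lower bound of `φ`
  have hUE : ∀ N, eLpNorm (fun x => Real.exp (-U N x)) ∞ torusMeasure ≤ E := by
    intro N
    have huE : ∀ᵐ x ∂torusMeasure, Real.exp (-φ x) ≤ E.toReal :=
      (ae_abs_le_of_memLp_top hu).mono fun x hx => (le_abs_self _).trans hx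
    have hE0 : 0 < E.toReal := by
      obtain ⟨x, hx⟩ := huE.exists
      exact (Real.exp_pos _).trans_le hx
    have h1 := const_le_fejer N hφ1 (c := -Real.log E.toReal) (huE.mono fun x hx => by
      have := (Real.le_log_iff_exp_le hE0).2 hx
      linarith)
    refine le_of_le_of_eq ?_ (ENNReal.ofReal_toReal hu.eLpNorm_ne_top)
    refine eLpNorm_le_of_forall_abs_le (fun x => ?_) _
    rw [abs_of_nonneg (Real.exp_nonneg _), ← Real.le_log_iff_exp_le hE0]
    linarith [h1 x]
  have hc0 : ∀ r, 1 ≤ r → r ≠ ∞ → CauchyLp r U := fun r hr hr' =>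
    cauchyLp_of_tendsto hr (fun N => (hU N).memLp r) (hφ.mono_exponent le_top)
      (tendsto_eLpNorm_fejer_sub hr hr' (hφ.mono_exponent le_top))
  have hcm : ∀ c d, c + d = a + b → CauchyLp p fun N => pd c d (U N) := fun c d hcd => by
    obtain ⟨g, h1, h2⟩ := hg c d hcd
    exact h1.cauchyLp hp.le hp' h2
  have hgrad : ∀ N, derivNorm (a + b) p (U N) ≤ gradNorm (a + b) p φ := fun N => by
    unfold derivNorm gradNorm
    refine Finset.sum_le_sum fun α hα => ?_
    obtain ⟨g, h1, h2⟩ := hg α.1 α.2 (Finset.HasAntidiagonal.mem_antidiagonal.1 hα)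
    rw [weakPartialNorm_eq h1, hUdef, h1.pd_fejer]
    exact eLpNorm_fejer_le N h2.1 hp.le hp'
  have hV : ∀ N, IsTest fun x => Real.exp (-U N x) := fun N => (hU N).exp_neg
  obtain ⟨g, hg1, hlim⟩ := (cauchyLp_pd_exp_neg hp hp' hm hU hUM hc0 hcm).exists_tendsto le_rfl
    fun N => ((hV N).iterDeriv a b).memLp 1
  refine ⟨g, hasWeakPartial_of_tendsto hu1 (hg1.integrable le_rfl) hV ?_ hlim, ?_⟩
  · have h1 := ENNReal.Tendsto.const_mul (tendsto_eLpNorm_fejer_sub le_rfl ENNReal.one_ne_top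
      (memLp_one_iff_integrable.2 hφ1)) (Or.inr (ENNReal.ofReal_ne_top (r := Real.exp M)))
    rw [mul_zero] at h1
    exact tendsto_of_tendsto_of_tendsto_of_le_of_le tendsto_const_nhds h1 (fun _ => zero_le)
      fun N => eLpNorm_exp_neg_sub_le (Eventually.of_forall (hUM N)) hφM 1
  · refine eLpNorm_le_of_tendsto_one
      (fun N => ((hV N).iterDeriv a b).continuous.aestronglyMeasurable) hg1.1 hlim fun N => ?_
    refine (hMoser (U N) (hU N)).trans ?_
    gcongr
    · exact hUE N
    · rw [← hM']
      exact eLpNorm_le_of_forall_abs_le (hUM N) _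
    · exact hgrad N

end

/-! ### Elliptic regularity -/

section

/-- Trigonometric polynomials. -/
def IsTrig (f : T2 → ℝ) : Prop := ∃ S c, f = trig S c

lemma trig_mono {S S' : Finset (Fin 2 → ℤ)} (h : S ⊆ S') (c : (Fin 2 → ℤ) → ℂ) :
    trig S c = trig S' fun n => if n ∈ S then c n else 0 := by
  ext x
  simp only [trig, ite_mul, zero_mul]
  rw [← Finset.sum_filter, Finset.filter_mem_eq_inter, Finset.inter_eq_right.2 h]

lemma IsTrig.sub {f g : T2 → ℝ} (hf : IsTrig f) (hg : IsTrig g) : IsTrig fun x => f x - g x := by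
  obtain ⟨S, c, rfl⟩ := hf
  obtain ⟨S', d, rfl⟩ := hg
  rw [trig_mono (Finset.subset_union_left : S ⊆ S ∪ S') c,
    trig_mono (Finset.subset_union_right : S' ⊆ S ∪ S') d]
  exact ⟨_, _, funext fun x => trig_sub x⟩

lemma IsTrig.iterDeriv {f : T2 → ℝ} (hf : IsTrig f) (a b : ℕ) : IsTrig (pd a b f) := by
  obtain ⟨S, c, rfl⟩ := hf
  exact ⟨_, _, pd_trig a b⟩

lemma isTrig_fejer {f : T2 → ℝ} (hf : Integrable f torusMeasure) (N : ℕ) : IsTrig (fejer N f) :=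
  ⟨_, _, fejer_eq_trig N hf⟩

lemma IsTest.pd_lap {f : T2 → ℝ} (hf : IsTest f) (a b : ℕ) :
    pd a b (PoissonBoltzmann.lap f) = PoissonBoltzmann.lap (pd a b f) := by
  induction a with
  | zero =>
    induction b with
    | zero => rfl
    | succ b ih =>
      rw [hf.lap.pd_succ_right, ih, (hf.iterDeriv 0 b).partialDeriv_lap, ← hf.pd_succ_right]
  | succ a ih =>
    rw [pd_succ_left, ih, (hf.iterDeriv a b).partialDeriv_lap, ← pd_succ_left]

lemma lap_sub {f g : T2 → ℝ} (hf : IsTest f) (hg : IsTest g) :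
    lap (fun x => f x - g x) = fun x => lap f x - lap g x := by
  ext x
  simp only [lap, partialDeriv_sub hf hg, partialDeriv_sub (hf.pderiv _) (hg.pderiv _)]
  ring

/-- `r` is the weak Laplacian of `f`. The identity is required for all Fejér means, which amounts to
testing with trigonometric polynomials only. -/
structure HasWeakLap (f r : T2 → ℝ) : Prop where
  integrable : Integrable f torusMeasure
  integrable_lap : Integrable r torusMeasure
  lap_fejer : ∀ N, lap (fejer N f) = fejer N r

variable {p : ℝ≥0∞} {f r : T2 → ℝ}

/-- Regularity of the Poisson equation in `L^p`, for derivatives of any order. -/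
lemma exists_hasWeakPartial_of_hasWeakLap (hp : 1 < p) (hp' : p ≠ ∞) :
    ∃ C : ℝ≥0∞, C ≠ ∞ ∧ ∀ f r, HasWeakLap f r → ∀ a b g, HasWeakPartial a b r g →
      MemLp g p torusMeasure → ∀ c d, c + d = 2 →
      ∃ g', HasWeakPartial (c + a) (d + b) f g' ∧ MemLp g' p torusMeasure ∧
        eLpNorm g' p torusMeasure ≤ C * eLpNorm g p torusMeasure := by
  obtain ⟨C, hC, hCZ⟩ := exists_eLpNorm_second_le hp hp'
  refine ⟨C, hC, fun f r hfr a b g hg hgp c d hcd => ?_⟩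
  have hCZ' : ∀ h, IsTrig h → IsTest h → eLpNorm (pd c d h) p torusMeasure ≤
      C * eLpNorm (lap h) p torusMeasure := by
    rintro h ⟨S, e, rfl⟩ ht
    have : c ≤ 2 := by omega
    interval_cases c
    · obtain rfl : d = 2 := by omega
      exact hCZ S e 1 1
    · obtain rfl : d = 1 := by omega
      exact hCZ S e 0 1
    · obtain rfl : d = 0 := by omega
      exact hCZ S e 0 0
  have ht : ∀ N, IsTest (fejer N f) := fun N => isTest_fejer N hfr.integrable
  have htr := fun N => isTrig_fejer hfr.integrable N
  have hlap : ∀ N, lap (pd a b (fejer N f)) = fejer N g := fun N => by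
    rw [← (ht N).pd_lap, hfr.lap_fejer, hg.pd_fejer]
  have hc : CauchyLp p fun N => fejer N g :=
    cauchyLp_of_tendsto hp.le (fun N => (isTest_fejer N hg.2.1).memLp p) hgp
      (tendsto_eLpNorm_fejer_sub hp.le hp' hgp)
  have hc2 : CauchyLp p fun N => pd (c + a) (d + b) (fejer N f) := by
    refine hc.mono hC fun n m => ?_
    have h1 := hCZ' _ (((htr n).iterDeriv a b).sub ((htr m).iterDeriv a b))
      (((ht n).iterDeriv a b).sub ((ht m).iterDeriv a b))
    rwa [((ht n).iterDeriv a b).pd_sub ((ht m).iterDeriv a b), (ht n).pd_pd, (ht m).pd_pd,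
      lap_sub ((ht n).iterDeriv a b) ((ht m).iterDeriv a b), hlap, hlap] at h1
  obtain ⟨g', h1, h2⟩ := exists_hasWeakPartial_of_cauchyLp hp.le hfr.integrable hc2
  refine ⟨g', h1, h2, ?_⟩
  refine eLpNorm_le_of_tendsto_one (U := fun N => fejer N g')
    (fun N => (isTest_fejer N h1.2.1).continuous.aestronglyMeasurable) h2.1
    (tendsto_eLpNorm_fejer_sub le_rfl ENNReal.one_ne_top (memLp_one_iff_integrable.2 h1.2.1))
    fun N => ?_
  have h3 := hCZ' _ ((htr N).iterDeriv a b) ((ht N).iterDeriv a b)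
  rw [(ht N).pd_pd, hlap, h1.pd_fejer] at h3
  exact h3.trans (mul_le_mul_right (eLpNorm_fejer_le N hg.2.1.1 hp.le hp') C)

/-- Intermediate derivatives have mean zero on lines, so that they are controlled by those of the
next order. -/
lemma exists_hasWeakPartial_of_succ (hp : 1 ≤ p) (hp' : p ≠ ∞) (hf : Integrable f torusMeasure)
    {a b : ℕ} (hab : 1 ≤ a + b)
    (h : ∀ c d, c + d = a + b + 1 → ∃ g, HasWeakPartial c d f g ∧ MemLp g p torusMeasure) :
    ∃ g, HasWeakPartial a b f g ∧ MemLp g p torusMeasure := by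
  have ht : ∀ N, IsTest (fejer N f) := fun N => isTest_fejer N hf
  refine exists_hasWeakPartial_of_cauchyLp hp hf ?_
  have key : ∀ {i : Fin 2} {h : T2 → ℝ}, IsTest h →
      eLpNorm (partialDeriv i h) p torusMeasure ≤
        eLpNorm (partialDeriv i (partialDeriv i h)) p torusMeasure := fun {i h} hh =>
    (hh.hasPartial i).eLpNorm_le_eLpNorm_partial ((hh.pderiv i).hasPartial i)
      (hh.pderiv i).continuous ((hh.pderiv i).pderiv i).continuous hp hp'
  rcases a with _ | a
  · obtain ⟨b, rfl⟩ : ∃ k, b = k + 1 := ⟨b - 1, by omega⟩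
    obtain ⟨g, h1, h2⟩ := h 0 (b + 1 + 1) (by omega)
    refine (h1.cauchyLp hp hp' h2).mono ENNReal.one_ne_top fun n m => ?_
    have hs := (ht n).sub (ht m)
    rw [← (ht n).pd_sub (ht m), ← (ht n).pd_sub (ht m), hs.pd_succ_right, hs.pd_succ_right,
      hs.pd_succ_right, one_mul]
    exact key (hs.iterDeriv 0 b)
  · obtain ⟨g, h1, h2⟩ := h (a + 1 + 1) b (by omega)
    refine (h1.cauchyLp hp hp' h2).mono ENNReal.one_ne_top fun n m => ?_
    have hs := (ht n).sub (ht m)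
    rw [← (ht n).pd_sub (ht m), ← (ht n).pd_sub (ht m), pd_succ_left, pd_succ_left, pd_succ_left,
      one_mul]
    exact key (hs.iterDeriv a b)

lemma hasWeakPartial_zero (hf : Integrable f torusMeasure) : HasWeakPartial 0 0 f f :=
  ⟨hf, hf, fun ψ _ => by simp⟩

/-- In two dimensions `W^{2,1}` embeds into `L^∞`. -/
lemma eLpNorm_top_le_sobolevNorm (hf : Integrable f torusMeasure)
    (h : ∀ a b, a + b ≤ 2 → ∃ g, HasWeakPartial a b f g) {q : ℝ≥0∞} (hq : 1 ≤ q) :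
    eLpNorm f ∞ torusMeasure ≤ sobolevNorm 2 q f := by
  have ht : ∀ N, IsTest (fejer N f) := fun N => isTest_fejer N hf
  have h1 : ∀ N a b, a + b ≤ 2 →
      eLpNorm (pd a b (fejer N f)) 1 torusMeasure ≤ weakPartialNorm a b q f := by
    intro N a b hab
    obtain ⟨g, hg⟩ := h a b hab
    rw [hg.pd_fejer, weakPartialNorm_eq hg]
    exact (eLpNorm_fejer_le N hg.2.1.1 le_rfl ENNReal.one_ne_top).trans
      (eLpNorm_le_eLpNorm_of_exponent_le hq hg.2.1.1)
  have h2 : weakPartialNorm 0 0 q f + weakPartialNorm 0 1 q f +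
      (weakPartialNorm 1 0 q f + weakPartialNorm 1 1 q f) ≤ sobolevNorm 2 q f := by
    have e : sobolevNorm 2 q f = weakPartialNorm 0 0 q f + weakPartialNorm 0 1 q f +
      (weakPartialNorm 1 0 q f + weakPartialNorm 1 1 q f) +
      (weakPartialNorm 0 2 q f + weakPartialNorm 2 0 q f) := by
      simp only [sobolevNorm, gradNorm, Finset.sum_range_succ, Finset.range_zero, Finset.sum_empty]
      simp only [Finset.Nat.antidiagonal_succ, Finset.sum_cons,
        Finset.Nat.antidiagonal_zero, Finset.sum_singleton, zero_add, Finset.map_cons,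
        Finset.map_singleton]
      simp
      ring
    rw [e]; exact le_self_add
  refine eLpNorm_le_of_tendsto_one (U := fun N => fejer N f)
    (fun N => (ht N).continuous.aestronglyMeasurable) hf.1
    (tendsto_eLpNorm_fejer_sub le_rfl ENNReal.one_ne_top (memLp_one_iff_integrable.2 hf))
    fun N => le_trans ?_ h2
  rw [eLpNorm_exponent_top]
  refine eLpNormEssSup_le_of_ae_enorm_bound (Eventually.of_forall fun x => ?_)
  refine ((ht N).enorm_le_eLpNorm_one x).trans ?_
  gcongr
  · exact h1 N 0 0 (by norm_num)
  · exact h1 N 0 1 (by norm_num)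
  · exact h1 N 1 0 (by norm_num)
  · exact h1 N 1 1 (by norm_num)

/-! ### Monotone test functions -/

/-- Testing the weak Laplacian of `f` against a decreasing function of `f`. The sign is clear for
Fejér means, and survives the limit without any bound on `f` or on its gradient. -/
lemma HasWeakLap.integral_mul_comp_nonneg (hfr : HasWeakLap f r) {h : ℝ → ℝ}
    (hh : ContDiff ℝ ((⊤ : ℕ∞) : WithTop ℕ∞) h) (hanti : Antitone h) {B : ℝ}
    (hB : ∀ y, |h y| ≤ B) : 0 ≤ ∫ x, r x * h (f x) ∂torusMeasure := by
  have ht : ∀ N, IsTest (fejer N f) := fun N => isTest_fejer N hfr.integrable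
  have hr := hfr.integrable_lap
  have hhc := hh.continuous
  have hB0 : 0 ≤ B := (abs_nonneg _).trans (hB 0)
  have hN : ∀ N, 0 ≤ ∫ x, fejer N r x * h (fejer N f x) ∂torusMeasure := by
    intro N
    have hd : ∀ y, HasDerivAt h (deriv h y) y := fun y =>
      (hh.differentiable (by simp) y).hasDerivAt
    have hd0 : ∀ y, deriv h y ≤ 0 := fun y => hanti.deriv_nonpos
    have htc : IsTest fun x => h (fejer N f x) := (ht N).comp hh
    have hpart : ∀ i, partialDeriv i (fun x => h (fejer N f x)) =
        fun x => deriv h (fejer N f x) * partialDeriv i (fejer N f) x := fun i =>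
      (((ht N).hasPartial i).comp hd).partialDeriv_eq
    have hi : ∀ i, ∫ x, h (fejer N f x) * partialDeriv i (partialDeriv i (fejer N f)) x
        ∂torusMeasure = -∫ x, deriv h (fejer N f x) * partialDeriv i (fejer N f) x ^ 2
          ∂torusMeasure := fun i => by
      rw [htc.integral_mul_partialDeriv ((ht N).pderiv i), hpart]
      simp only [sq, mul_assoc]
    have hi0 : ∀ i, 0 ≤ ∫ x, h (fejer N f x) * partialDeriv i (partialDeriv i (fejer N f)) x
        ∂torusMeasure := fun i => by
      rw [hi, neg_nonneg]
      exact integral_nonpos fun x => mul_nonpos_of_nonpos_of_nonneg (hd0 _) (sq_nonneg _)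
    rw [← hfr.lap_fejer]
    have e : (fun x => lap (fejer N f) x * h (fejer N f x)) = fun x =>
        h (fejer N f x) * partialDeriv 0 (partialDeriv 0 (fejer N f)) x +
        h (fejer N f x) * partialDeriv 1 (partialDeriv 1 (fejer N f)) x := by
      ext x; simp only [lap]; ring
    rw [e, integral_add (htc.mul (((ht N).pderiv 0).pderiv 0)).integrable
      (htc.mul (((ht N).pderiv 1).pderiv 1)).integrable]
    exact add_nonneg (hi0 0) (hi0 1)
  have hlim1 := tendsto_eLpNorm_fejer_sub le_rfl ENNReal.one_ne_top
    (memLp_one_iff_integrable.2 hfr.integrable)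
  obtain ⟨ns, hns, hae⟩ := (tendstoInMeasure_of_tendsto_eLpNorm one_ne_zero
    (fun N => (ht N).continuous.aestronglyMeasurable) hfr.integrable.1
    hlim1).exists_seq_tendsto_ae
  have hhm : ∀ k, AEStronglyMeasurable (fun x => h (fejer (ns k) f x)) torusMeasure := fun k =>
    (hhc.comp (ht _).continuous).aestronglyMeasurable
  have hi1 : ∀ k, Integrable (fun x => r x * h (fejer (ns k) f x)) torusMeasure := fun k =>
    hr.mul_bdd (c := B) (hhm k) (Eventually.of_forall fun x => hB _)
  have hi2 : ∀ k, Integrable (fun x => fejer (ns k) r x * h (fejer (ns k) f x)) torusMeasure :=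
    fun k => (isTest_fejer _ hr).integrable.mul_bdd (c := B) (hhm k)
      (Eventually.of_forall fun x => hB _)
  have l1 : Tendsto (fun k => ∫ x, r x * h (fejer (ns k) f x) ∂torusMeasure) atTop
      (𝓝 (∫ x, r x * h (f x) ∂torusMeasure)) := by
    refine tendsto_integral_of_dominated_convergence (fun x => |r x| * B)
      (fun k => (hi1 k).1) (hr.abs.mul_const B) (fun k => Eventually.of_forall fun x => ?_) ?_
    · rw [norm_mul]; exact mul_le_mul_of_nonneg_left (hB _) (norm_nonneg _)
    · filter_upwards [hae] with x hx
      exact ((hhc.tendsto _).comp hx).const_mul _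
  have l2 : Tendsto (fun k => ∫ x, fejer (ns k) r x * h (fejer (ns k) f x) ∂torusMeasure -
      ∫ x, r x * h (fejer (ns k) f x) ∂torusMeasure) atTop (𝓝 0) := by
    have h0 := (tendsto_eLpNorm_fejer_sub le_rfl ENNReal.one_ne_top
      (memLp_one_iff_integrable.2 hr)).comp hns.tendsto_atTop
    have h1 := ((ENNReal.continuousAt_toReal ENNReal.zero_ne_top).tendsto.comp h0).mul_const B
    simp only [ENNReal.toReal_zero, zero_mul] at h1
    refine squeeze_zero_norm (fun k => ?_) h1
    have hd : Integrable (fun x => fejer (ns k) r x - r x) torusMeasure :=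
      (isTest_fejer _ hr).integrable.sub hr
    rw [← integral_sub (hi2 k) (hi1 k)]
    calc _ ≤ ∫ x, ‖fejer (ns k) r x - r x‖ * B ∂torusMeasure := by
          refine norm_integral_le_of_norm_le (hd.norm.mul_const B)
            (Eventually.of_forall fun x => ?_)
          rw [← sub_mul, norm_mul]
          exact mul_le_mul_of_nonneg_left (hB _) (norm_nonneg _)
      _ = _ := by
          rw [integral_mul_const, integral_norm_eq_lintegral_enorm hd.1,
            ← eLpNorm_one_eq_lintegral_enorm]
          rfl
  have l3 := l2.add l1
  simp only [sub_add_cancel, zero_add] at l3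
  exact ge_of_tendsto l3 (Eventually.of_forall fun k => hN _)

end

/-! ### Basic bounds for the Poisson–Boltzmann equation -/

lemma integrable_mul_of_continuous {f g : T2 → ℝ} (hf : Integrable f torusMeasure)
    (hg : Continuous g) : Integrable (fun x => f x * g x) torusMeasure := by
  obtain ⟨C, hC⟩ := (isCompact_univ (X := T2)).exists_bound_of_continuousOn hg.continuousOn
  exact hf.mul_bdd hg.aestronglyMeasurable (Eventually.of_forall fun x => hC x (mem_univ x))

/-- The weak Laplacian defined by all test functions is one in the sense of `HasWeakLap`. -/
lemma hasWeakLap_of_forall {f r : T2 → ℝ} (hf : Integrable f torusMeasure)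
    (hr : Integrable r torusMeasure)
    (h : ∀ ψ, IsTest ψ → ∫ x, f x * lap ψ x ∂torusMeasure = ∫ x, r x * ψ x ∂torusMeasure) :
    HasWeakLap f r := by
  refine ⟨hf, hr, fun N => ?_⟩
  ext x
  set c : (Fin 2 → ℤ) → ℂ := fun n => fejerCoef N n
  have h1 := h _ (isTest_trig (fejerSupp N) fun n => conj (c n * mFourier n x))
  have e1 : ∀ y, lap (trig (fejerSupp N) fun n => conj (c n * mFourier n x)) y =
      trig (fejerSupp N) (fun n => eig n * c n) (x - y) := fun y => by
    rw [lap_trig, trig_sub_apply]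
    congr 1; ext n
    simp only [map_mul, Complex.conj_ofReal, mul_assoc]
  simp only [e1, ← trig_sub_apply] at h1
  have h2 : conv (trig (fejerSupp N) fun n => eig n * c n) f x = fejer N r x := by
    refine Eq.trans ?_ (h1.trans ?_)
    · simp only [conv, mul_comm (f _)]
    · simp only [fejer, conv, mul_comm (r _)]; rfl
  rw [← h2, fejer_eq_trig N hf, lap_trig, conv_trig hf]
  simp only [mul_assoc, c]

/-- Weak derivatives of the right hand side of the Poisson equation, where `c = δ⁻²`. -/
lemma HasWeakPartial.sub_const_mul {a b : ℕ} {f g f' g' : T2 → ℝ}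
    (hf : HasWeakPartial a b f f') (hg : HasWeakPartial a b g g') (c : ℝ) :
    HasWeakPartial a b (fun x => c * (f x - g x)) fun x => c * (f' x - g' x) := by
  refine ⟨(hf.1.sub hg.1).const_mul c, (hf.2.1.sub hg.2.1).const_mul c, fun ψ hψ => ?_⟩
  have hψ' : Continuous ((partialDeriv 0)^[a] ((partialDeriv 1)^[b] ψ)) :=
    (hψ.iterDeriv a b).continuous
  simp only [mul_assoc, sub_mul, integral_const_mul]
  rw [integral_sub (integrable_mul_of_continuous hf.1 hψ')
      (integrable_mul_of_continuous hg.1 hψ'), integral_sub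
      (integrable_mul_of_continuous hf.2.1 hψ.continuous)
      (integrable_mul_of_continuous hg.2.1 hψ.continuous), hf.2.2 ψ hψ, hg.2.2 ψ hψ]
  ring

namespace IsWeakSolution

variable {δ : ℝ} {ρ φ : T2 → ℝ}

lemma integrable (hs : IsWeakSolution δ ρ φ) : Integrable φ torusMeasure := by
  obtain ⟨g, hg, -⟩ := hs.memSobolev 0 0 (by norm_num)
  exact hg.1

lemma hasWeakLap (hs : IsWeakSolution δ ρ φ) (hδ : 0 < δ) (hρ : Integrable ρ torusMeasure) :
    HasWeakLap φ fun x => (δ ^ 2)⁻¹ * (ρ x - Real.exp (-φ x)) := by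
  refine hasWeakLap_of_forall hs.integrable ((hρ.sub hs.integrable_exp).const_mul _)
    fun ψ hψ => ?_
  obtain ⟨G₀, G₁, h0, h1, heq⟩ := hs.weak_eq
  have k0 := h0.2.2 _ (hψ.pderiv 0)
  have k1 := h1.2.2 _ (hψ.pderiv 1)
  simp only [Function.iterate_zero, id, Function.iterate_succ,
    Function.comp_apply] at k0 k1
  have heq := heq ψ hψ
  rw [integral_add (integrable_mul_of_continuous h0.2.1 (hψ.pderiv 0).continuous)
    (integrable_mul_of_continuous h1.2.1 (hψ.pderiv 1).continuous)] at heq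
  have e : ∫ x, φ x * lap ψ x ∂torusMeasure =
      ∫ x, φ x * partialDeriv 0 (partialDeriv 0 ψ) x ∂torusMeasure +
        ∫ x, φ x * partialDeriv 1 (partialDeriv 1 ψ) x ∂torusMeasure := by
    simp only [lap, mul_add]
    exact integral_add
      (integrable_mul_of_continuous hs.integrable ((hψ.pderiv 0).pderiv 0).continuous)
      (integrable_mul_of_continuous hs.integrable ((hψ.pderiv 1).pderiv 1).continuous)
  have e2 : ∫ x, (δ ^ 2)⁻¹ * (ρ x - Real.exp (-φ x)) * ψ x ∂torusMeasure =
      -(δ ^ 2)⁻¹ * ∫ x, (Real.exp (-φ x) - ρ x) * ψ x ∂torusMeasure := by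
    rw [← integral_const_mul]
    refine integral_congr_ae (Eventually.of_forall fun x => ?_)
    simp only; ring
  rw [e, k0, k1, e2, ← heq]
  field_simp
  ring

lemma integral_mul_comp_nonneg (hs : IsWeakSolution δ ρ φ) (hδ : 0 < δ)
    (hρ : Integrable ρ torusMeasure) {h : ℝ → ℝ} (hh : ContDiff ℝ ((⊤ : ℕ∞) : WithTop ℕ∞) h)
    (hanti : Antitone h) {B : ℝ} (hB : ∀ y, |h y| ≤ B) :
    0 ≤ ∫ x, (ρ x - Real.exp (-φ x)) * h (φ x) ∂torusMeasure := by
  have h1 := (hs.hasWeakLap hδ hρ).integral_mul_comp_nonneg hh hanti hB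
  simp only [mul_assoc] at h1
  rw [integral_const_mul] at h1
  exact nonneg_of_mul_nonneg_right h1 (by positivity)

lemma aestronglyMeasurable_exp (hs : IsWeakSolution δ ρ φ) :
    AEStronglyMeasurable (fun x => Real.exp (-φ x)) torusMeasure := hs.integrable_exp.1

/-- The maximum principle: `e^{-φ}` is bounded by the supremum of `ρ`. -/
lemma memLp_top_exp (hs : IsWeakSolution δ ρ φ) (hδ : 0 < δ) (hρ : MemLp ρ ∞ torusMeasure) :
    MemLp (fun x => Real.exp (-φ x)) ∞ torusMeasure := by
  have hρ1 := hρ.integrable le_top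
  set R := (eLpNorm ρ ∞ torusMeasure).toReal + 1 with hR
  have hRpos : 0 < R := by positivity
  have hρR : ∀ᵐ x ∂torusMeasure, ρ x < R :=
    (ae_abs_le_of_memLp_top hρ).mono fun x hx => by linarith [le_abs_self (ρ x)]
  -- a decreasing function that is positive exactly where `e^{-y} > R`
  set h : ℝ → ℝ := fun y => Real.smoothTransition (-y - Real.log R) with hh
  have hcd : ContDiff ℝ ((⊤ : ℕ∞) : WithTop ℕ∞) h :=
    Real.smoothTransition.contDiff.comp (contDiff_neg.sub contDiff_const)
  have hanti : Antitone h := fun y z hyz => Real.smoothTransition.monotone (by linarith)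
  have hB : ∀ y, |h y| ≤ 1 := fun y => by
    rw [abs_of_nonneg (Real.smoothTransition.nonneg _)]; exact Real.smoothTransition.le_one _
  have h0 := hs.integral_mul_comp_nonneg hδ hρ1 hcd hanti hB
  -- the integrand is nonpositive, hence vanishes
  have hle : ∀ᵐ x ∂torusMeasure, 0 ≤ -((ρ x - Real.exp (-φ x)) * h (φ x)) := by
    filter_upwards [hρR] with x hx
    rw [neg_nonneg]
    by_cases hc : -φ x - Real.log R ≤ 0
    · rw [hh]; simp only; rw [Real.smoothTransition.zero_of_nonpos hc, mul_zero]
    · refine mul_nonpos_of_nonpos_of_nonneg ?_ (Real.smoothTransition.nonneg _)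
      have := (Real.log_lt_iff_lt_exp hRpos).1 (by linarith : Real.log R < -φ x)
      linarith
  have hint : Integrable (fun x => (ρ x - Real.exp (-φ x)) * h (φ x)) torusMeasure :=
    (hρ1.sub hs.integrable_exp).mul_bdd (c := 1)
      (hcd.continuous.comp_aestronglyMeasurable hs.integrable.1) (Eventually.of_forall fun x => hB _)
  have hz : ∫ x, -((ρ x - Real.exp (-φ x)) * h (φ x)) ∂torusMeasure = 0 :=
    le_antisymm (by rw [integral_neg]; linarith) (integral_nonneg_of_ae hle)
  rw [integral_eq_zero_iff_of_nonneg_ae hle hint.neg] at hz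
  refine memLp_top_of_bound hs.aestronglyMeasurable_exp R ?_
  filter_upwards [hρR, hz] with x hx hx0
  rw [Real.norm_of_nonneg (Real.exp_nonneg _)]
  by_contra! hlt
  have h3 : 0 < h (φ x) := Real.smoothTransition.pos_of_pos
    (by have := (Real.log_lt_iff_lt_exp hRpos).2 hlt; linarith)
  simp only [Pi.zero_apply, neg_eq_zero, mul_eq_zero] at hx0
  rcases hx0 with hx0 | hx0
  · linarith
  · exact h3.ne' hx0

/-- Testing with a regularisation of `e^{-(p-1)φ}` bounds `e^{-φ}` by `ρ` in every `L^p`. -/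
lemma eLpNorm_exp_le (hs : IsWeakSolution δ ρ φ) (hδ : 0 < δ) (hρ : MemLp ρ ∞ torusMeasure)
    {p : ℝ≥0∞} (hp : 1 < p) (hp' : p ≠ ∞) :
    eLpNorm (fun x => Real.exp (-φ x)) p torusMeasure ≤ eLpNorm ρ p torusMeasure := by
  obtain ⟨P, rfl⟩ : ∃ P : ℝ, p = ENNReal.ofReal P := ⟨p.toReal, (ENNReal.ofReal_toReal hp').symm⟩
  have hP1 : 1 < P := by simpa using hp
  have hP0 : 0 < P := by linarith
  have hρ1 := hρ.integrable le_top
  have hρP : MemLp ρ (ENNReal.ofReal P) torusMeasure := hρ.mono_exponent le_top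
  -- a bounded regularisation of `e^{-φ}` from below
  set v : ℝ → T2 → ℝ := fun η x => (Real.exp (φ x) + η)⁻¹ with hv
  have hvm : ∀ η, AEStronglyMeasurable (v η) torusMeasure := fun η =>
    ((Real.measurable_exp.comp_aemeasurable hs.integrable.1.aemeasurable).add_const
      η).inv.aestronglyMeasurable
  have hv0 : ∀ η, 0 < η → ∀ x, 0 < v η x := fun η hη x => by positivity
  have hvη : ∀ η, 0 < η → ∀ x, v η x ≤ η⁻¹ := fun η hη x =>
    inv_anti₀ hη (by linarith [Real.exp_pos (φ x)])
  have hvP : ∀ η, 0 < η → MemLp (v η) (ENNReal.ofReal P) torusMeasure := fun η hη =>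
    (memLp_top_of_bound (hvm η) η⁻¹ (Eventually.of_forall fun x => by
      rw [Real.norm_of_nonneg (hv0 η hη x).le]; exact hvη η hη x)).mono_exponent le_top
  have hnorm : ∀ {w : T2 → ℝ}, MemLp w (ENNReal.ofReal P) torusMeasure →
      eLpNorm w (ENNReal.ofReal P) torusMeasure =
        ENNReal.ofReal ((∫ x, |w x| ^ P ∂torusMeasure) ^ P⁻¹) := fun hw => by
    have := hw.eLpNorm_eq_integral_rpow_norm (by simpa using hP0) ENNReal.ofReal_ne_top
    simpa [ENNReal.toReal_ofReal hP0.le] using this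
  have hpow : ∀ {w : T2 → ℝ}, MemLp w (ENNReal.ofReal P) torusMeasure →
      Integrable (fun x => |w x| ^ P) torusMeasure := fun hw => by
    have := hw.integrable_norm_rpow (by simpa using hP0) ENNReal.ofReal_ne_top
    simpa [ENNReal.toReal_ofReal hP0.le] using this
  have key : ∀ η, 0 < η → eLpNorm (v η) (ENNReal.ofReal P) torusMeasure ≤
      eLpNorm ρ (ENNReal.ofReal P) torusMeasure := by
    intro η hη
    rw [hnorm (hvP η hη), hnorm hρP]
    refine ENNReal.ofReal_le_ofReal (Real.rpow_le_rpow (integral_nonneg fun x => by positivity)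
      ?_ (by positivity))
    set h : ℝ → ℝ := fun y => (Real.exp y + η) ^ (-(P - 1)) with hh
    have hpos : ∀ y, 0 < Real.exp y + η := fun y => by positivity
    have h0 := hs.integral_mul_comp_nonneg hδ hρ1 (h := h) (B := η ^ (-(P - 1)))
      ((Real.contDiff_exp.add contDiff_const).rpow_const_of_ne fun y => (hpos y).ne')
      (fun y z hyz => Real.rpow_le_rpow_of_nonpos (hpos y)
        (by linarith [Real.exp_le_exp.2 hyz]) (by linarith))
      (fun y => by
        rw [abs_of_nonneg (Real.rpow_nonneg (hpos y).le _)]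
        exact Real.rpow_le_rpow_of_nonpos hη (by linarith [Real.exp_pos y]) (by linarith))
    have hQ : P.HolderConjugate (P / (P - 1)) := Real.HolderConjugate.conjExponent hP1
    have hpt : ∀ x, (ρ x - Real.exp (-φ x)) * h (φ x) ≤
        P⁻¹ * (|ρ x| ^ P - |v η x| ^ P) := by
      intro x
      have hvx := hv0 η hη x
      have e1 : h (φ x) = v η x ^ (P - 1) := by
        simp only [hh, hv]
        rw [Real.rpow_neg (hpos _).le, Real.inv_rpow (hpos _).le]
      have e2 : v η x * v η x ^ (P - 1) = v η x ^ P := by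
        rw [mul_comm, ← Real.rpow_add_one hvx.ne', sub_add_cancel]
      have hge : v η x ≤ Real.exp (-φ x) := by
        rw [Real.exp_neg]; exact inv_anti₀ (Real.exp_pos _) (by linarith)
      have hY := Real.young_inequality_of_nonneg (abs_nonneg (ρ x))
        (Real.rpow_nonneg hvx.le (P - 1)) hQ
      rw [← Real.rpow_mul hvx.le, mul_div_cancel₀ _ (by linarith : P - 1 ≠ 0)] at hY
      rw [e1, abs_of_pos hvx]
      have hw : 0 ≤ v η x ^ (P - 1) := Real.rpow_nonneg hvx.le _
      calc (ρ x - Real.exp (-φ x)) * v η x ^ (P - 1)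
          ≤ (|ρ x| - v η x) * v η x ^ (P - 1) :=
            mul_le_mul_of_nonneg_right (by linarith [le_abs_self (ρ x)]) hw
        _ = |ρ x| * v η x ^ (P - 1) - v η x ^ P := by rw [sub_mul, e2]
        _ ≤ |ρ x| ^ P / P + v η x ^ P / (P / (P - 1)) - v η x ^ P := by linarith
        _ = _ := by field_simp; ring
    have hi := (hpow hρP).sub (hpow (hvP η hη))
    have h1 : ∫ x, (ρ x - Real.exp (-φ x)) * h (φ x) ∂torusMeasure ≤
        ∫ x, P⁻¹ * (|ρ x| ^ P - |v η x| ^ P) ∂torusMeasure := by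
      by_cases hint : Integrable (fun x => (ρ x - Real.exp (-φ x)) * h (φ x)) torusMeasure
      · exact integral_mono hint (hi.const_mul _) hpt
      · refine absurd ((hρ1.sub hs.integrable_exp).mul_bdd (c := η ^ (-(P - 1))) ?_
          (Eventually.of_forall fun x => ?_)) hint
        · have hc : Continuous h := (Real.continuous_exp.add continuous_const).rpow_const
            fun y => Or.inl (hpos y).ne'
          exact hc.comp_aestronglyMeasurable hs.integrable.1
        · rw [Real.norm_of_nonneg (Real.rpow_nonneg (hpos _).le _)]
          exact Real.rpow_le_rpow_of_nonpos hη (by linarith [Real.exp_pos (φ x)]) (by linarith)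
    rw [integral_const_mul, integral_sub (hpow hρP) (hpow (hvP η hη))] at h1
    have h2 := nonneg_of_mul_nonneg_right (h0.trans h1) (by positivity)
    linarith
  refine Lp.eLpNorm_le_of_ae_tendsto (u := atTop) (f := fun n : ℕ => v (1 / ((n : ℝ) + 1)))
    (Eventually.of_forall fun n => key _ (by positivity)) (fun n => hvm _)
    (Eventually.of_forall fun x => ?_)
  have h1 : Tendsto (fun n : ℕ => Real.exp (φ x) + 1 / ((n : ℝ) + 1)) atTop
      (𝓝 (Real.exp (φ x) + 0)) := tendsto_one_div_add_atTop_nhds_zero_nat.const_add _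
  rw [add_zero] at h1
  rw [Real.exp_neg]
  exact h1.inv₀ (Real.exp_pos _).ne'

/-- The total mass, by testing the equation with the constant one. -/
lemma integral_exp (hs : IsWeakSolution δ ρ φ) (hρ : Integrable ρ torusMeasure) :
    ∫ x, Real.exp (-φ x) ∂torusMeasure = ∫ x, ρ x ∂torusMeasure := by
  obtain ⟨G₀, G₁, h0, h1, heq⟩ := hs.weak_eq
  have h := heq _ (IsTest.const 1)
  have e : ∀ i, partialDeriv i (fun _ : T2 => (1 : ℝ)) = fun _ => 0 := fun i =>
    HasPartial.partialDeriv_eq fun x => hasDerivAt_const _ _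
  simp only [e, mul_zero, add_zero, integral_zero, mul_one] at h
  rw [integral_sub hs.integrable_exp hρ] at h
  linarith

lemma one_le_eLpNorm_exp (hs : IsWeakSolution δ ρ φ) (hρ : MemLp ρ ∞ torusMeasure)
    (h1 : ∫ x, ρ x ∂torusMeasure = 1) :
    1 ≤ eLpNorm (fun x => Real.exp (-φ x)) ∞ torusMeasure := by
  have h2 := hs.integral_exp (hρ.integrable le_top)
  have h3 : eLpNorm (fun x => Real.exp (-φ x)) 1 torusMeasure = 1 := by
    rw [eLpNorm_one_eq_lintegral_enorm, ← ofReal_integral_norm_eq_lintegral_enorm hs.integrable_exp]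
    simp only [Real.norm_of_nonneg (Real.exp_nonneg _), h2, h1, ENNReal.ofReal_one]
  rw [← h3]
  exact eLpNorm_le_eLpNorm_of_exponent_le le_top hs.aestronglyMeasurable_exp

/-- Second derivatives exist because the right hand side is bounded. -/
lemma exists_hasWeakPartial (hs : IsWeakSolution δ ρ φ) (hδ : 0 < δ) (hρ : MemLp ρ ∞ torusMeasure)
    (a b : ℕ) (hab : a + b ≤ 2) :
    ∃ g, HasWeakPartial a b φ g ∧ MemLp g 2 torusMeasure := by
  rcases Nat.lt_or_ge (a + b) 2 with h | h
  · exact hs.memSobolev a b (by omega)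
  · obtain ⟨C, hC, hreg⟩ := exists_hasWeakPartial_of_hasWeakLap (p := 2) (by norm_num) (by simp)
    have hw := hs.hasWeakLap hδ (hρ.integrable le_top)
    have hm : MemLp (fun x => (δ ^ 2)⁻¹ * (ρ x - Real.exp (-φ x))) 2 torusMeasure :=
      (((hρ.sub (hs.memLp_top_exp hδ hρ)).const_mul _).mono_exponent le_top)
    obtain ⟨g, h1, h2, -⟩ := hreg _ _ hw 0 0 _ (hasWeakPartial_zero hw.integrable_lap) hm a b
      (by omega)
    exact ⟨g, h1, h2⟩

lemma eLpNorm_top_le (hs : IsWeakSolution δ ρ φ) (hδ : 0 < δ) (hρ : MemLp ρ ∞ torusMeasure)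
    {q : ℝ≥0∞} (hq : 1 ≤ q) : eLpNorm φ ∞ torusMeasure ≤ sobolevNorm 2 q φ :=
  eLpNorm_top_le_sobolevNorm hs.integrable (fun a b hab => by
    obtain ⟨g, hg, -⟩ := hs.exists_hasWeakPartial hδ hρ a b hab
    exact ⟨g, hg⟩) hq

lemma memLp_top (hs : IsWeakSolution δ ρ φ) (hδ : 0 < δ) (hρ : MemLp ρ ∞ torusMeasure) :
    MemLp φ ∞ torusMeasure := by
  refine ⟨hs.integrable.1, (hs.eLpNorm_top_le hδ hρ (q := 2) (by norm_num)).trans_lt ?_⟩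
  refine ENNReal.sum_lt_top.2 fun k hk => ENNReal.sum_lt_top.2 fun α hα => ?_
  have h1 := Finset.HasAntidiagonal.mem_antidiagonal.1 hα
  have h2 := Finset.mem_range.1 hk
  obtain ⟨g, hg, hg2⟩ := hs.exists_hasWeakPartial hδ hρ α.1 α.2 (by omega)
  rw [weakPartialNorm_eq hg]
  exact hg2.eLpNorm_lt_top

end IsWeakSolution

/-! ### Higher regularity -/

section

lemma sobolevNorm_mono {k m : ℕ} (h : k ≤ m) (p : ℝ≥0∞) (f : T2 → ℝ) :
    sobolevNorm k p f ≤ sobolevNorm m p f :=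
  Finset.sum_le_sum_of_subset (Finset.range_subset_range.2 (by omega))

lemma weakPartialNorm_le_sobolevNorm {a b m : ℕ} (h : a + b ≤ m) (p : ℝ≥0∞) (f : T2 → ℝ) :
    weakPartialNorm a b p f ≤ sobolevNorm m p f := by
  have h1 : (a, b) ∈ Finset.HasAntidiagonal.antidiagonal (a + b) :=
    Finset.HasAntidiagonal.mem_antidiagonal.2 rfl
  have h2 := Finset.single_le_sum_of_canonicallyOrdered
    (f := fun α : ℕ × ℕ => weakPartialNorm α.1 α.2 p f) h1
  have h3 := Finset.single_le_sum_of_canonicallyOrdered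
    (f := fun k => gradNorm k p f) (Finset.mem_range.2 (by omega : a + b < m + 1))
  exact le_trans h2 h3

lemma MemSobolev.mono {k m : ℕ} (h : k ≤ m) {p : ℝ≥0∞} {f : T2 → ℝ} (hf : MemSobolev m p f) :
    MemSobolev k p f := fun a b hab => hf a b (hab.trans h)

lemma MemSobolev.exists_hasWeakPartial {m : ℕ} {p : ℝ≥0∞} {f : T2 → ℝ} (hf : MemSobolev m p f)
    {a b : ℕ} (hab : a + b ≤ m) :
    ∃ g, HasWeakPartial a b f g ∧ MemLp g p torusMeasure ∧
      eLpNorm g p torusMeasure ≤ sobolevNorm m p f := by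
  obtain ⟨g, h1, h2⟩ := hf a b hab
  refine ⟨g, h1, h2, ?_⟩
  rw [← weakPartialNorm_eq h1]
  exact weakPartialNorm_le_sobolevNorm hab p f

/-- The factor by which the derivatives of order `m` of `e^{-φ}` exceed the Sobolev norm of `ρ`. -/
def weight (m α : ℕ) (δ : ℝ) (φ : T2 → ℝ) : ℝ≥0∞ :=
  eLpNorm (fun x => Real.exp (-φ x)) ∞ torusMeasure ^ ((m : ℝ) / 2) *
    (1 + eLpNorm φ ∞ torusMeasure) ^ α * (1 + ENNReal.ofReal δ⁻¹ ^ m)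

/-- All derivatives of order `m` of `e^{-φ}` are bounded in `L^p` by the Sobolev norm of order `k`
of `ρ`, uniformly over all solutions. The orders `m` and `k` differ since the bound for `m + 2`
needs no more derivatives of `ρ` than the one for `m`. -/
def ExpDerivBound (m k α : ℕ) (p C : ℝ≥0∞) : Prop :=
  ∀ (δ : ℝ) (ρ φ : T2 → ℝ), 0 < δ → MemLp ρ ∞ torusMeasure → ∫ x, ρ x ∂torusMeasure = 1 →
    MemSobolev k p ρ → IsWeakSolution δ ρ φ → ∀ a b, a + b = m →
    ∃ g, HasWeakPartial a b (fun x => Real.exp (-φ x)) g ∧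
      eLpNorm g p torusMeasure ≤ C * weight m α δ φ * sobolevNorm k p ρ

lemma ExpDerivBound.mono {m k k' α : ℕ} {p C : ℝ≥0∞} (h : ExpDerivBound m k α p C) (hk : k ≤ k') :
    ExpDerivBound m k' α p C := fun δ ρ φ hδ hρ h1 hS hs a b hab => by
  obtain ⟨g, hg, hle⟩ := h δ ρ φ hδ hρ h1 (hS.mono hk) hs a b hab
  exact ⟨g, hg, hle.trans (mul_le_mul_right (sobolevNorm_mono hk p ρ) _)⟩

lemma one_le_weight {m α : ℕ} {δ : ℝ} {φ : T2 → ℝ}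
    (hE : 1 ≤ eLpNorm (fun x => Real.exp (-φ x)) ∞ torusMeasure) : 1 ≤ weight m α δ φ :=
  one_le_mul (one_le_mul ((ENNReal.one_rpow _).symm.trans_le
    (ENNReal.rpow_le_rpow hE (by positivity)))
    (one_le_pow₀ le_self_add)) le_self_add

variable {p : ℝ≥0∞}

/-- For order zero the bound is `‖e^{-φ}‖_p ≤ ‖ρ‖_p`. -/
lemma expDerivBound_zero (hp : 1 < p) (hp' : p ≠ ∞) : ExpDerivBound 0 0 0 p 1 := by
  intro δ ρ φ hδ hρ h1 hS hs a b hab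
  obtain ⟨rfl, rfl⟩ : a = 0 ∧ b = 0 := by omega
  refine ⟨_, hasWeakPartial_zero hs.integrable_exp, (hs.eLpNorm_exp_le hδ hρ hp hp').trans ?_⟩
  have h2 := weakPartialNorm_le_sobolevNorm (le_refl (0 + 0)) p ρ
  rw [weakPartialNorm_eq (hasWeakPartial_zero (hρ.integrable le_top))] at h2
  refine h2.trans (le_mul_of_one_le_left zero_le ?_)
  rw [one_mul]
  exact one_le_weight (hs.one_le_eLpNorm_exp hρ h1)

/-- The Poisson equation turns bounds for derivatives of order `m` of `e^{-φ}` into bounds for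
derivatives of order `m + 2` of `φ`. -/
lemma ExpDerivBound.exists_hasWeakPartial (hp : 1 < p) (hp' : p ≠ ∞) {m α : ℕ} {C : ℝ≥0∞}
    (hC : C ≠ ∞) (h : ExpDerivBound m m α p C) :
    ∃ D : ℝ≥0∞, D ≠ ∞ ∧ ∀ (δ : ℝ) (ρ φ : T2 → ℝ), 0 < δ → MemLp ρ ∞ torusMeasure →
      ∫ x, ρ x ∂torusMeasure = 1 → MemSobolev m p ρ → IsWeakSolution δ ρ φ →
      (∀ a b, a + b = m + 2 → ∃ g, HasWeakPartial a b φ g ∧ MemLp g p torusMeasure) ∧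
      gradNorm (m + 2) p φ ≤
        D * (ENNReal.ofReal δ⁻¹ ^ 2 * weight m α δ φ * sobolevNorm m p ρ) := by
  obtain ⟨A, hA, hreg⟩ := exists_hasWeakPartial_of_hasWeakLap hp hp'
  refine ⟨(m + 3) * (A * (1 + C)), by finiteness, fun δ ρ φ hδ hρ h1 hS hs => ?_⟩
  have hρ1 := hρ.integrable le_top
  have hW := one_le_weight (m := m) (α := α) (δ := δ) (hs.one_le_eLpNorm_exp hρ h1)
  have key : ∀ a b, a + b = m + 2 → ∃ g, HasWeakPartial a b φ g ∧ MemLp g p torusMeasure ∧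
      eLpNorm g p torusMeasure ≤ A * (1 + C) *
        (ENNReal.ofReal δ⁻¹ ^ 2 * weight m α δ φ * sobolevNorm m p ρ) := by
    intro a b hab
    -- split off two derivatives, to which the Calderón–Zygmund inequality applies
    obtain ⟨c, d, a', b', hcd, rfl, rfl⟩ :
        ∃ c d a' b', c + d = 2 ∧ a = c + a' ∧ b = d + b' := by
      rcases Nat.lt_or_ge a 2 with ha | ha
      · rcases Nat.lt_or_ge b 2 with hb | hb
        · exact ⟨1, 1, a - 1, b - 1, rfl, by omega, by omega⟩
        · exact ⟨0, 2, a, b - 2, rfl, by omega, by omega⟩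
      · exact ⟨2, 0, a - 2, b, rfl, by omega, by omega⟩
    obtain ⟨v, hv, hvle⟩ := h δ ρ φ hδ hρ h1 hS hs a' b' (by omega)
    obtain ⟨w, hw, hwp, hwle⟩ := hS.exists_hasWeakPartial (a := a') (b := b') (by omega)
    have hfin : sobolevNorm m p ρ ≠ ∞ := by
      refine ENNReal.sum_ne_top.2 fun k hk => ENNReal.sum_ne_top.2 fun β hβ => ?_
      have h3 := Finset.HasAntidiagonal.mem_antidiagonal.1 hβ
      have h4 := Finset.mem_range.1 hk
      obtain ⟨g, hg, hgp⟩ := hS β.1 β.2 (by omega)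
      rw [weakPartialNorm_eq hg]
      exact hgp.eLpNorm_ne_top
    have hWfin : weight m α δ φ ≠ ∞ := by
      have := (hs.memLp_top hδ hρ).eLpNorm_ne_top
      have := (hs.memLp_top_exp hδ hρ).eLpNorm_ne_top
      refine ENNReal.mul_ne_top (ENNReal.mul_ne_top (ENNReal.rpow_ne_top_of_nonneg (by positivity)
        this) (by finiteness)) (by finiteness)
    have hvp : MemLp v p torusMeasure := ⟨hv.2.1.1, hvle.trans_lt
      (ENNReal.mul_lt_top (ENNReal.mul_lt_top hC.lt_top hWfin.lt_top) hfin.lt_top)⟩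
    obtain ⟨g, hg, hgp, hgle⟩ := hreg _ _ (hs.hasWeakLap hδ hρ1) a' b' _
      (hw.sub_const_mul hv (δ ^ 2)⁻¹) ((hwp.sub hvp).const_mul _) c d hcd
    refine ⟨g, hg, hgp, hgle.trans ?_⟩
    have e : eLpNorm (fun x => (δ ^ 2)⁻¹ * (w x - v x)) p torusMeasure =
        ENNReal.ofReal δ⁻¹ ^ 2 * eLpNorm (w - v) p torusMeasure := by
      have := eLpNorm_const_smul (δ ^ 2)⁻¹ (w - v) p torusMeasure
      rw [Real.enorm_eq_ofReal (by positivity), ← inv_pow, ENNReal.ofReal_pow (by positivity),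
        inv_pow] at this
      exact this
    rw [e]
    calc A * (ENNReal.ofReal δ⁻¹ ^ 2 * eLpNorm (w - v) p torusMeasure)
        ≤ A * (ENNReal.ofReal δ⁻¹ ^ 2 * (weight m α δ φ * sobolevNorm m p ρ +
          C * weight m α δ φ * sobolevNorm m p ρ)) := by
          gcongr
          refine (eLpNorm_sub_le hwp.1 hvp.1 hp.le).trans (add_le_add ?_ hvle)
          exact hwle.trans (le_mul_of_one_le_left zero_le hW)
      _ = _ := by ring
  refine ⟨fun a b hab => ?_, ?_⟩
  · obtain ⟨g, hg, hgp, -⟩ := key a b hab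
    exact ⟨g, hg, hgp⟩
  · refine (Finset.sum_le_card_nsmul _ _ (A * (1 + C) *
        (ENNReal.ofReal δ⁻¹ ^ 2 * weight m α δ φ * sobolevNorm m p ρ)) fun β hβ => ?_).trans
        (le_of_eq ?_)
    · obtain ⟨g, hg, hgp, hle⟩ := key β.1 β.2 (Finset.HasAntidiagonal.mem_antidiagonal.1 hβ)
      rw [weakPartialNorm_eq hg]
      exact hle
    · rw [Finset.Nat.card_antidiagonal, nsmul_eq_mul]
      push_cast
      ring

lemma sq_mul_one_add_pow_le (D : ℝ≥0∞) (m : ℕ) : D ^ 2 * (1 + D ^ m) ≤ 2 * (1 + D ^ (m + 2)) := by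
  have h1 : D ^ 2 ≤ 1 + D ^ (m + 2) := by
    rcases le_total D 1 with h | h
    · exact (pow_le_one₀ zero_le h).trans le_self_add
    · exact (pow_le_pow_right₀ h (by omega)).trans le_add_self
  calc D ^ 2 * (1 + D ^ m) = D ^ 2 + D ^ (m + 2) := by ring
    _ ≤ (1 + D ^ (m + 2)) + (1 + D ^ (m + 2)) := add_le_add h1 le_add_self
    _ = _ := by ring

/-- Moser's estimate closes the recursion in steps of two derivatives. -/
lemma ExpDerivBound.succ_succ (hp : 1 < p) (hp' : p ≠ ∞) {m α : ℕ} {C : ℝ≥0∞} (hC : C ≠ ∞)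
    (h : ExpDerivBound m m α p C) :
    ∃ D : ℝ≥0∞, D ≠ ∞ ∧ ExpDerivBound (m + 2) m (α + (m + 2)) p D := by
  obtain ⟨A, hA, hreg⟩ := h.exists_hasWeakPartial hp hp' hC
  have hM : ∀ a b, ∃ B : ℝ≥0∞, B ≠ ∞ ∧ (a + b = m + 2 → ∀ φ : T2 → ℝ, MemLp φ ∞ torusMeasure →
      (∀ c d, c + d = m + 2 → ∃ g, HasWeakPartial c d φ g ∧ MemLp g p torusMeasure) →
      ∃ g, HasWeakPartial a b (fun x => Real.exp (-φ x)) g ∧ eLpNorm g p torusMeasure ≤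
        B * eLpNorm (fun x => Real.exp (-φ x)) ∞ torusMeasure *
          (1 + eLpNorm φ ∞ torusMeasure) ^ (m + 2) * gradNorm (m + 2) p φ) := by
    intro a b
    by_cases hab : a + b = m + 2
    · obtain ⟨B, hB, h⟩ := exists_hasWeakPartial_exp_neg hp hp' (by omega : 1 ≤ a + b)
      rw [hab] at h
      exact ⟨B, hB, fun _ => h⟩
    · exact ⟨0, by simp, fun h => absurd h hab⟩
  choose B hB hM using hM
  refine ⟨(∑ β ∈ Finset.HasAntidiagonal.antidiagonal (m + 2), B β.1 β.2) * (A * 2),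
    ENNReal.mul_ne_top (ENNReal.sum_ne_top.2 fun β _ => hB _ _) (by finiteness),
    fun δ ρ φ hδ hρ h1 hS hs a b hab => ?_⟩
  obtain ⟨hex, hgrad⟩ := hreg δ ρ φ hδ hρ h1 hS hs
  obtain ⟨g, hg, hle⟩ := hM a b hab φ (hs.memLp_top hδ hρ) hex
  refine ⟨g, hg, hle.trans ?_⟩
  have hE1 := hs.one_le_eLpNorm_exp hρ h1
  have hEt := (hs.memLp_top_exp hδ hρ).eLpNorm_ne_top
  unfold weight at hgrad ⊢
  set E := eLpNorm (fun x => Real.exp (-φ x)) ∞ torusMeasure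
  set M := eLpNorm φ ∞ torusMeasure
  set D := ENNReal.ofReal δ⁻¹
  have hEp : E * E ^ ((m : ℝ) / 2) = E ^ (((m + 2 : ℕ) : ℝ) / 2) := by
    rw [show (((m + 2 : ℕ) : ℝ) / 2) = 1 + (m : ℝ) / 2 by push_cast; ring,
      ENNReal.rpow_add _ _ (zero_lt_one.trans_le hE1).ne' hEt, ENNReal.rpow_one]
  have hBle : B a b ≤ ∑ β ∈ Finset.HasAntidiagonal.antidiagonal (m + 2), B β.1 β.2 := by
    have hmem : (a, b) ∈ Finset.HasAntidiagonal.antidiagonal (m + 2) :=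
      Finset.HasAntidiagonal.mem_antidiagonal.2 hab
    have := Finset.single_le_sum_of_canonicallyOrdered (f := fun β : ℕ × ℕ => B β.1 β.2) hmem
    exact this
  set T := ∑ β ∈ Finset.HasAntidiagonal.antidiagonal (m + 2), B β.1 β.2
  calc B a b * E * (1 + M) ^ (m + 2) * gradNorm (m + 2) p φ
      ≤ T * E * (1 + M) ^ (m + 2) * (A * (D ^ 2 * (E ^ ((m : ℝ) / 2) * (1 + M) ^ α *
          (1 + D ^ m)) * sobolevNorm m p ρ)) := by gcongr
    _ = T * A * (E * E ^ ((m : ℝ) / 2)) * (1 + M) ^ (α + (m + 2)) * (D ^ 2 * (1 + D ^ m)) *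
          sobolevNorm m p ρ := by rw [pow_add]; ring
    _ ≤ T * A * (E * E ^ ((m : ℝ) / 2)) * (1 + M) ^ (α + (m + 2)) *
          (2 * (1 + D ^ (m + 2))) * sobolevNorm m p ρ := by
          exact mul_le_mul_left (mul_le_mul_right (sq_mul_one_add_pow_le D m) _) _
    _ = _ := by rw [hEp]; ring

/-- The interpolation inequality for weak derivatives, with all norms in `L^p`. -/
lemma exists_sq_eLpNorm_hasWeakPartial_le (hp : 1 < p) (hp' : p ≠ ∞) :
    ∃ C : ℝ≥0∞, C ≠ ∞ ∧ ∀ (f g h : T2 → ℝ) (a b : ℕ), a + b = 1 → HasWeakPartial a b f g →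
      HasWeakPartial (a + a) (b + b) f h →
      eLpNorm g p torusMeasure ^ 2 ≤ C * (eLpNorm f p torusMeasure * eLpNorm h p torusMeasure) := by
  obtain ⟨C, hC, hGN⟩ := exists_sq_eLpNorm_partialDeriv_le hp hp (two_mul p⁻¹).symm
  refine ⟨C, hC, fun f g h a b hab hg hh => ?_⟩
  have ht : ∀ N, IsTest (fejer N f) := fun N => isTest_fejer N hg.1
  have hle : ∀ N, eLpNorm (fejer N g) p torusMeasure ≤
      (C * (eLpNorm f p torusMeasure * eLpNorm h p torusMeasure)) ^ (2 : ℝ)⁻¹ := by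
    intro N
    rw [ENNReal.le_rpow_inv_iff two_pos]
    have h1 : eLpNorm (pd a b (fejer N f)) p torusMeasure ^ 2 ≤
        C * (eLpNorm (fejer N f) p torusMeasure *
          eLpNorm (pd (a + a) (b + b) (fejer N f)) p torusMeasure) := by
      have : (a = 1 ∧ b = 0) ∨ (a = 0 ∧ b = 1) := by omega
      rcases this with ⟨rfl, rfl⟩ | ⟨rfl, rfl⟩
      · exact hGN _ (ht N) 0
      · exact hGN _ (ht N) 1
    rw [hg.pd_fejer, hh.pd_fejer] at h1
    have h2 : eLpNorm (fejer N g) p torusMeasure ^ (2 : ℝ) =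
        eLpNorm (fejer N g) p torusMeasure ^ 2 := by exact_mod_cast ENNReal.rpow_natCast _ 2
    rw [h2]
    refine h1.trans ?_
    gcongr
    · exact eLpNorm_fejer_le N hg.1.1 hp.le hp'
    · exact eLpNorm_fejer_le N hh.2.1.1 hp.le hp'
  have h3 := eLpNorm_le_of_tendsto_one (U := fun N => fejer N g)
    (fun N => (isTest_fejer N hg.2.1).continuous.aestronglyMeasurable) hg.2.1.1
    (tendsto_eLpNorm_fejer_sub le_rfl ENNReal.one_ne_top (memLp_one_iff_integrable.2 hg.2.1)) hle
  rw [ENNReal.le_rpow_inv_iff two_pos] at h3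
  exact_mod_cast h3

/-- The bound for first derivatives, by interpolation between orders zero and two. -/
lemma exists_expDerivBound_one (hp : 1 < p) (hp' : p ≠ ∞) :
    ∃ C : ℝ≥0∞, C ≠ ∞ ∧ ExpDerivBound 1 1 2 p C := by
  obtain ⟨A, hA, h2⟩ := (expDerivBound_zero hp hp').succ_succ hp hp' ENNReal.one_ne_top
  obtain ⟨B, hB, hGN⟩ := exists_sq_eLpNorm_hasWeakPartial_le hp hp'
  refine ⟨1 + B * A, by finiteness, fun δ ρ φ hδ hρ h1 hS hs a b hab => ?_⟩
  have hex := h2 δ ρ φ hδ hρ h1 (hS.mono zero_le_one) hs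
  have hu : MemLp (fun x => Real.exp (-φ x)) p torusMeasure :=
    (hs.memLp_top_exp hδ hρ).mono_exponent le_top
  have hE1 := hs.one_le_eLpNorm_exp hρ h1
  have hEt := (hs.memLp_top_exp hδ hρ).eLpNorm_ne_top
  have hMt := (hs.memLp_top hδ hρ).eLpNorm_ne_top
  have hu0 := hs.eLpNorm_exp_le hδ hρ hp hp'
  have hρ0 := weakPartialNorm_le_sobolevNorm (le_refl (0 + 0)) p ρ
  rw [weakPartialNorm_eq (hasWeakPartial_zero (hρ.integrable le_top))] at hρ0
  have hρp : sobolevNorm 0 p ρ ≠ ∞ := by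
    have : sobolevNorm 0 p ρ = eLpNorm ρ p torusMeasure := by
      simp [sobolevNorm, gradNorm, weakPartialNorm_eq (hasWeakPartial_zero (hρ.integrable le_top))]
    rw [this]
    exact (hρ.mono_exponent le_top).eLpNorm_ne_top
  have h01 := sobolevNorm_mono zero_le_one p ρ
  unfold weight at hex ⊢
  set E := eLpNorm (fun x => Real.exp (-φ x)) ∞ torusMeasure
  set M := eLpNorm φ ∞ torusMeasure
  set D := ENNReal.ofReal δ⁻¹ with hD
  obtain ⟨g, hg, -⟩ := exists_hasWeakPartial_of_succ (p := p) hp.le hp' hs.integrable_exp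
    (by omega : 1 ≤ a + b) fun c d hcd => by
      obtain ⟨g, hg, hle⟩ := hex c d (by omega)
      refine ⟨g, hg, hg.2.1.1, hle.trans_lt (ENNReal.mul_lt_top (ENNReal.mul_lt_top hA.lt_top
        (ENNReal.mul_lt_top (ENNReal.mul_lt_top (ENNReal.rpow_lt_top_of_nonneg (by positivity) hEt)
          ?_) ?_)) hρp.lt_top)⟩ <;> finiteness
  obtain ⟨w, hw, hwle⟩ := hex (a + a) (b + b) (by omega)
  refine ⟨g, hg, ?_⟩
  have hsq := hGN _ _ _ a b hab hg hw
  have hEs : E ^ (((0 + 2 : ℕ) : ℝ) / 2) = (E ^ (((1 : ℕ) : ℝ) / 2)) ^ 2 := by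
    rw [← ENNReal.rpow_natCast, ← ENNReal.rpow_mul]; norm_num
  have hfin : eLpNorm g p torusMeasure ^ 2 ≤ ((1 + B * A) * (E ^ (((1 : ℕ) : ℝ) / 2) *
      (1 + M) ^ 2 * (1 + D ^ 1)) * sobolevNorm 1 p ρ) ^ 2 := by
    refine hsq.trans ?_
    calc B * (eLpNorm (fun x => Real.exp (-φ x)) p torusMeasure * eLpNorm w p torusMeasure)
        ≤ B * (sobolevNorm 1 p ρ * (A * (E ^ (((0 + 2 : ℕ) : ℝ) / 2) * (1 + M) ^ (0 + (0 + 2)) *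
            (1 + D ^ (0 + 2))) * sobolevNorm 1 p ρ)) := by
          gcongr
          · exact hu0.trans (hρ0.trans h01)
          · exact hwle.trans (by gcongr)
      _ = (B * A) * (E ^ (((1 : ℕ) : ℝ) / 2)) ^ 2 * (1 + M) ^ 2 * (1 + D ^ 2) *
            sobolevNorm 1 p ρ ^ 2 := by rw [hEs]; ring
      _ ≤ (1 + B * A) ^ 2 * (E ^ (((1 : ℕ) : ℝ) / 2)) ^ 2 * (1 + M) ^ 4 * (1 + D) ^ 2 *
            sobolevNorm 1 p ρ ^ 2 := by
          gcongr
          · calc B * A ≤ 1 + B * A := le_add_self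
              _ ≤ (1 + B * A) ^ 2 := le_self_pow₀ le_self_add two_ne_zero
          · exact le_self_add
          · norm_num
          · calc 1 + D ^ 2 ≤ (1 + D ^ 2) + 2 * D := le_self_add
              _ = (1 + D) ^ 2 := by ring
      _ = _ := by ring
  by_contra! hlt
  exact absurd hfin (not_le.2 (ENNReal.pow_lt_pow_left two_ne_zero hlt))

/-- The bound in all orders. The exponent `α` depends on the order only, not on `p`. -/
lemma exists_expDerivBound (m : ℕ) : ∃ α : ℕ, ∀ p : ℝ≥0∞, 1 < p → p ≠ ∞ →
    ∃ C : ℝ≥0∞, C ≠ ∞ ∧ ExpDerivBound m m α p C := by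
  induction m using Nat.twoStepInduction with
  | zero => exact ⟨0, fun p hp hp' => ⟨1, by simp, expDerivBound_zero hp hp'⟩⟩
  | one => exact ⟨2, fun p hp hp' => exists_expDerivBound_one hp hp'⟩
  | more m ih _ =>
    obtain ⟨α, h⟩ := ih
    refine ⟨α + (m + 2), fun p hp hp' => ?_⟩
    obtain ⟨C, hC, h⟩ := h p hp hp'
    obtain ⟨D, hD, h⟩ := h.succ_succ hp hp' hC
    exact ⟨D, hD, h.mono (by omega)⟩

/-- On the torus the derivatives of order `s` control those of all lower positive orders. -/
lemma memSobolev_of_top_order (hp : 1 ≤ p) (hp' : p ≠ ∞) {f : T2 → ℝ} (hf : MemLp f p torusMeasure)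
    {s : ℕ} (h : ∀ a b, a + b = s → ∃ g, HasWeakPartial a b f g ∧ MemLp g p torusMeasure) :
    MemSobolev s p f := by
  have hf1 := hf.integrable hp
  have key : ∀ j a b, a + b + j = s → 1 ≤ a + b →
      ∃ g, HasWeakPartial a b f g ∧ MemLp g p torusMeasure := by
    intro j
    induction j with
    | zero => exact fun a b hab _ => h a b hab
    | succ j ih =>
      exact fun a b hab h1 => exists_hasWeakPartial_of_succ hp hp' hf1 h1 fun c d hcd =>
        ih c d (by omega) (by omega)
  intro a b hab
  rcases Nat.eq_zero_or_pos (a + b) with h0 | h0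
  · obtain ⟨rfl, rfl⟩ : a = 0 ∧ b = 0 := by omega
    exact ⟨f, hasWeakPartial_zero hf1, hf⟩
  · exact key (s - (a + b)) a b (by omega) h0

lemma one_add_pow_le (X : ℝ≥0∞) (α : ℕ) : (1 + X) ^ α ≤ 2 ^ α * (1 + X ^ α) := by
  rcases le_total X 1 with h | h
  · calc (1 + X) ^ α ≤ (1 + 1) ^ α := by gcongr
      _ = 2 ^ α * 1 := by norm_num
      _ ≤ _ := by gcongr; exact le_self_add
  · calc (1 + X) ^ α ≤ (X + X) ^ α := by gcongr
      _ = 2 ^ α * X ^ α := by rw [← two_mul, mul_pow]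
      _ ≤ _ := by gcongr; exact le_add_self

end

end PoissonBoltzmann

end

theorem proposition3p3 (s : ℕ) (hs : 2 ≤ s) :
    ∃ α : ℕ, ∀ p q : ℝ≥0∞, 1 < p → p < ∞ → 1 < q → ∃ K : ℝ, 0 < K ∧
      ∀ ρ : PoissonBoltzmann.T2 → ℝ,
        PoissonBoltzmann.MemSobolev (s - 2) p ρ →
        MemLp ρ ∞ PoissonBoltzmann.torusMeasure →
        ∫ x, ρ x ∂PoissonBoltzmann.torusMeasure = 1 →
      ∀ δ : ℝ, 0 < δ → ∀ φ : PoissonBoltzmann.T2 → ℝ,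
        PoissonBoltzmann.IsWeakSolution δ ρ φ →
        PoissonBoltzmann.MemSobolev s p φ ∧
        PoissonBoltzmann.gradNorm s p φ ≤
          ENNReal.ofReal (K / δ ^ 2) *
          (1 + eLpNorm (fun x => Real.exp (-φ x)) ∞ PoissonBoltzmann.torusMeasure
                ^ (((s : ℝ) - 2) / 2)) *
          (1 + PoissonBoltzmann.sobolevNorm 2 q φ ^ α) *
          ENNReal.ofReal (1 + 1 / δ ^ (s - 2)) *
          PoissonBoltzmann.sobolevNorm (s - 2) p ρ := by
  obtain ⟨m, rfl⟩ := Nat.exists_eq_add_of_le' hs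
  simp only [Nat.add_sub_cancel]
  obtain ⟨α, h⟩ := PoissonBoltzmann.exists_expDerivBound m
  refine ⟨α, fun p q hp hp' hq => ?_⟩
  obtain ⟨C, hC, h⟩ := h p hp hp'.ne
  obtain ⟨A, hA, h⟩ := h.exists_hasWeakPartial hp hp'.ne hC
  refine ⟨(A * 2 ^ α).toReal + 1, by positivity, fun ρ hS hρ h1 δ hδ φ hφ => ?_⟩
  obtain ⟨hex, hgrad⟩ := h δ ρ φ hδ hρ h1 hS hφ
  refine ⟨PoissonBoltzmann.memSobolev_of_top_order hp.le hp'.ne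
    ((hφ.memLp_top hδ hρ).mono_exponent le_top) hex, hgrad.trans ?_⟩
  have hM := hφ.eLpNorm_top_le hδ hρ hq.le
  have e1 : (((m + 2 : ℕ) : ℝ) - 2) / 2 = (m : ℝ) / 2 := by push_cast; ring
  have e2 : ENNReal.ofReal (1 + 1 / δ ^ m) = 1 + ENNReal.ofReal δ⁻¹ ^ m := by
    rw [ENNReal.ofReal_add zero_le_one (by positivity), ENNReal.ofReal_one, one_div, ← inv_pow,
      ENNReal.ofReal_pow (by positivity)]
  have e3 : A * 2 ^ α * ENNReal.ofReal δ⁻¹ ^ 2 ≤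
      ENNReal.ofReal (((A * 2 ^ α).toReal + 1) / δ ^ 2) := by
    rw [div_eq_mul_inv, ← inv_pow, ENNReal.ofReal_mul (by positivity),
      ENNReal.ofReal_pow (by positivity)]
    gcongr
    rw [ENNReal.ofReal_add (by positivity) zero_le_one,
      ENNReal.ofReal_toReal (by finiteness)]
    exact le_self_add
  rw [e1, e2]
  unfold PoissonBoltzmann.weight
  set E := eLpNorm (fun x => Real.exp (-φ x)) ∞ PoissonBoltzmann.torusMeasure
  set M := eLpNorm φ ∞ PoissonBoltzmann.torusMeasure
  set X := PoissonBoltzmann.sobolevNorm 2 q φ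
  set S := PoissonBoltzmann.sobolevNorm m p ρ
  set D := ENNReal.ofReal δ⁻¹
  calc A * (D ^ 2 * (E ^ ((m : ℝ) / 2) * (1 + M) ^ α * (1 + D ^ m)) * S)
      ≤ A * (D ^ 2 * ((1 + E ^ ((m : ℝ) / 2)) * (2 ^ α * (1 + X ^ α)) * (1 + D ^ m)) * S) := by
        gcongr
        · exact le_add_self
        · exact (pow_le_pow_left' (add_le_add_right hM 1) α).trans
            (PoissonBoltzmann.one_add_pow_le X α)
    _ = A * 2 ^ α * D ^ 2 * (1 + E ^ ((m : ℝ) / 2)) * (1 + X ^ α) * (1 + D ^ m) * S := by ring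
    _ ≤ _ := by gcongr
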